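/- **Theorem (Locally computable energy norm estimate).** *Mesh.* Let $d\in\{2,3\}$ and let $\tau_h$ be a finite conforming simplicial triangulation (no hanging nodes) of a bounded domain (open, connected) $\Omega\subset\mathbb R^d$, where $\Omega$ is the interior of the union of the closed simplices $t\in\tau_h$. Let $\mathcal T_H$ be a coarse partition: each $T\in\mathcal T_H$ is the interior of the union of the simplices in a nonempty set $\tau_h^T$, and the sets $\tau_h^T$ partition $\tau_h$. Write $h_T,h_e$ for diameters. To a face $e$ belong a neighbour $t^-$, for an inner face also the other neighbour $t^+$, and the unit normal $n_e$ pointing out of $t^-$; $q^\pm$ are the traces from $t^\pm$. A face is *inside* $T$ if both its neighbours belong to $\tau_h^T$; all other faces, including those on $\partial\Omega$, are *coupling faces*. Put $H^1(\tau_h)=\{q\in L^2(\Omega): q|_t\in H^1(t)\ \forall t\in\tau_h\}$, with broken gradient $\nabla_h$. *Data.* Let $\mathcal P$ be a parameter set and $f\in L^2(\Omega)$. Let $\kappa$ be constant, symmetric and positive definite on each $t\in\tau_h$. Let $\lambda(\mu)=\sum_{\xi=1}^{N}\theta_\xi(\mu)\lambda_\xi$ with $\theta_\xi:\mathcal P\to(0,\infty)$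 and with bounded, measurable, nonnegative $\lambda_\xi$ that have bounded measurable one-sided traces on the faces, and let $\lambda(\mu)\ge c$ for some $c>0$ independent of $\mu\in\mathcal P$. Set $$\alpha(\mu,\nu)=\min_\xi\frac{\theta_\xi(\mu)}{\theta_\xi(\nu)},\qquad \gamma(\mu,\nu)=\max_\xi\frac{\theta_\xi(\mu)}{\theta_\xi(\nu)},$$ and let $c^T$ be the infimum over $\mu\in\mathcal P$ and $t\in\tau_h^T$ of the (essential infimum over $t$ of the) smallest eigenvalue of $\lambda(\mu)\kappa|_t$. For $S\subset\Omega$ put $b^S(p,q;\mu)=\int_S(\lambda(\mu)\kappa\nabla_hp)\cdot\nabla_hq$; further $|||q|||_{\mu,T}=b^T(q,q;\mu)^{1/2}$ and $|||q|||_\mu=\big(\sum_{T}|||q|||_{\mu,T}^2\big)^{1/2}$. Let $p(\mu)\in H^1_0(\Omega)$ be the weak solution: $\sum_Tb^T(p(\mu),q;\mu)=\int_\Omega fq$ for all $q\in H_0^1(\Omega)$. For each $T$ let $C_P^T>0$ satisfy the Poincaré inequality $\|\varphi-\Pi_0^T\varphi\|_{L^2(T)}^2\le C_P^Th_T^2\|\nabla\varphi\|_{L^2(T)}^2$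 for all $\varphi\in H^1(T)$, where $\Pi_0^T\varphi$ is the mean value of $\varphi$ over $T$. *Discretization.* Let $k\ge1$. For each $T$ let $Q_h^{k,T}$ be either the space of functions that are polynomials of degree at most $k$ on every $t\in\tau_h^T$, or its subspace of functions continuous on $\overline T$; and choose one of NIPDG, IIPDG, SIPDG, SWIPDG, with symmetry parameter $\vartheta=-1,0,1,1$ respectively. Let $Q_h^k=\{q: q|_T\in Q_h^{k,T}\ \forall T\}$. With $\delta_e^\pm=n_e\cdot\kappa^\pm n_e$, the weights on an inner face are $\omega_e^\mp=\delta_e^\pm/(\delta_e^++\delta_e^-)$ on coupling faces and on faces inside an SWIPDG element, and $\omega_e^\pm=\tfrac12$ otherwise. On inner faces $[q]=q^--q^+$ and $\{q\}=\omega_e^-q^-+\omega_e^+q^+$; on boundary faces $[q]=\{q\}=q$. Let $$b_c^e(p,q;\mu)=-\int_e\{(\lambda(\mu)\kappa\nabla p)\cdot n_e\}[q]\,ds,\qquad b_p^e(p,q;\mu)=\int_e\sigma_e(\mu)[p][q]\,ds,$$ $\sigma_e(\mu)=\sigma h_e^{-1}\{\lambda(\mu)\}\,\delta_e^+\delta_e^-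 /(\delta_e^++\delta_e^-)$ on inner faces and $\sigma_e(\mu)=\sigma h_e^{-1}\{\lambda(\mu)\}\,\delta_e^-$ on boundary faces, with $\sigma\ge1$. Put $$b_h(p,q;\mu)=\sum_{T}\Big[b^T(p,q;\mu)+\sum_{e\text{ inside }T}\big(\vartheta^Tb_c^e(q,p;\mu)+b_c^e(p,q;\mu)+b_p^e(q,p;\mu)\big)\Big]+\sum_{e\text{ coupling}}\big(b_c^e(q,p;\mu)+b_c^e(p,q;\mu)+b_p^e(q,p;\mu)\big).$$ Let $Q_{\rm red}^T\subset Q_h^{k,T}$ be linear subspaces that contain the constant function $1$, and $Q_{\rm red}=\{q\in Q_h^k: q|_T\in Q_{\rm red}^T\ \forall T\}$. A *DG solution* $p_h(\mu)\in Q_h^k$, respectively a *reduced solution* $p_{\rm red}(\mu)\in Q_{\rm red}$, satisfies $b_h(\cdot,q;\mu)=\int_\Omega fq$ for all $q$ in $Q_h^k$, respectively in $Q_{\rm red}$. *Reconstructions.* For $q\in Q_h^k$, the Oswald interpolant $I_{\rm os}[q]$ is the function, polynomial of degree at most $k$ on each $t$, whose value at a Lagrange node $\nu$ of order $k$ is $0$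 if $\nu\in\partial\Omega$, and otherwise the mean of the values $q|_t(\nu)$ over all $t\in\tau_h$ with $\nu\in t$. Let $k-1\le l\le k$. A diffusive flux reconstruction $R_h^l[q;\mu]$ of $q$ is a $v\in H_{\rm div}(\Omega)$ with $v|_t\in[\mathbb P_l(t)]^d+x\,\mathbb P_l(t)$ for every $t\in\tau_h$, such that for all $t\in\tau_h$ $$\int_e(v\cdot n_e)\,r\,ds=-\int_e\{(\lambda(\mu)\kappa\nabla q)\cdot n_e\}\,r\,ds+\int_e\sigma_e(\mu)[q]\,r\,ds\qquad\text{for all faces }e\text{ of }t,\ r\in\mathbb P_l(e),$$ $$\int_tv\cdot\nabla r\,dx=-b^t(q,r;\mu)-\sum_{e\subset\partial t}\vartheta_e\,b_c^e(r,q;\mu)\qquad\text{for all }r\in\mathbb P_l(t),$$ where in $b_c^e(r,q;\mu)$ the polynomial $r$ is extended by zero outside $t$, $\vartheta_e=\vartheta^T$ for $e$ inside $T$, and $\vartheta_e=1$ on coupling faces. *Claim.* For all $\mu,\bar\mu,\hat\mu\in\mathcal P$, every DG solution $p_h(\mu)$ and every reduced solution $p_{\rm red}(\mu)$, $$|||p(\mu)-p_h(\mu)|||_{\bar\mu}\le\eta(p_h(\mu);\mu,\bar\mu,\hat\mu),\qquad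 |||p(\mu)-p_{\rm red}(\mu)|||_{\bar\mu}\le\eta(p_{\rm red}(\mu);\mu,\bar\mu,\hat\mu),$$ where $$\eta(q;\mu,\bar\mu,\hat\mu)=\tfrac1{\sqrt{\alpha(\mu,\bar\mu)}}\Big[\sqrt{\gamma(\mu,\bar\mu)}\Big(\sum_T(\eta_{\rm nc}^T)^2\Big)^{1/2}+\Big(\sum_T(\eta_{\rm r}^T)^2\Big)^{1/2}+\tfrac1{\sqrt{\alpha(\mu,\hat\mu)}}\Big(\sum_T(\eta_{\rm df}^T)^2\Big)^{1/2}\Big]$$ and, with any diffusive flux reconstruction $v=R_h^l[q;\mu]$ of $q$, $$\eta_{\rm nc}^T=|||q-I_{\rm os}[q]|||_{\bar\mu,T},\quad \eta_{\rm r}^T=\Big(\frac{C_P^T}{c^T}\Big)^{1/2}h_T\|f-\nabla\cdot v\|_{L^2(T)},\quad \eta_{\rm df}^T=\big\|(\lambda(\hat\mu)\kappa)^{-1/2}\big(\lambda(\mu)\kappa\nabla_hq+v\big)\big\|_{L^2(T)}.$$ -/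

import Mathlib

open MeasureTheory Filter Topology
open scoped ContDiff

noncomputable section

namespace LRBMS

/-- Euclidean space `ℝ^d`. -/
abbrev E (d : ℕ) : Type := EuclideanSpace ℝ (Fin d)

/-! ### Sobolev spaces through test functions -/

section Sobolev

variable {d : ℕ}

/-- `φ ∈ C_c^∞(U)`. -/
def IsTest (U : Set (E d)) (φ : E d → ℝ) : Prop :=
  ContDiff ℝ ∞ φ ∧ HasCompactSupport φ ∧ tsupport φ ⊆ U

/-- `G` is the weak gradient of `u` on the open set `U`. -/
def IsWeakGrad (U : Set (E d)) (u : E d → ℝ) (G : E d → E d) : Prop :=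
  ∀ φ : E d → ℝ, IsTest U φ → ∀ w : E d,
    ∫ x in U, u x * fderiv ℝ φ x w = -∫ x in U, inner ℝ (G x) w * φ x

/-- `u ∈ H¹(U)`. -/
def MemH1 (U : Set (E d)) (u : E d → ℝ) : Prop :=
  MemLp u 2 (volume.restrict U) ∧
    ∃ G : E d → E d, MemLp G 2 (volume.restrict U) ∧ IsWeakGrad U u G

open scoped Classical in
/-- The weak gradient of `u ∈ H¹(U)` (unique almost everywhere on `U`), and `0` for other `u`. -/
def weakGrad (U : Set (E d)) (u : E d → ℝ) : E d → E d :=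
  if h : ∃ G : E d → E d, MemLp G 2 (volume.restrict U) ∧ IsWeakGrad U u G then h.choose else 0

/-- `u ∈ H¹₀(U)`, the closure of `C_c^∞(U)` in `H¹(U)`. -/
def MemH10 (U : Set (E d)) (u : E d → ℝ) : Prop :=
  MemLp u 2 (volume.restrict U) ∧
    ∃ G : E d → E d, MemLp G 2 (volume.restrict U) ∧
      ∃ φ : ℕ → E d → ℝ, (∀ n, IsTest U (φ n)) ∧
        Tendsto (fun n => eLpNorm (fun x => u x - φ n x) 2 (volume.restrict U)) atTop (𝓝 0) ∧
        Tendsto (fun n => eLpNorm (fun x => G x - gradient (φ n) x) 2 (volume.restrict U))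
          atTop (𝓝 0)

/-- `g` is the weak divergence of `v` on the open set `U`. -/
def IsWeakDiv (U : Set (E d)) (v : E d → E d) (g : E d → ℝ) : Prop :=
  ∀ φ : E d → ℝ, IsTest U φ →
    ∫ x in U, inner ℝ (v x) (gradient φ x) = -∫ x in U, g x * φ x

/-- `v ∈ H_div(U)`. -/
def MemHdiv (U : Set (E d)) (v : E d → E d) : Prop :=
  MemLp v 2 (volume.restrict U) ∧ ∃ g : E d → ℝ, MemLp g 2 (volume.restrict U) ∧ IsWeakDiv U v g

open scoped Classical in
/-- The divergence of `v ∈ H_div(U)` (unique almost everywhere on `U`), and `0` for other `v`. -/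
def weakDiv (U : Set (E d)) (v : E d → E d) : E d → ℝ :=
  if h : ∃ g : E d → ℝ, MemLp g 2 (volume.restrict U) ∧ IsWeakDiv U v g then h.choose else 0

/-- The Poincaré inequality `‖φ - Π₀φ‖² ≤ C h² ‖∇φ‖²` on `U`, with `h` the diameter of `U` and
`Π₀φ` the mean value of `φ` over `U`. -/
def PoincareOn (U : Set (E d)) (C : ℝ) : Prop :=
  ∀ φ : E d → ℝ, MemH1 U φ →
    ∫ x in U, (φ x - ⨍ y in U, φ y) ^ 2
      ≤ C * Metric.diam U ^ 2 * ∫ x in U, ‖weakGrad U φ x‖ ^ 2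

end Sobolev

/-! ### Polynomials -/

/-- The polynomial function on `ℝ^d` given by a polynomial. -/
def polyFun (d : ℕ) : MvPolynomial (Fin d) ℝ →ₗ[ℝ] (E d → ℝ) where
  toFun P := fun x => MvPolynomial.eval (fun i => x i) P
  map_add' p q := by funext x; simp
  map_smul' c P := by funext x; simp

/-- The space `ℙ_k` of polynomial functions of total degree at most `k`. -/
def polySpace (d k : ℕ) : Submodule ℝ (E d → ℝ) :=
  (MvPolynomial.restrictTotalDegree (Fin d) ℝ k).map (polyFun d)

/-- The local Raviart-Thomas-Nédélec space `[ℙ_l]^d + x ℙ_l`. -/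
def rtnSpace (d l : ℕ) : Set (E d → E d) :=
  {v | ∃ w : E d → E d, ∃ r ∈ polySpace d l,
    (∀ i : Fin d, (fun x => w x i) ∈ polySpace d l) ∧ ∀ x, v x = w x + r x • x}

/-! ### Meshes -/

/-- A simplicial triangulation in `ℝ^d` without hanging nodes; `t : ι` is the simplex with vertex
set `vert t`. -/
structure SimplicialMesh (d : ℕ) (ι : Type*) where
  vert : ι → Finset (E d)
  card_vert : ∀ t, (vert t).card = d + 1
  affineIndependent : ∀ t, AffineIndependent ℝ ((↑) : vert t → E d)
  vert_injective : Function.Injective vert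
  conforming : ∀ t t', convexHull ℝ (vert t : Set (E d)) ∩ convexHull ℝ (vert t' : Set (E d))
    ⊆ convexHull ℝ ((vert t : Set (E d)) ∩ (vert t' : Set (E d)))

namespace SimplicialMesh

variable {d : ℕ} {ι : Type*} (M : SimplicialMesh d ι)

/-- The closed simplex `t`. -/
def cell (t : ι) : Set (E d) := convexHull ℝ (M.vert t : Set (E d))

/-- A face of the mesh, given by its `d` vertices. -/
def IsFace (e : Finset (E d)) : Prop := e.card = d ∧ ∃ t, e ⊆ M.vert t

/-- An inner face is shared by two elements; the other faces are boundary faces. -/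
def IsInner (e : Finset (E d)) : Prop :=
  e.card = d ∧ ∃ t t', t ≠ t' ∧ e ⊆ M.vert t ∧ e ⊆ M.vert t'

/-- The vertices of `t` as an affine basis. -/
def basis (t : ι) : AffineBasis (M.vert t) ℝ (E d) :=
  AffineBasis.mk _ (M.affineIndependent t)
    ((M.affineIndependent t).affineSpan_eq_top_iff_card_eq_finrank_add_one.2
      (by simp [M.card_vert t]))

open scoped Classical in
/-- The barycentric coordinate on `t` that belongs to the vertex `a` of `t`. -/
def bary (t : ι) (a x : E d) : ℝ := if h : a ∈ M.vert t then (M.basis t).coord ⟨a, h⟩ x else 0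

end SimplicialMesh

/-- A fine triangulation `τ_h` with a coarse partition `𝒯_H` (a fine element `t` belongs to the
coarse element `coarse t`). A face `e` has a neighbor `t⁻ = minus e`, an inner face also
`t⁺ = plus e`, and `normal e` is the unit normal on `e` that points out of `t⁻`. -/
structure NestedMesh (d : ℕ) (ι J : Type*) extends SimplicialMesh d ι where
  coarse : ι → J
  coarse_surjective : Function.Surjective coarse
  minus : Finset (E d) → ι
  plus : Finset (E d) → ι
  normal : Finset (E d) → E d
  subset_minus : ∀ e, toSimplicialMesh.IsFace e → e ⊆ vert (minus e)
  subset_plus : ∀ e, toSimplicialMesh.IsInner e → e ⊆ vert (plus e) ∧ plus e ≠ minus e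
  norm_normal : ∀ e, toSimplicialMesh.IsFace e → ‖normal e‖ = 1
  normal_orthogonal : ∀ e, toSimplicialMesh.IsFace e → ∀ x ∈ e, ∀ y ∈ e,
    inner ℝ (normal e) (y - x) = 0
  normal_outward : ∀ e, toSimplicialMesh.IsFace e → ∀ x ∈ e, ∀ a ∈ vert (minus e), a ∉ e →
    inner ℝ (normal e) (a - x) < 0

namespace NestedMesh

variable {d : ℕ} {ι J : Type*} (M : NestedMesh d ι J)

/-- The domain `Ω` that is triangulated (an open set). -/
def domain : Set (E d) := interior (⋃ t, M.cell t)

/-- The coarse element `T` (an open set). -/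
def coarseSet (T : J) : Set (E d) := interior (⋃ t, ⋃ _ : M.coarse t = T, M.cell t)

/-- `τ_h^T`, the fine elements that cover the coarse element `T`. -/
abbrev Patch (T : J) : Type _ := {t : ι // M.coarse t = T}

/-- The restriction of a broken function to a coarse element. -/
def restr (T : J) (q : ι → E d → ℝ) : M.Patch T → E d → ℝ := fun t => q t.1

/-- The face `e` lies in the interior of a coarse element (otherwise it lies on a coarse face). -/
def IsInside (e : Finset (E d)) : Prop :=
  M.IsInner e ∧ M.coarse (M.minus e) = M.coarse (M.plus e)

variable [Fintype ι]

open scoped Classical in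
/-- All fine faces `ℱ_h`. -/
def faces : Finset (Finset (E d)) :=
  Finset.univ.biUnion fun t => (M.vert t).powersetCard d

open scoped Classical in
/-- The fine faces in the interior of the coarse element `T`. -/
def insideFaces (T : J) : Finset (Finset (E d)) :=
  M.faces.filter fun e => M.IsInside e ∧ M.coarse (M.minus e) = T

open scoped Classical in
/-- The fine faces that lie on coarse faces: the disjoint union of `ℱ_h^E` over all coarse faces
`E`, those on the boundary of `Ω` included. -/
def couplingFaces : Finset (Finset (E d)) := M.faces.filter fun e => ¬ M.IsInside e

/-- A broken function is given by one function for each fine element. `glue` is the function on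
`Ω` which it defines almost everywhere. -/
def glue {F : Type*} [AddCommMonoid F] (q : ι → E d → F) (x : E d) : F :=
  ∑ t, (interior (M.cell t)).indicator (q t) x

/-- The broken gradient `∇_h`. -/
def brokenGrad (q : E d → ℝ) : E d → E d :=
  M.glue fun t => weakGrad (interior (M.cell t)) q

end NestedMesh

/-! ### The parametric problem -/

/-- The data `λ(μ) = ∑ θ_ξ(μ) λ_ξ` and `κ` (constant on each fine element). `lamC ξ t` is a
representative of `λ_ξ` on the closed simplex `t`; its values on the faces of `t` are the traces of
`λ_ξ` from within `t`. -/
structure Coefficients {d : ℕ} {ι J : Type*} (M : NestedMesh d ι J) (P : Type*) (N : ℕ) where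
  θ : Fin N → P → ℝ
  lamC : Fin N → ι → E d → ℝ
  κ : ι → Matrix (Fin d) (Fin d) ℝ
  θ_pos : ∀ ξ μ, 0 < θ ξ μ
  lamC_measurable : ∀ ξ t, Measurable (lamC ξ t)
  lamC_nonneg : ∀ ξ t, ∀ x ∈ M.cell t, 0 ≤ lamC ξ t x
  lamC_bounded : ∃ C : ℝ, ∀ ξ t, ∀ x ∈ M.cell t, lamC ξ t x ≤ C
  lam_lower : ∃ c : ℝ, 0 < c ∧ ∀ μ t, ∀ x ∈ M.cell t, c ≤ ∑ ξ, θ ξ μ * lamC ξ t x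
  κ_posDef : ∀ t, (κ t).PosDef

namespace Coefficients

variable {d : ℕ} {ι J : Type*} {M : NestedMesh d ι J} {P : Type*} {N : ℕ}
  (A : Coefficients M P N)

/-- `λ(μ)` on the element `t`. -/
def lam (μ : P) (t : ι) (x : E d) : ℝ := ∑ ξ, A.θ ξ μ * A.lamC ξ t x

/-- `α(μ, ν) = min_ξ θ_ξ(μ) / θ_ξ(ν)`. -/
def alpha (μ ν : P) : ℝ := ⨅ ξ, A.θ ξ μ / A.θ ξ ν

/-- `γ(μ, ν) = max_ξ θ_ξ(μ) / θ_ξ(ν)`. -/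
def gamma (μ ν : P) : ℝ := ⨆ ξ, A.θ ξ μ / A.θ ξ ν

/-- The smallest eigenvalue of `λ(μ) κ` on the fine element `t` (essential infimum over `t`). -/
def cElem (μ : P) (t : ι) : ℝ :=
  essInf (fun x => sInf (spectrum ℝ (A.lam μ t x • A.κ t))) (volume.restrict (M.cell t))

/-- `c_ε^T`, the smallest value of `cElem` over all parameters and all `t ∈ τ_h^T`. -/
def cCoarse (T : J) : ℝ := ⨅ t : M.Patch T, ⨅ μ : P, A.cElem μ t.1

variable [Fintype ι]

/-- The matrix field `λ(μ) κ` on `Ω`. -/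
def coeff (μ : P) (x : E d) : Matrix (Fin d) (Fin d) ℝ :=
  M.glue (fun t y => A.lam μ t y • A.κ t) x

/-- `∫_S (λ(μ) κ ∇_h p) · ∇_h q`. -/
def bForm (μ : P) (S : Set (E d)) (p q : E d → ℝ) : ℝ :=
  ∫ x in S, inner ℝ (Matrix.toEuclideanLin (A.coeff μ x) (M.brokenGrad p x)) (M.brokenGrad q x)

/-- The local energy semi-norm on the coarse element `T`. -/
def energyLocal (μ : P) (T : J) (q : E d → ℝ) : ℝ := √(A.bForm μ (M.coarseSet T) q q)

variable [Fintype J]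

/-- The energy semi-norm. -/
def energyNorm (μ : P) (q : E d → ℝ) : ℝ := √(∑ T, A.energyLocal μ T q ^ 2)

end Coefficients

section Forms

variable {d : ℕ} {ι J : Type*} (M : NestedMesh d ι J) [Fintype J]

/-- The linear form `l(q) = ∑_T ∫_T f q`. -/
def load (f q : E d → ℝ) : ℝ := ∑ T, ∫ x in M.coarseSet T, f x * q x

/-- `p ∈ H¹₀(Ω)` is the weak solution for the parameter `μ`. -/
def IsWeakSolution [Fintype ι] {P : Type*} {N : ℕ} (A : Coefficients M P N) (f : E d → ℝ) (μ : P)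
    (p : E d → ℝ) : Prop :=
  MemH10 M.domain p ∧
    ∀ q, MemH10 M.domain q → ∑ T, A.bForm μ (M.coarseSet T) p q = load M f q

end Forms

/-! ### The discretization -/

/-- The interior penalty variants. -/
inductive IPScheme
  | nipdg
  | iipdg
  | sipdg
  | swipdg

/-- The symmetry parameter `ϑ`. -/
def IPScheme.vartheta : IPScheme → ℝ
  | .nipdg => -1
  | .iipdg => 0
  | .sipdg => 1
  | .swipdg => 1

/-- The choice of the local ansatz space: continuous or discontinuous. -/
inductive LocalSpaceKind
  | cg
  | dg

/-- The local discretization on each coarse element and the penalty parameter `σ`. -/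
structure Discretization (J : Type*) where
  kind : J → LocalSpaceKind
  scheme : J → IPScheme
  σ : ℝ
  one_le_σ : 1 ≤ σ

section Spaces

variable {d : ℕ} {ι J : Type*} (M : NestedMesh d ι J) (D : Discretization J) (k : ℕ)

/-- The discontinuous local space `Q_h^k(τ_h^T)`. -/
def dgLocal (T : J) : Submodule ℝ (M.Patch T → E d → ℝ) :=
  Submodule.pi Set.univ fun _ => polySpace d k

/-- The continuous local space `S_h^k(τ_h^T)`. -/
def cgLocal (T : J) : Submodule ℝ (M.Patch T → E d → ℝ) where
  carrier := {q | q ∈ dgLocal M k T ∧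
    ∀ t t' : M.Patch T, ∀ x ∈ M.cell t.1 ∩ M.cell t'.1, q t x = q t' x}
  add_mem' {p q} hp hq := ⟨add_mem hp.1 hq.1, fun t t' x hx => by
    simp [hp.2 t t' x hx, hq.2 t t' x hx]⟩
  zero_mem' := ⟨zero_mem _, fun _ _ _ _ => rfl⟩
  smul_mem' c q hq := ⟨Submodule.smul_mem _ c hq.1, fun t t' x hx => by
    simp [hq.2 t t' x hx]⟩

/-- The chosen local space `Q_h^{k,T}`. -/
def localSpace (T : J) : Submodule ℝ (M.Patch T → E d → ℝ) :=
  match D.kind T with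
  | .cg => cgLocal M k T
  | .dg => dgLocal M k T

/-- The DG space `Q_h^k`. -/
def dgSpace : Set (ι → E d → ℝ) := {q | ∀ T, M.restr T q ∈ localSpace M D k T}

/-- The coarse reduced space `Q_red(𝒯_H)` that belongs to given local reduced spaces. -/
def reducedSpace (Qred : ∀ T, Submodule ℝ (M.Patch T → E d → ℝ)) : Set (ι → E d → ℝ) :=
  {q | q ∈ dgSpace M D k ∧ ∀ T, M.restr T q ∈ Qred T}

end Spaces

section FaceForms

variable {d : ℕ} {ι J : Type*} {M : NestedMesh d ι J} {P : Type*} {N : ℕ}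
  (A : Coefficients M P N) (D : Discretization J)

/-- `∫_e g ds` with respect to the surface measure on the face `e`. -/
def faceIntegral (e : Finset (E d)) (g : E d → ℝ) : ℝ :=
  ∫ x in convexHull ℝ (e : Set (E d)), g x ∂(Measure.euclideanHausdorffMeasure (d - 1))

/-- `δ_e^- = n_e · κ^- n_e`. -/
def deltaMinus (e : Finset (E d)) : ℝ :=
  inner ℝ (M.normal e) (Matrix.toEuclideanLin (A.κ (M.minus e)) (M.normal e))

/-- `δ_e^+ = n_e · κ^+ n_e`. -/
def deltaPlus (e : Finset (E d)) : ℝ :=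
  inner ℝ (M.normal e) (Matrix.toEuclideanLin (A.κ (M.plus e)) (M.normal e))

open scoped Classical in
/-- The variant used on the face `e`: the local one inside coarse elements, SWIPDG elsewhere. -/
def schemeAt (M : NestedMesh d ι J) (e : Finset (E d)) : IPScheme :=
  if M.IsInside e then D.scheme (M.coarse (M.minus e)) else .swipdg

open scoped Classical in
/-- The weight `ω_e^-`. -/
def weightMinus (e : Finset (E d)) : ℝ :=
  if M.IsInner e then
    match schemeAt D M e with
    | .swipdg => deltaPlus A e / (deltaPlus A e + deltaMinus A e)
    | _ => 1 / 2
  else 1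

open scoped Classical in
/-- The weight `ω_e^+`. -/
def weightPlus (e : Finset (E d)) : ℝ :=
  if M.IsInner e then
    match schemeAt D M e with
    | .swipdg => deltaMinus A e / (deltaPlus A e + deltaMinus A e)
    | _ => 1 / 2
  else 0

open scoped Classical in
/-- The jump on the face `e`. -/
def jump (M : NestedMesh d ι J) (e : Finset (E d)) (q : ι → E d → ℝ) (x : E d) : ℝ :=
  if M.IsInner e then q (M.minus e) x - q (M.plus e) x else q (M.minus e) x

/-- The weighted average on the face `e` (the one-sided value on a boundary face). -/
def avg (e : Finset (E d)) (q : ι → E d → ℝ) (x : E d) : ℝ :=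
  weightMinus A D e * q (M.minus e) x + weightPlus A D e * q (M.plus e) x

/-- The weighted average of `(λ(μ) κ ∇p) · n_e` on the face `e`. -/
def avgFlux (μ : P) (e : Finset (E d)) (p : ι → E d → ℝ) (x : E d) : ℝ :=
  avg A D e (fun t y => inner ℝ
    (Matrix.toEuclideanLin (A.lam μ t y • A.κ t) (gradient (p t) y)) (M.normal e)) x

open scoped Classical in
/-- The penalty function `σ_e(μ) = σ h_e⁻¹ {λ(μ)}_e σ_ε^e`. -/
def penalty (μ : P) (e : Finset (E d)) (x : E d) : ℝ :=
  D.σ * (Metric.diam (convexHull ℝ (e : Set (E d))))⁻¹ * avg A D e (A.lam μ) x *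
    (if M.IsInner e then deltaPlus A e * deltaMinus A e / (deltaPlus A e + deltaMinus A e)
      else deltaMinus A e)

/-- The coupling part `b_c^e(p, q; μ)`. -/
def bc (μ : P) (e : Finset (E d)) (p q : ι → E d → ℝ) : ℝ :=
  faceIntegral e fun x => -avgFlux A D μ e p x * jump M e q x

/-- The penalty part `b_p^e(p, q; μ)`. -/
def bp (μ : P) (e : Finset (E d)) (p q : ι → E d → ℝ) : ℝ :=
  faceIntegral e fun x => penalty A D μ e x * jump M e p x * jump M e q x

variable [Fintype ι] [Fintype J]

/-- The local bilinear form `b_h^T`. -/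
def bhLocal (μ : P) (T : J) (p q : ι → E d → ℝ) : ℝ :=
  A.bForm μ (M.coarseSet T) (M.glue p) (M.glue q) +
    ∑ e ∈ M.insideFaces T,
      ((D.scheme T).vartheta * bc A D μ e q p + bc A D μ e p q + bp A D μ e q p)

/-- The DG bilinear form `b_h`. -/
def bh (μ : P) (p q : ι → E d → ℝ) : ℝ :=
  ∑ T, bhLocal A D μ T p q +
    ∑ e ∈ M.couplingFaces, (bc A D μ e q p + bc A D μ e p q + bp A D μ e q p)

/-- `p` is a Galerkin solution for the parameter `μ` in the space `Q`. -/
def IsGalerkinSolution (f : E d → ℝ) (μ : P) (Q : Set (ι → E d → ℝ)) (p : ι → E d → ℝ) : Prop :=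
  p ∈ Q ∧ ∀ q ∈ Q, bh A D μ p q = load M f (M.glue q)

end FaceForms

/-! ### Oswald interpolation -/

section Oswald

variable {d : ℕ} {ι J : Type*} (M : NestedMesh d ι J)

/-- The Lagrange node of order `k` on `t` with multi-index `m` (`∑ m a = k`). -/
def lagrangeNode (k : ℕ) (t : ι) (m : E d → ℕ) : E d := ∑ a ∈ M.vert t, ((m a : ℝ) / k) • a

/-- The Lagrange basis function of order `k` on `t` that belongs to this node: in barycentric
coordinates `β_a` it is `∏_a binom (k β_a) (m a)`. -/
def lagrangeBasis (k : ℕ) (t : ι) (m : E d → ℕ) (x : E d) : ℝ :=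
  ∏ a ∈ M.vert t, ∏ j ∈ Finset.range (m a), (k * M.bary t a x - j) / (j + 1)

variable [Fintype ι]

open scoped Classical in
/-- The nodal values of the Oswald interpolant: the mean of the values at `ν` from all elements
that share `ν` (one element only, if `ν` lies inside it), and `0` on the boundary of `Ω`. -/
def oswaldValue (p : ι → E d → ℝ) (ν : E d) : ℝ :=
  if ν ∈ frontier M.domain then 0
  else ((Finset.univ.filter fun t => ν ∈ M.cell t).card : ℝ)⁻¹ *
    ∑ t ∈ Finset.univ.filter (fun t => ν ∈ M.cell t), p t ν

open scoped Classical in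
/-- The Oswald interpolant of order `k`, given by its nodal values. -/
def oswald (k : ℕ) (p : ι → E d → ℝ) (t : ι) (x : E d) : ℝ :=
  ∑ m ∈ (M.vert t).piAntidiag k,
    oswaldValue M p (lagrangeNode M k t m) * lagrangeBasis M k t m x

end Oswald

/-! ### Diffusive flux reconstruction -/

section Flux

variable {d : ℕ} {ι J : Type*} {M : NestedMesh d ι J} {P : Type*} {N : ℕ}
  (A : Coefficients M P N) (D : Discretization J) [Fintype ι]

/-- `u ∈ V_h^l(τ_h)`: piecewise Raviart-Thomas-Nédélec and in `H_div(Ω)`. -/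
def MemRTN (M : NestedMesh d ι J) (l : ℕ) (u : ι → E d → E d) : Prop :=
  (∀ t, u t ∈ rtnSpace d l) ∧ MemHdiv M.domain (M.glue u)

open scoped Classical in
/-- `u = R_h^l[p; μ]` is the diffusive flux reconstruction of `p`. On a face `e`, a polynomial
`r ∈ ℙ_l(e)` takes the place of the jump of the second argument of `b_c^e` and `b_p^e`; a
polynomial on `t` is extended by zero as the argument of `b_c^e`. -/
def IsFluxReconstruction (l : ℕ) (μ : P) (p : ι → E d → ℝ) (u : ι → E d → E d) : Prop :=
  MemRTN M l u ∧
  (∀ t, ∀ e ∈ (M.vert t).powersetCard d, ∀ r ∈ polySpace d l,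
    faceIntegral e (fun x => inner ℝ (u t x) (M.normal e) * r x) =
      faceIntegral e (fun x => -avgFlux A D μ e p x * r x) +
        faceIntegral e (fun x => penalty A D μ e x * jump M e p x * r x)) ∧
  (∀ t, ∀ q ∈ polySpace d l,
    ∫ x in M.cell t, inner ℝ (u t x) (gradient q x) =
      -A.bForm μ (M.cell t) (M.glue p) q -
        ∑ e ∈ (M.vert t).powersetCard d,
          (schemeAt D M e).vartheta * bc A D μ e (Pi.single t q) p)

end Flux

/-! ### The error estimator -/

section Estimator

variable {d : ℕ} {ι J : Type*} {M : NestedMesh d ι J} {P : Type*} {N : ℕ}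
  (A : Coefficients M P N) [Fintype ι]

/-- The local nonconformity estimator. -/
def etaNC (μbar : P) (T : J) (q s : E d → ℝ) : ℝ := A.energyLocal μbar T (fun x => q x - s x)

/-- The local residual estimator. -/
def etaR (f : E d → ℝ) (CP : J → ℝ) (T : J) (v : E d → E d) : ℝ :=
  √(CP T / A.cCoarse T) * Metric.diam (M.coarseSet T) *
    √(∫ x in M.coarseSet T, (f x - weakDiv M.domain v x) ^ 2)

open scoped MatrixOrder in
/-- The local diffusive flux estimator, the `L²(T)` norm of
`(λ(μhat) κ)^(-1/2) (λ(μ) κ ∇_h q + v)`. -/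
def etaDF (μ μhat : P) (T : J) (q : E d → ℝ) (v : E d → E d) : ℝ :=
  √(∫ x in M.coarseSet T, ‖Matrix.toEuclideanLin (CFC.sqrt (A.coeff μhat x))⁻¹
    (Matrix.toEuclideanLin (A.coeff μ x) (M.brokenGrad q x) + v x)‖ ^ 2)

variable [Fintype J]

/-- The global estimator for given `s` and `v`. -/
def etaAbstract (f : E d → ℝ) (CP : J → ℝ) (μ μbar μhat : P) (q s : E d → ℝ) (v : E d → E d) : ℝ :=
  1 / √(A.alpha μ μbar) *
    (√(A.gamma μ μbar) * √(∑ T, etaNC A μbar T q s ^ 2)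
      + √(∑ T, etaR A f CP T v ^ 2)
      + 1 / √(A.alpha μ μhat) * √(∑ T, etaDF A μ μhat T q v ^ 2))

/-- The estimator `η(p; μ, μbar, μhat)`: `s` is the Oswald interpolant of `p`, and `u` is to be the
diffusive flux reconstruction of `p`. -/
def eta (f : E d → ℝ) (CP : J → ℝ) (k : ℕ) (μ μbar μhat : P) (p : ι → E d → ℝ)
    (u : ι → E d → E d) : ℝ :=
  etaAbstract A f CP μ μbar μhat (M.glue p) (M.glue (oswald M k p)) (M.glue u)

end Estimator

end LRBMS

end

/-!
The error `p - q` is split as `φ - a` with the conforming part `φ = p - s ∈ H¹₀` and `a = q - s`,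
where `s` is the Oswald interpolant of `q`. In the energy product of `μ`, an inequality
`⟨p - q, φ⟩ ≤ R ‖φ‖` implies `‖p - q‖ ≤ ‖a‖ + R` (`sq_sub_le_of_le`, an elementary statement on
two vectors of a Euclidean space). The change from `μ` to another parameter costs the factors
`α⁻¹ᐟ²` and `γ¹ᐟ²`. With the weak equation, and with Green's formula for `v ∈ H_div` and
`φ ∈ H¹₀`,

`⟨p - q, φ⟩ = ∑_T ∫_T (f - ∇·v) φ - ∑_T ∫_T (λκ∇_h q + v) · ∇φ`.

The second sum is bounded by the Cauchy-Schwarz inequality with the weight `(λ(μhat) κ)^(1/2)`, the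
first one by the Poincaré inequality, provided that `f - ∇·v` has mean value zero on each coarse
element (`energyNorm_le_etaAbstract`).

Two facts about the discretization enter. The first one is local conservation
(`integral_residual_eq_zero`). As the characteristic function of a coarse element `T` is an
admissible test function, `∫_T f` is the sum of the numerical fluxes over the coupling faces of `T`,
because its gradient vanishes and its jumps vanish on all faces inside `T`. The face conditions on
`v`, tested with the constant `1`, make the numerical flux equal to the flux of `v`. The divergence
theorem on a simplex (`IsOutwardNormal.integral_divergence`) turns the latter into `∫_T ∇·v`. It is
proved for the Hausdorff measure on the faces: slicing a simplex along the direction `j - i` of an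
edge gives `∫_t ∂_{j-i} g` as the difference of the integrals over the faces opposite to `i` and
`j`, with factors that are the normal components of `j - i`.

The second one is that the Oswald interpolant belongs to `H¹₀(Ω)` (`NestedMesh.isH10_oswald`).
Conformity of the mesh makes the values on a common face of two elements agree, and those on the
boundary vanish, so that the interpolant extends by zero to a Lipschitz function. A Lipschitz
function that vanishes outside `Ω` is a limit of Lipschitz functions with compact support in `Ω`,
and these are limits of their mollifications (`isH10_of_lipschitz`).
-/

noncomputable section

namespace LRBMS

/-! ### Barycentric coordinates -/

namespace SimplicialMesh

variable {d : ℕ} {ι : Type*} (M : SimplicialMesh d ι)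

theorem bary_of_mem {t : ι} {a : E d} (h : a ∈ M.vert t) (x : E d) :
    M.bary t a x = (M.basis t).coord ⟨a, h⟩ x := dif_pos h

theorem bary_of_notMem {t : ι} {a : E d} (h : a ∉ M.vert t) (x : E d) : M.bary t a x = 0 :=
  dif_neg h

theorem basis_apply (t : ι) (a : M.vert t) : M.basis t a = a := rfl

/-- The linear part of a barycentric coordinate. -/
def baryLin (t : ι) (a : E d) : E d →L[ℝ] ℝ := by
  classical
  exact if h : a ∈ M.vert t then LinearMap.toContinuousLinearMap ((M.basis t).coord ⟨a, h⟩).linear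
    else 0

theorem bary_add (t : ι) (a x v : E d) : M.bary t a (x + v) = M.bary t a x + M.baryLin t a v := by
  by_cases h : a ∈ M.vert t
  · have := ((M.basis t).coord ⟨a, h⟩).map_vadd x v
    simp only [vadd_eq_add] at this
    rw [bary_of_mem _ h, bary_of_mem _ h, baryLin, dif_pos h, add_comm x, this, add_comm]
    rfl
  · simp [bary_of_notMem _ h, baryLin, h]

theorem bary_eq (t : ι) (a x : E d) : M.bary t a x = M.bary t a 0 + M.baryLin t a x := by
  simpa using M.bary_add t a 0 x

theorem baryLin_apply_sub (t : ι) (a x y : E d) : M.baryLin t a (x - y) = M.bary t a x - M.bary t a y := by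
  rw [M.bary_eq t a x, M.bary_eq t a y, map_sub]; ring

@[fun_prop]
theorem contDiff_bary (t : ι) (a : E d) : ContDiff ℝ ∞ (M.bary t a) := by
  have : M.bary t a = fun x => M.bary t a 0 + M.baryLin t a x := funext (M.bary_eq t a)
  rw [this]
  fun_prop

@[fun_prop]
theorem continuous_bary (t : ι) (a : E d) : Continuous (M.bary t a) :=
  (M.contDiff_bary t a).continuous

theorem sum_bary (t : ι) (x : E d) : ∑ a ∈ M.vert t, M.bary t a x = 1 := by
  rw [← (M.basis t).sum_coord_apply_eq_one x, ← Finset.sum_attach]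
  exact Finset.sum_congr rfl fun a _ => M.bary_of_mem a.2 x

theorem sum_bary_smul (t : ι) (x : E d) : ∑ a ∈ M.vert t, M.bary t a x • a = x := by
  conv_rhs => rw [← (M.basis t).linear_combination_coord_eq_self x]
  rw [← Finset.sum_attach]
  exact Finset.sum_congr rfl fun a _ => by rw [M.bary_of_mem a.2 x, basis_apply]

theorem bary_vert {t : ι} {a b : E d} [Decidable (a = b)] (ha : a ∈ M.vert t)
    (hb : b ∈ M.vert t) : M.bary t a b = if a = b then 1 else 0 := by
  classical
  have := (M.basis t).coord_apply ⟨a, ha⟩ ⟨b, hb⟩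
  rw [M.basis_apply] at this
  simpa [M.bary_of_mem ha, Subtype.ext_iff] using this

/-- Barycentric coordinates commute with affine combinations. -/
theorem bary_sum {α : Type*} (t : ι) (a : E d) (s : Finset α) (w : α → ℝ) (z : α → E d)
    (hw : ∑ i ∈ s, w i = 1) :
    M.bary t a (∑ i ∈ s, w i • z i) = ∑ i ∈ s, w i * M.bary t a (z i) := by
  rw [M.bary_eq, map_sum]
  simp_rw [M.bary_eq t a (z _), mul_add, Finset.sum_add_distrib, ← Finset.sum_mul, hw, one_mul,
    map_smul, smul_eq_mul]

open scoped Classical in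
/-- A representation of a point by vertices of `t` determines its barycentric coordinates. -/
theorem bary_combination {t : ι} {s : Finset (E d)} (hs : s ⊆ M.vert t) (w : E d → ℝ)
    (hw : ∑ b ∈ s, w b = 1) (a : E d) :
    M.bary t a (∑ b ∈ s, w b • b) = if a ∈ s then w a else 0 := by
  rw [M.bary_sum t a s w (fun b => b) hw]
  by_cases ha : a ∈ M.vert t
  · rw [Finset.sum_congr rfl fun b hb => by rw [M.bary_vert ha (hs hb)]]
    simp
  · rw [if_neg fun h => ha (hs h)]
    exact Finset.sum_eq_zero fun b _ => by rw [M.bary_of_notMem ha, mul_zero]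

theorem range_basis (t : ι) : Set.range (M.basis t) = (M.vert t : Set (E d)) := by
  have : (M.basis t : M.vert t → E d) = Subtype.val := rfl
  rw [this, Subtype.range_coe]

theorem mem_cell_iff {t : ι} {x : E d} : x ∈ M.cell t ↔ ∀ a, 0 ≤ M.bary t a x := by
  rw [cell, ← M.range_basis t, (M.basis t).convexHull_eq_nonneg_coord]
  refine ⟨fun h a => ?_, fun h a => ?_⟩
  · by_cases ha : a ∈ M.vert t
    · rw [M.bary_of_mem ha]; exact h _
    · rw [M.bary_of_notMem ha]
  · have := h a
    rwa [M.bary_of_mem a.2] at this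

theorem mem_interior_cell_iff {t : ι} {x : E d} :
    x ∈ interior (M.cell t) ↔ ∀ a ∈ M.vert t, 0 < M.bary t a x := by
  rw [cell, ← M.range_basis t, AffineBasis.interior_convexHull]
  refine ⟨fun h a ha => ?_, fun h a => ?_⟩
  · rw [M.bary_of_mem ha]; exact h _
  · have := h a a.2
    rwa [M.bary_of_mem a.2] at this

theorem mem_convexHull_iff {t : ι} {e : Finset (E d)} (he : e ⊆ M.vert t) {x : E d} :
    x ∈ convexHull ℝ (e : Set (E d)) ↔ x ∈ M.cell t ∧ ∀ a, a ∉ e → M.bary t a x = 0 := by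
  classical
  constructor
  · intro h
    refine ⟨convexHull_mono (by exact_mod_cast he) h, fun a ha => ?_⟩
    rw [Finset.mem_convexHull'] at h
    obtain ⟨w, -, hw, rfl⟩ := h
    rw [M.bary_combination he w hw, if_neg ha]
  · rintro ⟨h, h0⟩
    rw [Finset.mem_convexHull']
    refine ⟨fun a => M.bary t a x, fun a _ => M.mem_cell_iff.1 h a, ?_, ?_⟩
    · rw [← M.sum_bary t x]
      exact Finset.sum_subset he fun a _ ha => h0 a ha
    · conv_rhs => rw [← M.sum_bary_smul t x]
      exact Finset.sum_subset he fun a _ ha => by simp [h0 a ha]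

theorem convex_cell (t : ι) : Convex ℝ (M.cell t) := convex_convexHull ℝ _

theorem isCompact_cell (t : ι) : IsCompact (M.cell t) :=
  (M.vert t).finite_toSet.isCompact_convexHull ℝ

theorem isClosed_cell (t : ι) : IsClosed (M.cell t) := (M.isCompact_cell t).isClosed

theorem interior_cell_nonempty (t : ι) : (interior (M.cell t)).Nonempty := by
  rw [cell, ← M.range_basis t]
  exact ⟨_, (M.basis t).centroid_mem_interior_convexHull⟩

theorem closure_interior_cell (t : ι) : closure (interior (M.cell t)) = M.cell t := by
  rw [(M.convex_cell t).closure_interior_eq_closure_of_nonempty_interior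
    (M.interior_cell_nonempty t), (M.isClosed_cell t).closure_eq]

/-- On the intersection of two simplices of a conforming mesh the barycentric coordinates agree. -/
theorem bary_eq_bary {t t' : ι} {x : E d} (h : x ∈ M.cell t) (h' : x ∈ M.cell t') (a : E d) :
    M.bary t a x = M.bary t' a x := by
  classical
  have hx := M.conforming t t' ⟨h, h'⟩
  rw [← Finset.coe_inter, Finset.mem_convexHull'] at hx
  obtain ⟨w, -, hw, rfl⟩ := hx
  rw [M.bary_combination Finset.inter_subset_left w hw,
    M.bary_combination Finset.inter_subset_right w hw]

/-- An interior point of a simplex has positive coordinates at all of its vertices, hence lies in no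
other simplex of a conforming mesh. -/
theorem eq_of_mem_interior_cell {t t' : ι} {x : E d} (h : x ∈ interior (M.cell t))
    (h' : x ∈ M.cell t') : t = t' := by
  have hsub : M.vert t ⊆ M.vert t' := fun a ha => by
    by_contra hna
    have := M.mem_interior_cell_iff.1 h a ha
    rw [M.bary_eq_bary (interior_subset h) h', M.bary_of_notMem hna] at this
    exact lt_irrefl _ this
  exact M.vert_injective (Finset.eq_of_subset_of_card_le hsub
    (by rw [M.card_vert, M.card_vert]))

theorem exists_eq_erase [DecidableEq (E d)] {t : ι} {e : Finset (E d)} (he : e ⊆ M.vert t)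
    (hc : e.card = d) : ∃ a ∈ M.vert t, a ∉ e ∧ e = (M.vert t).erase a := by
  have h1 : (M.vert t \ e).card = 1 := by
    rw [Finset.card_sdiff_of_subset he, M.card_vert, hc]; omega
  obtain ⟨a, ha⟩ := Finset.card_eq_one.1 h1
  have hm : a ∈ M.vert t \ e := by rw [ha]; simp
  rw [Finset.mem_sdiff] at hm
  refine ⟨a, hm.1, hm.2, ?_⟩
  refine Finset.eq_of_subset_of_card_le (Finset.subset_erase.2 ⟨he, hm.2⟩) ?_
  rw [Finset.card_erase_of_mem hm.1, M.card_vert, hc]; omega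

end SimplicialMesh

/-! ### Slicing volume integrals by a hyperplane and an oblique direction -/

section Slicing

variable {d : ℕ}

/-- Lebesgue measure in oblique coordinates: a point is written as `c + y + s • w` with `y` in the
hyperplane orthogonal to `n`. -/
theorem measurePreserving_slice {n w : E d} (hn : ‖n‖ = 1) (hw : inner ℝ n w ≠ (0 : ℝ)) (c : E d) :
    MeasurePreserving (fun p : ℝ × (ℝ ∙ n)ᗮ => c + p.2 + p.1 • w) (volume.prod volume)
      (ENNReal.ofReal |(inner ℝ n w)⁻¹| • volume) := by
  -- a shear in direction of the hyperplane, composed with orthogonal coordinates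
  set β : ℝ := inner ℝ n w with hβ
  have hn0 : n ≠ 0 := by rintro rfl; simp at hn
  have hnn : inner ℝ n n = (1 : ℝ) := by rw [real_inner_self_eq_norm_sq, hn]; norm_num
  let wV : (ℝ ∙ n)ᗮ := ⟨w - β • n, by
    rw [Submodule.mem_orthogonal_singleton_iff_inner_right, inner_sub_right, inner_smul_right, hnn]
    simp [hβ]⟩
  have h1 : MeasurePreserving (fun p : ℝ × (ℝ ∙ n)ᗮ => (β * p.1, p.2 + p.1 • wV))
      (volume.prod volume) (ENNReal.ofReal |β⁻¹| • (volume.prod volume)) := by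
    rw [← Measure.prod_smul_left]
    refine MeasurePreserving.skew_product (f := fun s => β * s)
      (g := fun s (y : (ℝ ∙ n)ᗮ) => y + s • wV) ⟨by fun_prop, Real.map_volume_mul_left hw⟩
      (by fun_prop) (Eventually.of_forall fun s => ?_)
    exact (measurePreserving_add_right volume (s • wV)).map_eq
  have h2 : MeasurePreserving (fun p : ℝ × (ℝ ∙ n)ᗮ => c + p.2 + p.1 • n)
      (volume.prod volume) volume := by
    have hL : MeasurePreserving (LinearIsometryEquiv.toSpanUnitSingleton (𝕜 := ℝ) n hn) :=
      LinearIsometryEquiv.measurePreserving _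
    have hp : MeasurePreserving (fun p : ℝ × (ℝ ∙ n)ᗮ =>
        (LinearIsometryEquiv.toSpanUnitSingleton (𝕜 := ℝ) n hn p.1, p.2)) (volume.prod volume)
        (volume.prod volume) := hL.prod (MeasurePreserving.id _)
    have hm := ((ℝ ∙ n).measurePreserving_measurableEquivProd c).symm
    have hv : (μHE[Module.finrank ℝ (E d)] : Measure (E d)) = volume :=
      InnerProductSpace.euclideanHausdorffMeasure_eq_volume
    rw [hv] at hm
    have h3 := hm.comp hp
    have heq : (fun p : ℝ × (ℝ ∙ n)ᗮ => c + p.2 + p.1 • n) =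
        ((ℝ ∙ n).measurableEquivProd c).symm ∘ fun p : ℝ × (ℝ ∙ n)ᗮ =>
        (LinearIsometryEquiv.toSpanUnitSingleton (𝕜 := ℝ) n hn p.1, p.2) := by
      funext p
      simp only [Function.comp, Submodule.measurableEquivProd_symm_apply,
        LinearIsometryEquiv.toSpanUnitSingleton_apply, vadd_eq_add]
      abel
    rw [heq]
    exact h3
  have h3 := (h2.smul_measure (ENNReal.ofReal |β⁻¹|)).comp h1
  have heq : (fun p : ℝ × (ℝ ∙ n)ᗮ => c + p.2 + p.1 • w) =
      (fun p : ℝ × (ℝ ∙ n)ᗮ => c + p.2 + p.1 • n) ∘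
        fun p : ℝ × (ℝ ∙ n)ᗮ => (β * p.1, p.2 + p.1 • wV) := by
    funext p
    simp only [Function.comp, Submodule.coe_add, Submodule.coe_smul, wV, smul_sub, smul_smul,
      mul_comm p.1 β]
    abel
  rw [heq]
  exact h3

theorem integral_slice {n w : E d} (hn : ‖n‖ = 1) (hw : inner ℝ n w ≠ (0 : ℝ)) (c : E d)
    {G : E d → ℝ} (hG : Integrable G) :
    ∫ x, G x = |inner ℝ n w| * ∫ y : (ℝ ∙ n)ᗮ, ∫ s : ℝ, G (c + y + s • w) := by
  have hm := measurePreserving_slice hn hw c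
  set β : ℝ := inner ℝ n w
  have hG' : Integrable G (ENNReal.ofReal |β⁻¹| • volume) :=
    hG.smul_measure ENNReal.ofReal_ne_top
  have hint : Integrable (fun p : ℝ × (ℝ ∙ n)ᗮ => G (c + p.2 + p.1 • w)) (volume.prod volume) :=
    hm.integrable_comp_of_integrable hG'
  have h1 : ∫ p : ℝ × (ℝ ∙ n)ᗮ, G (c + p.2 + p.1 • w) ∂(volume.prod volume)
      = |β⁻¹| * ∫ x, G x := by
    have := integral_map hm.measurable.aemeasurable (f := G) (by
      rw [hm.map_eq]; exact hG'.aestronglyMeasurable)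
    rw [← this, hm.map_eq, integral_smul_measure, ENNReal.toReal_ofReal (abs_nonneg _), smul_eq_mul]
  rw [integral_prod_symm _ hint] at h1
  rw [h1, abs_inv, mul_inv_cancel_left₀ (abs_ne_zero.2 hw)]

theorem isClosedEmbedding_hyperplane (n c : E d) :
    Topology.IsClosedEmbedding fun y : (ℝ ∙ n)ᗮ => c + (y : E d) :=
  (Homeomorph.addLeft c).isClosedEmbedding.comp
    (Submodule.closed_of_finiteDimensional _).isClosedEmbedding_subtypeVal

/-- On a hyperplane, the surface measure is the Lebesgue measure of the space of directions. -/
theorem restrict_hyperplane {n : E d} (hn : ‖n‖ = 1) (c : E d) {S : Set (E d)}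
    (hS : MeasurableSet S) (hSn : ∀ x ∈ S, inner ℝ n (x - c) = (0 : ℝ)) :
    (Measure.euclideanHausdorffMeasure (d - 1) : Measure (E d)).restrict S =
      (volume.map (fun y : (ℝ ∙ n)ᗮ => c + (y : E d))).restrict S := by
  have hn0 : n ≠ 0 := by rintro rfl; simp at hn
  have hfr : Module.finrank ℝ (ℝ ∙ n)ᗮ = d - 1 := by
    have h1 := (ℝ ∙ n).finrank_add_finrank_orthogonal
    rw [finrank_span_singleton hn0, finrank_euclideanSpace_fin] at h1
    omega
  have hiso : Isometry (fun y : (ℝ ∙ n)ᗮ => c + (y : E d)) :=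
    (IsometryEquiv.addLeft c).isometry.comp isometry_subtype_coe
  have hmap := hiso.map_euclideanHausdorffMeasure (d := d - 1)
  have hvol : (μHE[d - 1] : Measure (ℝ ∙ n)ᗮ) = volume := by
    rw [← hfr]; exact InnerProductSpace.euclideanHausdorffMeasure_eq_volume
  rw [hvol] at hmap
  have hsub : S ⊆ Set.range (fun y : (ℝ ∙ n)ᗮ => c + (y : E d)) := fun x hx =>
    ⟨⟨x - c, Submodule.mem_orthogonal_singleton_iff_inner_right.2 (hSn x hx)⟩, by simp⟩
  rw [hmap, Measure.restrict_restrict hS, Set.inter_eq_left.2 hsub]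

theorem setIntegral_hyperplane {n : E d} (hn : ‖n‖ = 1) (c : E d) {S : Set (E d)}
    (hS : MeasurableSet S) (hSn : ∀ x ∈ S, inner ℝ n (x - c) = (0 : ℝ)) {g : E d → ℝ}
    (hg : Continuous g) :
    ∫ x in S, g x ∂(Measure.euclideanHausdorffMeasure (d - 1)) =
      ∫ y : (ℝ ∙ n)ᗮ, S.indicator g (c + y) := by
  rw [restrict_hyperplane hn c hS hSn, ← integral_indicator hS, integral_map (by fun_prop)]
  exact (hg.measurable.indicator hS).aestronglyMeasurable

theorem integrableOn_hyperplane {n : E d} (hn : ‖n‖ = 1) (c : E d) {S : Set (E d)}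
    (hS : IsCompact S) (hSn : ∀ x ∈ S, inner ℝ n (x - c) = (0 : ℝ)) {g : E d → ℝ}
    (hg : Continuous g) :
    IntegrableOn g S (Measure.euclideanHausdorffMeasure (d - 1)) := by
  have hc := isClosedEmbedding_hyperplane n c
  rw [IntegrableOn, restrict_hyperplane hn c hS.measurableSet hSn, ← IntegrableOn,
    ← integrable_indicator_iff hS.measurableSet, integrable_map_measure
      (hg.measurable.indicator hS.measurableSet).aestronglyMeasurable hc.continuous.aemeasurable]
  have h2 := hc.isCompact_preimage hS
  have h1 : (S.indicator g) ∘ (fun y : (ℝ ∙ n)ᗮ => c + (y : E d)) =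
      ((fun y : (ℝ ∙ n)ᗮ => c + (y : E d)) ⁻¹' S).indicator fun y => g (c + y) := rfl
  rw [h1, integrable_indicator_iff h2.measurableSet]
  exact (hg.comp hc.continuous).continuousOn.integrableOn_compact h2

end Slicing

/-! ### The divergence theorem on a simplex -/

namespace SimplicialMesh

variable {d : ℕ} {ι : Type*} (M : SimplicialMesh d ι)

/-- The signed distance to the plane of a face is a multiple of a barycentric coordinate. -/
theorem inner_normal_eq [DecidableEq (E d)] {t : ι} {a b n : E d} (ha : a ∈ M.vert t)
    (horth : ∀ x ∈ (M.vert t).erase a, inner ℝ n (x - b) = (0 : ℝ)) (x : E d) :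
    (inner ℝ n (x - b) : ℝ) = M.bary t a x * inner ℝ n (a - b) := by
  have hx : x - b = ∑ c ∈ M.vert t, M.bary t c x • (c - b) := by
    simp_rw [smul_sub, Finset.sum_sub_distrib, M.sum_bary_smul, ← Finset.sum_smul, M.sum_bary,
      one_smul]
  rw [hx, inner_sum, Finset.sum_eq_single_of_mem a ha, inner_smul_right]
  intro c hc hca
  rw [inner_smul_right, horth c (Finset.mem_erase.2 ⟨hca, hc⟩), mul_zero]

theorem baryLin_sub {t : ι} {i j : E d} [DecidableEq (E d)] (hi : i ∈ M.vert t)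
    (hj : j ∈ M.vert t) (a : E d) :
    M.baryLin t a (j - i) = (if a = j then 1 else 0) - (if a = i then 1 else 0) := by
  rw [M.baryLin_apply_sub]
  by_cases ha : a ∈ M.vert t
  · rw [M.bary_vert ha hi, M.bary_vert ha hj]
  · rw [M.bary_of_notMem ha, M.bary_of_notMem ha, if_neg, if_neg] <;> rintro rfl <;> contradiction

/-- The point of the plane of the face opposite `i` that lies on the line through `x` parallel to
the edge from `i` to `j`. -/
def edgeProj (t : ι) (i j x : E d) : E d := x + M.bary t i x • (j - i)

theorem continuous_edgeProj (t : ι) (i j : E d) : Continuous (M.edgeProj t i j) := by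
  unfold edgeProj; fun_prop

theorem bary_add_smul [DecidableEq (E d)] {t : ι} {i j : E d} (hi : i ∈ M.vert t)
    (hj : j ∈ M.vert t) (a x : E d) (s : ℝ) :
    M.bary t a (x + s • (j - i)) =
      M.bary t a x + s * ((if a = j then 1 else 0) - (if a = i then 1 else 0)) := by
  rw [M.bary_add, map_smul, M.baryLin_sub hi hj, smul_eq_mul]

theorem edgeProj_add_smul [DecidableEq (E d)] {t : ι} {i j : E d} (hi : i ∈ M.vert t)
    (hj : j ∈ M.vert t) (hij : i ≠ j) (x : E d) (s : ℝ) :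
    M.edgeProj t i j (x + s • (j - i)) = M.edgeProj t i j x := by
  rw [edgeProj, M.bary_add_smul hi hj, edgeProj]
  simp only [if_neg hij, if_true]
  module

theorem measurableSet_face (e : Finset (E d)) : MeasurableSet (convexHull ℝ (e : Set (E d))) :=
  (e.finite_toSet.isCompact_convexHull ℝ).isClosed.measurableSet

theorem mem_face_iff [DecidableEq (E d)] {t : ι} {a x : E d} :
    x ∈ convexHull ℝ ((M.vert t).erase a : Set (E d)) ↔ x ∈ M.cell t ∧ M.bary t a x = 0 := by
  rw [M.mem_convexHull_iff (Finset.erase_subset _ _)]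
  refine and_congr_right fun _ => ⟨fun h => h a (by simp), fun h b hb => ?_⟩
  by_cases hba : b = a
  · rw [hba, h]
  · exact M.bary_of_notMem (fun h' => hb (Finset.mem_erase.2 ⟨hba, h'⟩)) x

theorem edgeProj_mem_face_iff [DecidableEq (E d)] {t : ι} {i j : E d} (hi : i ∈ M.vert t)
    (hj : j ∈ M.vert t) (hij : i ≠ j) {x : E d} (hx : M.bary t j x = 0) :
    M.edgeProj t i j x ∈ convexHull ℝ ((M.vert t).erase i : Set (E d)) ↔
      x ∈ convexHull ℝ ((M.vert t).erase j : Set (E d)) := by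
  rw [M.mem_face_iff, M.mem_face_iff, M.mem_cell_iff, M.mem_cell_iff]
  have key := fun a => M.bary_add_smul hi hj a x (M.bary t i x)
  have hki : M.bary t i (M.edgeProj t i j x) = 0 := by
    rw [edgeProj, key]; simp [hij]
  have hkj : M.bary t j (M.edgeProj t i j x) = M.bary t i x := by
    rw [edgeProj, key]; simp [hij.symm, hx]
  have hka : ∀ a, a ≠ i → a ≠ j → M.bary t a (M.edgeProj t i j x) = M.bary t a x := by
    intro a h1 h2
    rw [edgeProj, key]; simp [h1, h2]
  constructor
  · rintro ⟨h, -⟩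
    refine ⟨fun a => ?_, hx⟩
    by_cases h1 : a = i
    · rw [h1, ← hkj]; exact h j
    by_cases h2 : a = j
    · rw [h2, hx]
    rw [← hka a h1 h2]; exact h a
  · rintro ⟨h, -⟩
    refine ⟨fun a => ?_, hki⟩
    by_cases h1 : a = i
    · rw [h1, hki]
    by_cases h2 : a = j
    · rw [h2, hkj]; exact h i
    rw [hka a h1 h2]; exact h a

/-- The face opposite `i`, moved along the edge from `i` to `j`, sweeps out a sheared prism: all points
that project to the face and have a coordinate between `0` and `1` at `j`. -/
theorem isCompact_prism [DecidableEq (E d)] {t : ι} {i j : E d} (hi : i ∈ M.vert t)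
    (hj : j ∈ M.vert t) (hij : i ≠ j) :
    IsCompact {x | M.edgeProj t i j x ∈ convexHull ℝ ((M.vert t).erase i : Set (E d)) ∧
      M.bary t j x ∈ Set.Icc (0 : ℝ) 1} := by
  have hcK := (((M.vert t).erase i).finite_toSet.isCompact_convexHull ℝ)
  have hc : IsCompact ((fun p : E d × ℝ => p.1 + p.2 • (j - i)) ''
      ((convexHull ℝ ((M.vert t).erase i : Set (E d))) ×ˢ Set.Icc (-1 : ℝ) 1)) :=
    (hcK.prod isCompact_Icc).image
      (f := fun p : E d × ℝ => p.1 + p.2 • (j - i)) (by fun_prop)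
  refine hc.of_isClosed_subset ?_ ?_
  · exact (hcK.isClosed.preimage (M.continuous_edgeProj t i j)).inter
      (isClosed_Icc.preimage (M.continuous_bary t j))
  · rintro x ⟨hx, hx0, hx1⟩
    refine ⟨(M.edgeProj t i j x, -M.bary t i x), ⟨hx, ?_⟩, ?_⟩
    · have h1 := M.mem_cell_iff.1 ((M.mem_face_iff).1 hx).1 j
      have h2 : M.bary t j (M.edgeProj t i j x) ≤ 1 := by
        rw [← M.sum_bary t (M.edgeProj t i j x)]
        exact Finset.single_le_sum (f := fun a => M.bary t a (M.edgeProj t i j x))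
          (fun a _ => M.mem_cell_iff.1 ((M.mem_face_iff).1 hx).1 a) hj
      rw [edgeProj, M.bary_add_smul hi hj] at h1 h2
      simp only [if_true, if_neg hij.symm, sub_zero, mul_one] at h1 h2
      constructor <;> linarith
    · simp only [edgeProj]; module

variable [DecidableEq (E d)]

/-- `n a` is, for each vertex `a` of the simplex `t`, the outward unit normal on the face
opposite `a`. -/
structure IsOutwardNormal (t : ι) (n : E d → E d) : Prop where
  norm_eq : ∀ a ∈ M.vert t, ‖n a‖ = 1
  orthogonal : ∀ a ∈ M.vert t, ∀ x ∈ (M.vert t).erase a, ∀ y ∈ (M.vert t).erase a,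
    inner ℝ (n a) (y - x) = (0 : ℝ)
  outward : ∀ a ∈ M.vert t, ∀ x ∈ (M.vert t).erase a, inner ℝ (n a) (a - x) < (0 : ℝ)

variable {M} {t : ι} {n : E d → E d}

theorem IsOutwardNormal.inner_sub_eq_zero_iff (hn : M.IsOutwardNormal t n) {i j : E d}
    (hi : i ∈ M.vert t) (hj : j ∈ M.vert t) (hij : i ≠ j) (x : E d) :
    inner ℝ (n j) (x - i) = (0 : ℝ) ↔ M.bary t j x = 0 := by
  have hi' : i ∈ (M.vert t).erase j := Finset.mem_erase.2 ⟨hij, hi⟩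
  rw [M.inner_normal_eq hj fun x hx => hn.orthogonal j hj i hi' x hx]
  simp [(hn.outward j hj i hi').ne]

theorem IsOutwardNormal.bary_eq_zero (hn : M.IsOutwardNormal t n) {i j : E d}
    (hi : i ∈ M.vert t) (hj : j ∈ M.vert t) (hij : i ≠ j) (y : (ℝ ∙ n j)ᗮ) :
    M.bary t j (i + y) = 0 := by
  rw [← hn.inner_sub_eq_zero_iff hi hj hij, add_sub_cancel_left]
  exact Submodule.mem_orthogonal_singleton_iff_inner_right.1 y.2

/-- Change of variables between the two faces that the direction of an edge meets transversally. -/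
theorem IsOutwardNormal.integral_edgeProj (hn : M.IsOutwardNormal t n) {i j : E d}
    (hi : i ∈ M.vert t) (hj : j ∈ M.vert t) (hij : i ≠ j) {g : E d → ℝ} (hg : Continuous g) :
    |inner ℝ (n j) (j - i)| * (∫ y : (ℝ ∙ n j)ᗮ,
        (convexHull ℝ ((M.vert t).erase j : Set (E d))).indicator
          (fun x => g (M.edgeProj t i j x)) (i + y)) =
      |inner ℝ (n i) (j - i)| * faceIntegral ((M.vert t).erase i) g := by
  have hi' : i ∈ (M.vert t).erase j := Finset.mem_erase.2 ⟨hij, hi⟩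
  have hj' : j ∈ (M.vert t).erase i := Finset.mem_erase.2 ⟨hij.symm, hj⟩
  have hnj : inner ℝ (n j) (j - i) ≠ (0 : ℝ) := (hn.outward j hj i hi').ne
  have hni : inner ℝ (n i) (j - i) ≠ (0 : ℝ) := by
    have := hn.outward i hi j hj'
    rw [← neg_sub, inner_neg_right] at this
    linarith
  -- The integral of `g ∘ edgeProj` over the prism is computed by two slicings in the direction of the
  -- edge, with base planes that contain the two faces. The fibres have length `1` in both cases.
  set K := {x | M.edgeProj t i j x ∈ convexHull ℝ ((M.vert t).erase i : Set (E d)) ∧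
      M.bary t j x ∈ Set.Icc (0 : ℝ) 1} with hK
  set G : E d → ℝ := K.indicator fun x => g (M.edgeProj t i j x) with hGdef
  have hG : Integrable G := by
    rw [hGdef, integrable_indicator_iff (M.isCompact_prism hi hj hij).measurableSet]
    exact (hg.comp (M.continuous_edgeProj t i j)).continuousOn.integrableOn_compact
      (M.isCompact_prism hi hj hij)
  have hGs : ∀ x s, G (x + s • (j - i)) =
      (convexHull ℝ ((M.vert t).erase i : Set (E d))).indicator g (M.edgeProj t i j x) *
      (Set.Icc (-M.bary t j x) (1 - M.bary t j x)).indicator (fun _ => (1 : ℝ)) s := by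
    intro x s
    have h1 : x + s • (j - i) ∈ K ↔
        M.edgeProj t i j x ∈ convexHull ℝ ((M.vert t).erase i : Set (E d)) ∧
          s ∈ Set.Icc (-M.bary t j x) (1 - M.bary t j x) := by
      rw [hK, Set.mem_ofPred_eq, M.edgeProj_add_smul hi hj hij, M.bary_add_smul hi hj]
      refine and_congr_right fun _ => ?_
      simp only [if_true, if_neg hij.symm, Set.mem_Icc]
      constructor <;> rintro ⟨h1, h2⟩ <;> constructor <;> linarith
    by_cases hA : M.edgeProj t i j x ∈ convexHull ℝ ((M.vert t).erase i : Set (E d))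
    · by_cases hB : s ∈ Set.Icc (-M.bary t j x) (1 - M.bary t j x)
      · rw [hGdef, Set.indicator_of_mem (h1.2 ⟨hA, hB⟩), Set.indicator_of_mem hA,
          Set.indicator_of_mem hB, mul_one, M.edgeProj_add_smul hi hj hij]
      · rw [hGdef, Set.indicator_of_notMem (fun h => hB (h1.1 h).2), Set.indicator_of_notMem hB,
          mul_zero]
    · rw [hGdef, Set.indicator_of_notMem (fun h => hA (h1.1 h).1), Set.indicator_of_notMem hA,
        zero_mul]
  have hinner : ∀ x, ∫ s : ℝ, G (x + s • (j - i)) =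
      (convexHull ℝ ((M.vert t).erase i : Set (E d))).indicator g (M.edgeProj t i j x) := by
    intro x
    simp_rw [hGs x, integral_const_mul, integral_indicator measurableSet_Icc]
    simp
  have e1 := integral_slice (hn.norm_eq j hj) hnj i hG
  have e2 := integral_slice (hn.norm_eq i hi) hni j hG
  simp_rw [hinner] at e1 e2
  have r1 : ∀ y : (ℝ ∙ n j)ᗮ, (convexHull ℝ ((M.vert t).erase i : Set (E d))).indicator g
        (M.edgeProj t i j (i + y)) = (convexHull ℝ ((M.vert t).erase j : Set (E d))).indicator
          (fun x => g (M.edgeProj t i j x)) (i + y) := by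
    intro y
    have h := M.edgeProj_mem_face_iff hi hj hij (hn.bary_eq_zero hi hj hij y)
    by_cases hA : (i + y : E d) ∈ convexHull ℝ ((M.vert t).erase j : Set (E d))
    · rw [Set.indicator_of_mem hA, Set.indicator_of_mem (h.2 hA)]
    · rw [Set.indicator_of_notMem hA, Set.indicator_of_notMem (fun h' => hA (h.1 h'))]
  have r2 : ∀ y : (ℝ ∙ n i)ᗮ, M.edgeProj t i j (j + y) = j + y := by
    intro y
    rw [edgeProj, hn.bary_eq_zero hj hi hij.symm, zero_smul, add_zero]
  simp_rw [r1] at e1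
  simp_rw [r2] at e2
  rw [← e1, e2, faceIntegral, setIntegral_hyperplane (hn.norm_eq i hi) j (measurableSet_face _)
    (fun x hx => ?_) hg]
  exact (hn.inner_sub_eq_zero_iff hj hi hij.symm x).2 ((M.mem_face_iff).1 hx).2

end SimplicialMesh

theorem hasDerivAt_line {d : ℕ} {g : E d → ℝ} (hg : ContDiff ℝ 1 g) (x w : E d) (s : ℝ) :
    HasDerivAt (fun s : ℝ => g (x + s • w)) (fderiv ℝ g (x + s • w) w) s := by
  have h1 : HasDerivAt (fun s : ℝ => x + s • w) w s := by
    simpa using ((hasDerivAt_id s).smul_const w).const_add x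
  have h2 := (hg.differentiable one_ne_zero (x + s • w)).hasFDerivAt
  exact h2.comp_hasDerivAt s h1

namespace SimplicialMesh

variable {d : ℕ} {ι : Type*} {M : SimplicialMesh d ι} [DecidableEq (E d)] {t : ι} {n : E d → E d}

theorem mem_cell_add_smul_iff {i j : E d} (hi : i ∈ M.vert t) (hj : j ∈ M.vert t) (hij : i ≠ j)
    {x : E d} (hx : M.bary t j x = 0) (s : ℝ) :
    x + s • (j - i) ∈ M.cell t ↔
      x ∈ convexHull ℝ ((M.vert t).erase j : Set (E d)) ∧ s ∈ Set.Icc 0 (M.bary t i x) := by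
  rw [M.mem_face_iff, M.mem_cell_iff, M.mem_cell_iff]
  have key := fun a => M.bary_add_smul hi hj a x s
  have hki : M.bary t i (x + s • (j - i)) = M.bary t i x - s := by
    rw [key]; simp [hij]; ring
  have hkj : M.bary t j (x + s • (j - i)) = s := by
    rw [key]; simp [hij.symm, hx]
  have hka : ∀ a, a ≠ i → a ≠ j → M.bary t a (x + s • (j - i)) = M.bary t a x := by
    intro a h1 h2
    rw [key]; simp [h1, h2]
  constructor
  · intro h
    have h1 := h i
    have h2 := h j
    rw [hki] at h1
    rw [hkj] at h2
    refine ⟨⟨fun a => ?_, hx⟩, h2, by linarith⟩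
    by_cases hai : a = i
    · rw [hai]; linarith
    by_cases haj : a = j
    · rw [haj, hx]
    rw [← hka a hai haj]; exact h a
  · rintro ⟨⟨h, -⟩, h1, h2⟩ a
    by_cases hai : a = i
    · rw [hai, hki]; linarith
    by_cases haj : a = j
    · rw [haj, hkj]; exact h1
    rw [hka a hai haj]; exact h a

/-- The divergence theorem in the direction of an edge of the simplex. -/
theorem IsOutwardNormal.integral_fderiv_edge (hn : M.IsOutwardNormal t n) {i j : E d}
    (hi : i ∈ M.vert t) (hj : j ∈ M.vert t) (hij : i ≠ j) {g : E d → ℝ} (hg : ContDiff ℝ 1 g) :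
    ∫ x in M.cell t, fderiv ℝ g x (j - i) =
      inner ℝ (n i) (j - i) * faceIntegral ((M.vert t).erase i) g +
        inner ℝ (n j) (j - i) * faceIntegral ((M.vert t).erase j) g := by
  have hi' : i ∈ (M.vert t).erase j := Finset.mem_erase.2 ⟨hij, hi⟩
  have hj' : j ∈ (M.vert t).erase i := Finset.mem_erase.2 ⟨hij.symm, hj⟩
  have hnj : inner ℝ (n j) (j - i) < (0 : ℝ) := hn.outward j hj i hi'
  have hni : 0 < (inner ℝ (n i) (j - i) : ℝ) := by
    have := hn.outward i hi j hj'
    rw [← neg_sub, inner_neg_right] at this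
    linarith
  have hgc := hg.continuous
  have hdc : Continuous fun x => fderiv ℝ g x (j - i) :=
    (hg.continuous_fderiv one_ne_zero).clm_apply continuous_const
  have hG : Integrable ((M.cell t).indicator fun x => fderiv ℝ g x (j - i)) := by
    rw [integrable_indicator_iff (M.isClosed_cell t).measurableSet]
    exact hdc.continuousOn.integrableOn_compact (M.isCompact_cell t)
  set F := convexHull ℝ ((M.vert t).erase j : Set (E d)) with hF
  have hFc : IsCompact F := ((M.vert t).erase j).finite_toSet.isCompact_convexHull ℝ
  -- The line through a point `x` of the face opposite `j` leaves the simplex at `edgeProj x`, at the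
  -- parameter `bary i x`; the fundamental theorem of calculus applies between the two points.
  have hinner : ∀ y : (ℝ ∙ n j)ᗮ, ∫ s : ℝ, (M.cell t).indicator (fun x => fderiv ℝ g x (j - i))
      (i + y + s • (j - i)) =
        F.indicator (fun x => g (M.edgeProj t i j x)) (i + y) - F.indicator g (i + y) := by
    intro y
    set x : E d := i + y with hx
    have hx0 : M.bary t j x = 0 := hn.bary_eq_zero hi hj hij y
    by_cases hA : x ∈ F
    · have hb : 0 ≤ M.bary t i x := M.mem_cell_iff.1 (M.mem_face_iff.1 hA).1 i
      have : ∀ s : ℝ, (M.cell t).indicator (fun x => fderiv ℝ g x (j - i)) (x + s • (j - i)) =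
          (Set.Icc 0 (M.bary t i x)).indicator (fun s => fderiv ℝ g (x + s • (j - i)) (j - i)) s := by
        intro s
        have h := mem_cell_add_smul_iff hi hj hij hx0 s
        by_cases hs : s ∈ Set.Icc 0 (M.bary t i x)
        · rw [Set.indicator_of_mem hs, Set.indicator_of_mem (h.2 ⟨hA, hs⟩)]
        · rw [Set.indicator_of_notMem hs, Set.indicator_of_notMem fun h' => hs (h.1 h').2]
      simp_rw [this]
      rw [integral_indicator measurableSet_Icc, integral_Icc_eq_integral_Ioc,
        ← intervalIntegral.integral_of_le hb,
        intervalIntegral.integral_eq_sub_of_hasDerivAt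
          (fun s _ => hasDerivAt_line hg x (j - i) s)
          ((hdc.comp (by fun_prop : Continuous fun s : ℝ => x + s • (j - i))).intervalIntegrable _ _),
        Set.indicator_of_mem hA, Set.indicator_of_mem hA, zero_smul, add_zero, edgeProj]
    · have : ∀ s : ℝ, (M.cell t).indicator (fun x => fderiv ℝ g x (j - i)) (x + s • (j - i)) = 0 :=
        fun s => Set.indicator_of_notMem
          (fun h' => hA ((mem_cell_add_smul_iff hi hj hij hx0 s).1 h').1) _
      simp_rw [this]
      rw [Set.indicator_of_notMem hA, Set.indicator_of_notMem hA]
      simp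
  have hcl := isClosedEmbedding_hyperplane (n j) i
  have hint : ∀ f : E d → ℝ, Continuous f →
      Integrable fun y : (ℝ ∙ n j)ᗮ => F.indicator f (i + y) := by
    intro f hf
    have h1 : (fun y : (ℝ ∙ n j)ᗮ => F.indicator f (i + y)) =
        ((fun y : (ℝ ∙ n j)ᗮ => i + (y : E d)) ⁻¹' F).indicator fun y => f (i + y) := rfl
    have h2 : IsCompact ((fun y : (ℝ ∙ n j)ᗮ => i + (y : E d)) ⁻¹' F) :=
      hcl.isCompact_preimage hFc
    rw [h1, integrable_indicator_iff h2.measurableSet]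
    exact (hf.comp hcl.continuous).continuousOn.integrableOn_compact h2
  rw [← integral_indicator (M.isClosed_cell t).measurableSet,
    integral_slice (hn.norm_eq j hj) hnj.ne i hG]
  simp_rw [hinner]
  rw [integral_sub (hint (fun x => g (M.edgeProj t i j x))
    (hgc.comp (M.continuous_edgeProj t i j))) (hint _ hgc), mul_sub,
    hn.integral_edgeProj hi hj hij hgc]
  rw [← setIntegral_hyperplane (hn.norm_eq j hj) i hFc.measurableSet
    (fun x hx => (hn.inner_sub_eq_zero_iff hi hj hij x).2 (M.mem_face_iff.1 hx).2) hgc,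
    abs_of_pos hni, abs_of_neg hnj, faceIntegral, faceIntegral]
  ring

/-- The divergence theorem on a simplex, for one component of a vector field. Both sides are linear in
the direction `w`, and the edges span the whole space. -/
theorem IsOutwardNormal.integral_fderiv (hn : M.IsOutwardNormal t n) {g : E d → ℝ}
    (hg : ContDiff ℝ 1 g) (w : E d) :
    ∫ x in M.cell t, fderiv ℝ g x w =
      ∑ a ∈ M.vert t, inner ℝ (n a) w * faceIntegral ((M.vert t).erase a) g := by
  have hdc : ∀ w, Continuous fun x => fderiv ℝ g x w := fun w =>
    (hg.continuous_fderiv one_ne_zero).clm_apply continuous_const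
  have hint : ∀ w, IntegrableOn (fun x => fderiv ℝ g x w) (M.cell t) := fun w =>
    (hdc w).continuousOn.integrableOn_compact (M.isCompact_cell t)
  have hspan : w ∈ Submodule.span ℝ ((M.vert t : Set (E d)) -ᵥ (M.vert t : Set (E d))) := by
    have h1 : affineSpan ℝ (M.vert t : Set (E d)) = ⊤ := by
      rw [← M.range_basis t]; exact (M.basis t).tot
    have h2 : vectorSpan ℝ (M.vert t : Set (E d)) = ⊤ := by
      rw [← direction_affineSpan, h1, AffineSubspace.direction_top]
    rw [← vectorSpan_def, h2]
    trivial
  induction hspan using Submodule.span_induction with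
  | mem w hw =>
    obtain ⟨j, hj, i, hi, rfl⟩ := Set.mem_vsub.1 hw
    rw [Finset.mem_coe] at hi hj
    rw [vsub_eq_sub]
    by_cases hij : i = j
    · simp [hij]
    rw [hn.integral_fderiv_edge hi hj hij hg]
    have hsub : ({i, j} : Finset (E d)) ⊆ M.vert t := by
      intro a ha
      simp only [Finset.mem_insert, Finset.mem_singleton] at ha
      rcases ha with rfl | rfl <;> assumption
    rw [← Finset.sum_subset hsub, Finset.sum_pair hij]
    intro a ha hna
    simp only [Finset.mem_insert, Finset.mem_singleton, not_or] at hna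
    rw [hn.orthogonal a ha i (Finset.mem_erase.2 ⟨Ne.symm hna.1, hi⟩) j
      (Finset.mem_erase.2 ⟨Ne.symm hna.2, hj⟩), zero_mul]
  | zero => simp
  | add u v _ _ hu hv =>
    simp_rw [map_add, inner_add_right, add_mul, Finset.sum_add_distrib]
    rw [integral_add (hint u) (hint v), hu, hv]
  | smul c u _ hu =>
    simp_rw [map_smul, inner_smul_right, smul_eq_mul, mul_assoc, ← Finset.mul_sum]
    rw [integral_const_mul, hu]

end SimplicialMesh

/-- The divergence of a differentiable vector field. -/
def divergence {d : ℕ} (u : E d → E d) (x : E d) : ℝ :=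
  ∑ i, fderiv ℝ (fun y => u y i) x (EuclideanSpace.single i 1)

theorem contDiff_component {d : ℕ} {u : E d → E d} {m : WithTop ℕ∞} (hu : ContDiff ℝ m u)
    (i : Fin d) : ContDiff ℝ m fun y => u y i := by
  fun_prop

namespace SimplicialMesh

variable {d : ℕ} {ι : Type*} {M : SimplicialMesh d ι} [DecidableEq (E d)] {t : ι} {n : E d → E d}

theorem IsOutwardNormal.integrableOn_face (hn : M.IsOutwardNormal t n) {a : E d}
    (ha : a ∈ M.vert t) {g : E d → ℝ} (hg : Continuous g) :
    IntegrableOn g (convexHull ℝ ((M.vert t).erase a : Set (E d)))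
      (Measure.euclideanHausdorffMeasure (d - 1)) := by
  rcases ((M.vert t).erase a).eq_empty_or_nonempty with h | ⟨b, hb⟩
  · simp [h]
  · have hb' := Finset.mem_erase.1 hb
    exact integrableOn_hyperplane (hn.norm_eq a ha) b
      (((M.vert t).erase a).finite_toSet.isCompact_convexHull ℝ)
      (fun x hx => (hn.inner_sub_eq_zero_iff hb'.2 ha hb'.1 x).2 (M.mem_face_iff.1 hx).2) hg

/-- The divergence theorem on a simplex. -/
theorem IsOutwardNormal.integral_divergence (hn : M.IsOutwardNormal t n) {u : E d → E d}
    (hu : ContDiff ℝ 1 u) :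
    ∫ x in M.cell t, divergence u x =
      ∑ a ∈ M.vert t, faceIntegral ((M.vert t).erase a) fun x => inner ℝ (u x) (n a) := by
  have hint : ∀ i, IntegrableOn (fun x => fderiv ℝ (fun y => u y i) x (EuclideanSpace.single i 1))
      (M.cell t) := fun i =>
    (((contDiff_component hu i).continuous_fderiv one_ne_zero).clm_apply
      continuous_const).continuousOn.integrableOn_compact (M.isCompact_cell t)
  unfold divergence
  rw [integral_finsetSum _ fun i _ => hint i]
  simp_rw [fun i => hn.integral_fderiv (contDiff_component hu i) (EuclideanSpace.single i 1)]
  rw [Finset.sum_comm]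
  refine Finset.sum_congr rfl fun a ha => ?_
  unfold faceIntegral
  simp_rw [PiLp.inner_apply]
  rw [integral_finsetSum]
  · refine Finset.sum_congr rfl fun i _ => ?_
    rw [← integral_const_mul]
    simp
  · intro i _
    exact hn.integrableOn_face ha (by have := hu.continuous; fun_prop)

end SimplicialMesh

/-! ### Neighbors of a face -/

namespace SimplicialMesh

variable {d : ℕ} {ι : Type*} (M : SimplicialMesh d ι) [DecidableEq (E d)]

/-- Two different simplices with a common face lie on different sides of it: otherwise a point near
the barycenter of the face would lie in the interior of both. -/
theorem opposite_side {t t' : ι} (htt : t ≠ t') {e : Finset (E d)} {x₀ : E d} (hx₀ : x₀ ∈ e)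
    {a a' n : E d} (ha : a ∈ M.vert t) (he : e = (M.vert t).erase a)
    (ha' : a' ∈ M.vert t') (he' : e = (M.vert t').erase a')
    (horth : ∀ x ∈ e, inner ℝ n (x - x₀) = (0 : ℝ)) (hneg : inner ℝ n (a - x₀) < (0 : ℝ)) :
    0 < (inner ℝ n (a' - x₀) : ℝ) := by
  by_contra hcon
  push Not at hcon
  have h1 := M.inner_normal_eq ha (n := n) (b := x₀) (fun x hx => horth x (he ▸ hx))
  have h2 := M.inner_normal_eq ha' (n := n) (b := x₀) (fun x hx => horth x (he' ▸ hx))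
  have hlt : (inner ℝ n (a' - x₀) : ℝ) < 0 := by
    refine lt_of_le_of_ne hcon fun h0 => ?_
    have := h2 a
    rw [h0, mul_zero] at this
    linarith
  have hcard : (0 : ℝ) < e.card := by exact_mod_cast Finset.card_pos.2 ⟨x₀, hx₀⟩
  have hesub : e ⊆ M.vert t := he ▸ Finset.erase_subset _ _
  have hesub' : e ⊆ M.vert t' := he' ▸ Finset.erase_subset _ _
  set y : E d := ∑ b ∈ e, (e.card : ℝ)⁻¹ • b with hy
  have hw : ∑ b ∈ e, (e.card : ℝ)⁻¹ = 1 := by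
    rw [Finset.sum_const, nsmul_eq_mul, mul_inv_cancel₀ hcard.ne']
  have hyt : ∀ b ∈ e, 0 < M.bary t b y := fun b hb => by
    rw [hy, M.bary_combination hesub (fun _ => (e.card : ℝ)⁻¹) hw, if_pos hb]
    exact inv_pos.2 hcard
  have hyt' : ∀ b ∈ e, 0 < M.bary t' b y := fun b hb => by
    rw [hy, M.bary_combination hesub' (fun _ => (e.card : ℝ)⁻¹) hw, if_pos hb]
    exact inv_pos.2 hcard
  have hya : M.bary t a y = 0 := by
    rw [hy, M.bary_combination hesub (fun _ => (e.card : ℝ)⁻¹) hw, if_neg (by rw [he]; simp)]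
  have hlim : Tendsto (fun s : ℝ => y + s • (a - x₀)) (𝓝[>] 0) (𝓝 y) := by
    have : Continuous fun s : ℝ => y + s • (a - x₀) := by fun_prop
    simpa using (this.tendsto 0).mono_left nhdsWithin_le_nhds
  have ev1 : ∀ᶠ s : ℝ in 𝓝[>] 0, ∀ b ∈ e, 0 < M.bary t b (y + s • (a - x₀)) :=
    (Finset.eventually_all e).2 fun b hb => (((M.continuous_bary t b).tendsto y).comp
      hlim).eventually (lt_mem_nhds (hyt b hb))
  have ev2 : ∀ᶠ s : ℝ in 𝓝[>] 0, ∀ b ∈ e, 0 < M.bary t' b (y + s • (a - x₀)) :=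
    (Finset.eventually_all e).2 fun b hb => (((M.continuous_bary t' b).tendsto y).comp
      hlim).eventually (lt_mem_nhds (hyt' b hb))
  obtain ⟨s, ⟨hs1, hs2⟩, hs⟩ := ((ev1.and ev2).and self_mem_nhdsWithin).exists
  have hs : 0 < s := hs
  have hta : 0 < M.bary t a (y + s • (a - x₀)) := by
    have hx₀' : a ≠ x₀ := by rintro rfl; rw [he] at hx₀; simp at hx₀
    rw [M.bary_add_smul (hesub hx₀) ha, hya]
    simpa [hx₀'] using hs
  have hta' : 0 < M.bary t' a' (y + s • (a - x₀)) := by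
    have e1 := h1 (y + s • (a - x₀))
    have e2 := h2 (y + s • (a - x₀))
    have : (inner ℝ n (y + s • (a - x₀) - x₀) : ℝ) < 0 := by
      rw [e1]; exact mul_neg_of_pos_of_neg hta hneg
    rw [e2] at this
    exact pos_of_mul_neg_left this hlt.le
  refine htt (M.eq_of_mem_interior_cell (x := y + s • (a - x₀)) ?_ (interior_subset ?_))
  · refine M.mem_interior_cell_iff.2 fun b hb => ?_
    by_cases hba : b = a
    · rw [hba]; exact hta
    · exact hs1 b (he ▸ Finset.mem_erase.2 ⟨hba, hb⟩)
  · refine M.mem_interior_cell_iff.2 fun b hb => ?_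
    by_cases hba : b = a'
    · rw [hba]; exact hta'
    · exact hs2 b (he' ▸ Finset.mem_erase.2 ⟨hba, hb⟩)

end SimplicialMesh

namespace NestedMesh

variable {d : ℕ} {ι J : Type*} (M : NestedMesh d ι J)

/-- A face has no neighbors except `minus e` and `plus e`: of three neighbors, two would lie on the
same side. -/
theorem eq_minus_or_eq_plus (hd : 0 < d) {e : Finset (E d)} (hc : e.card = d) {t : ι}
    (ht : e ⊆ M.vert t) (hm : t ≠ M.minus e) : M.IsInner e ∧ t = M.plus e := by
  classical
  have hface : M.IsFace e := ⟨hc, t, ht⟩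
  have hminus := M.subset_minus e hface
  have hinner : M.IsInner e := ⟨hc, t, M.minus e, hm, ht, hminus⟩
  refine ⟨hinner, ?_⟩
  by_contra hp
  obtain ⟨hplus, hpm⟩ := M.subset_plus e hinner
  obtain ⟨x₀, hx₀⟩ : e.Nonempty := Finset.card_pos.1 (by rw [hc]; exact hd)
  obtain ⟨a, ha, hae, hea⟩ := M.exists_eq_erase ht hc
  obtain ⟨b, hb, hbe, heb⟩ := M.exists_eq_erase hminus hc
  obtain ⟨c, hc', hce, hec⟩ := M.exists_eq_erase hplus hc
  have ho : ∀ x ∈ e, inner ℝ (M.normal e) (x - x₀) = (0 : ℝ) := fun x hx =>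
    M.normal_orthogonal e hface x₀ hx₀ x hx
  have hb0 := M.normal_outward e hface x₀ hx₀ b hb hbe
  have h1 := M.opposite_side (Ne.symm hm) hx₀ hb heb ha hea ho hb0
  have h2 := M.opposite_side (Ne.symm hpm) hx₀ hb heb hc' hec ho hb0
  have h3 := M.opposite_side hp hx₀ ha hea hc' hec (n := -M.normal e)
    (fun x hx => by rw [inner_neg_left, ho x hx, neg_zero]) (by rw [inner_neg_left]; linarith)
  rw [inner_neg_left] at h3
  linarith

open scoped Classical in
/-- The orientation of the normal of the face `e` as seen from the neighbor `t`. -/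
def faceSign (e : Finset (E d)) (t : ι) : ℝ := if t = M.minus e then 1 else -1

open scoped Classical in
theorem isOutwardNormal (t : ι) : M.IsOutwardNormal t
    fun a => M.faceSign ((M.vert t).erase a) t • M.normal ((M.vert t).erase a) := by
  have hface : ∀ a ∈ M.vert t, M.IsFace ((M.vert t).erase a) := fun a ha =>
    ⟨by rw [Finset.card_erase_of_mem ha, M.card_vert]; rfl, t, Finset.erase_subset _ _⟩
  refine ⟨fun a ha => ?_, fun a ha x hx y hy => ?_, fun a ha x hx => ?_⟩
  · rw [norm_smul, M.norm_normal _ (hface a ha), faceSign]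
    split_ifs <;> norm_num
  · rw [inner_smul_left, M.normal_orthogonal _ (hface a ha) x hx y hy, mul_zero]
  · rw [inner_smul_left, faceSign]
    split_ifs with h
    · have := M.normal_outward _ (hface a ha) x hx a (h ▸ ha) (by simp)
      simpa using this
    · have hb := M.subset_minus _ (hface a ha)
      obtain ⟨b, hb1, hb2, hb3⟩ := M.exists_eq_erase hb (hface a ha).1
      have h1 := M.opposite_side (Ne.symm h) hx hb1 hb3 ha rfl
        (fun z hz => M.normal_orthogonal _ (hface a ha) x hx z hz)
        (M.normal_outward _ (hface a ha) x hx b hb1 hb2)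
      simpa using h1

theorem sum_erase_eq_sum_powersetCard [DecidableEq (E d)] (t : ι) (F : Finset (E d) → ℝ) :
    ∑ a ∈ M.vert t, F ((M.vert t).erase a) = ∑ e ∈ (M.vert t).powersetCard d, F e := by
  refine Finset.sum_bij (fun a _ => (M.vert t).erase a) (fun a ha => ?_)
    (fun a ha b hb h => ?_) (fun e he => ?_) fun _ _ => rfl
  · rw [Finset.mem_powersetCard, Finset.card_erase_of_mem ha, M.card_vert]
    exact ⟨Finset.erase_subset _ _, rfl⟩
  · by_contra hab
    have h1 : a ∈ (M.vert t).erase b := Finset.mem_erase.2 ⟨hab, ha⟩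
    rw [← h] at h1
    simp at h1
  · rw [Finset.mem_powersetCard] at he
    obtain ⟨a, ha, -, h⟩ := M.exists_eq_erase he.1 he.2
    exact ⟨a, ha, h.symm⟩

variable [Fintype ι]

theorem mem_faces_iff {e : Finset (E d)} : e ∈ M.faces ↔ M.IsFace e := by
  classical
  simp only [faces, Finset.mem_biUnion, Finset.mem_univ, true_and, Finset.mem_powersetCard,
    SimplicialMesh.IsFace]
  exact ⟨fun ⟨t, h1, h2⟩ => ⟨h2, t, h1⟩, fun ⟨h2, t, h1⟩ => ⟨t, h1, h2⟩⟩

/-- Summation by parts: face contributions collected over the elements give the jumps. -/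
theorem sum_faceSign_eq_sum_jump (hd : 0 < d) (χ : ι → ℝ) (F : Finset (E d) → ℝ) (x : E d) :
    ∑ t, χ t * ∑ e ∈ (M.vert t).powersetCard d, M.faceSign e t * F e =
      ∑ e ∈ M.faces, jump M e (fun t _ => χ t) x * F e := by
  classical
  have h1 : ∀ t, χ t * ∑ e ∈ (M.vert t).powersetCard d, M.faceSign e t * F e =
      ∑ e ∈ M.faces, if e ⊆ M.vert t then χ t * (M.faceSign e t * F e) else 0 := by
    intro t
    rw [Finset.mul_sum, ← Finset.sum_filter]
    refine Finset.sum_congr ?_ fun _ _ => rfl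
    ext e
    rw [Finset.mem_powersetCard, Finset.mem_filter, mem_faces_iff]
    exact ⟨fun h => ⟨⟨h.2, t, h.1⟩, h.1⟩, fun h => ⟨h.2, h.1.1⟩⟩
  simp_rw [h1]
  rw [Finset.sum_comm]
  refine Finset.sum_congr rfl fun e he => ?_
  rw [mem_faces_iff] at he
  have hm := M.subset_minus e he
  rw [← Finset.sum_filter]
  by_cases hin : M.IsInner e
  · obtain ⟨hp, hpm⟩ := M.subset_plus e hin
    have : (Finset.univ.filter fun t => e ⊆ M.vert t) = {M.minus e, M.plus e} := by
      ext t
      simp only [Finset.mem_filter, Finset.mem_univ, true_and, Finset.mem_insert,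
        Finset.mem_singleton]
      refine ⟨fun h => ?_, fun h => ?_⟩
      · by_contra hcon
        push Not at hcon
        exact hcon.2 (M.eq_minus_or_eq_plus hd he.1 h hcon.1).2
      · rcases h with rfl | rfl <;> assumption
    rw [this, Finset.sum_pair (Ne.symm hpm), jump, if_pos hin, faceSign, faceSign, if_pos rfl,
      if_neg hpm]
    ring
  · have : (Finset.univ.filter fun t => e ⊆ M.vert t) = {M.minus e} := by
      ext t
      simp only [Finset.mem_filter, Finset.mem_univ, true_and, Finset.mem_singleton]
      refine ⟨fun h => ?_, fun h => ?_⟩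
      · by_contra hcon
        exact hin (M.eq_minus_or_eq_plus hd he.1 h hcon).1
      · rw [h]; assumption
    rw [this, Finset.sum_singleton, jump, if_neg hin, faceSign, if_pos rfl]
    ring

end NestedMesh

/-! ### Elements cover the domain up to a null set -/

namespace SimplicialMesh

variable {d : ℕ} {ι : Type*} (M : SimplicialMesh d ι)

theorem ae_eq_interior_cell (t : ι) : (interior (M.cell t) : Set (E d)) =ᵐ[volume] M.cell t :=
  interior_ae_eq_of_null_frontier ((M.convex_cell t).addHaar_frontier volume)

theorem pairwise_disjoint_interior_cell :
    Pairwise (Function.onFun Disjoint fun t => interior (M.cell t)) := fun _ _ h =>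
  Set.disjoint_left.2 fun _ hx hx' => h (M.eq_of_mem_interior_cell hx (interior_subset hx'))

theorem ae_eq_iUnion_interior_cell [Finite ι] (p : ι → Prop) :
    (interior (⋃ t, ⋃ _ : p t, M.cell t) : Set (E d)) =ᵐ[volume]
      (⋃ t, ⋃ _ : p t, interior (M.cell t) : Set (E d)) := by
  have h1 : (⋃ t, ⋃ _ : p t, interior (M.cell t) : Set (E d)) ≤ᵐ[volume]
      interior (⋃ t, ⋃ _ : p t, M.cell t) :=
    (Set.iUnion₂_subset fun t ht => interior_mono (Set.subset_iUnion₂ (s := fun t _ => M.cell t)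
      t ht)).eventuallyLE
  have h2 : (⋃ t, ⋃ _ : p t, M.cell t : Set (E d)) ≤ᵐ[volume]
      (⋃ t, ⋃ _ : p t, interior (M.cell t) : Set (E d)) :=
    Filter.EventuallyLE.countable_iUnion fun t =>
      Filter.EventuallyLE.countable_iUnion fun _ =>
      (M.ae_eq_interior_cell t).symm.le
  exact ((interior_subset.eventuallyLE).trans h2).antisymm h1

end SimplicialMesh

namespace NestedMesh

variable {d : ℕ} {ι J : Type*} (M : NestedMesh d ι J)

theorem isOpen_domain : IsOpen M.domain := isOpen_interior

theorem isOpen_coarseSet (T : J) : IsOpen (M.coarseSet T) := isOpen_interior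

theorem coarseSet_subset_domain (T : J) : M.coarseSet T ⊆ M.domain :=
  interior_mono (Set.iUnion_mono fun _ => Set.iUnion_subset fun _ => subset_rfl)

theorem interior_cell_subset_domain (t : ι) : interior (M.cell t) ⊆ M.domain :=
  interior_mono (Set.subset_iUnion _ t)

variable [Fintype ι]

theorem isCompact_iUnion_cell : IsCompact (⋃ t, M.cell t) :=
  isCompact_iUnion fun t => M.isCompact_cell t

theorem isBounded_domain : Bornology.IsBounded M.domain :=
  M.isCompact_iUnion_cell.isBounded.subset interior_subset

instance isFiniteMeasure_domain : IsFiniteMeasure (volume.restrict M.domain) :=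
  ⟨by simpa using M.isBounded_domain.measure_lt_top⟩

theorem domain_ae_eq : M.domain =ᵐ[volume] ⋃ t, interior (M.cell t) := by
  have := M.ae_eq_iUnion_interior_cell fun _ => True
  simpa [domain] using this

theorem coarseSet_ae_eq (T : J) :
    M.coarseSet T =ᵐ[volume] ⋃ t, ⋃ _ : M.coarse t = T, interior (M.cell t) :=
  M.ae_eq_iUnion_interior_cell fun t => M.coarse t = T

theorem ae_domain_of_forall_cell {p : E d → Prop}
    (h : ∀ t, ∀ᵐ x ∂volume.restrict (interior (M.cell t)), p x) :
    ∀ᵐ x ∂volume.restrict M.domain, p x := by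
  rw [Measure.restrict_congr_set M.domain_ae_eq, ae_restrict_iUnion_iff]
  exact h

theorem ae_coarseSet_of_forall_cell {T : J} {p : E d → Prop}
    (h : ∀ t, M.coarse t = T → ∀ᵐ x ∂volume.restrict (interior (M.cell t)), p x) :
    ∀ᵐ x ∂volume.restrict (M.coarseSet T), p x := by
  rw [Measure.restrict_congr_set (M.coarseSet_ae_eq T), ae_restrict_iUnion_iff]
  intro t
  by_cases ht : M.coarse t = T
  · simpa [ht] using h t ht
  · simp [ht]

theorem setIntegral_coarseSet [DecidableEq J] (T : J) {f : E d → ℝ}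
    (hf : IntegrableOn f M.domain) :
    ∫ x in M.coarseSet T, f x =
      ∑ t, (if M.coarse t = T then 1 else 0) * ∫ x in interior (M.cell t), f x := by
  have h1 : (⋃ t, ⋃ _ : M.coarse t = T, interior (M.cell t)) =
      ⋃ t ∈ Finset.univ.filter fun t => M.coarse t = T, interior (M.cell t) := by
    simp
  rw [setIntegral_congr_set (M.coarseSet_ae_eq T), h1, integral_biUnion_finset]
  · rw [Finset.sum_filter]
    refine Finset.sum_congr rfl fun t _ => ?_
    split_ifs <;> simp
  · exact fun t _ => isOpen_interior.measurableSet
  · exact fun t _ t' _ h => M.pairwise_disjoint_interior_cell h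
  · exact fun t _ => hf.mono_set (M.interior_cell_subset_domain t)

theorem setIntegral_domain {f : E d → ℝ} (hf : IntegrableOn f M.domain) :
    ∫ x in M.domain, f x = ∑ t, ∫ x in interior (M.cell t), f x := by
  rw [setIntegral_congr_set M.domain_ae_eq, integral_iUnion_fintype]
  · exact fun t => isOpen_interior.measurableSet
  · exact M.pairwise_disjoint_interior_cell
  · exact fun t => hf.mono_set (M.interior_cell_subset_domain t)

theorem sum_setIntegral_coarseSet [Fintype J] {f : E d → ℝ} (hf : IntegrableOn f M.domain) :
    ∑ T, ∫ x in M.coarseSet T, f x = ∫ x in M.domain, f x := by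
  classical
  simp_rw [fun T => M.setIntegral_coarseSet T hf, M.setIntegral_domain hf]
  rw [Finset.sum_comm]
  simp

theorem glue_of_mem {F : Type*} [AddCommMonoid F] (q : ι → E d → F) {t : ι} {x : E d}
    (hx : x ∈ interior (M.cell t)) : M.glue q x = q t x := by
  rw [glue, Finset.sum_eq_single t, Set.indicator_of_mem hx]
  · intro t' _ htt
    exact Set.indicator_of_notMem
      (fun h => htt (M.eq_of_mem_interior_cell h (interior_subset hx))) _
  · simp

end NestedMesh

/-! ### The inner product of `L²` -/

section LTwo

variable {α H : Type*} [MeasurableSpace α] {μ : Measure α} [NormedAddCommGroup H]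
  [InnerProductSpace ℝ H]

theorem integral_inner_eq_inner_toLp {f g : α → H} (hf : MemLp f 2 μ) (hg : MemLp g 2 μ) :
    ∫ x, inner ℝ (f x) (g x) ∂μ = inner ℝ (hf.toLp f) (hg.toLp g) := by
  rw [L2.inner_def]
  refine integral_congr_ae ?_
  filter_upwards [hf.coeFn_toLp, hg.coeFn_toLp] with x h1 h2
  rw [h1, h2]

theorem integrable_inner {f g : α → H} (hf : MemLp f 2 μ) (hg : MemLp g 2 μ) :
    Integrable (fun x => inner ℝ (f x) (g x)) μ := by
  refine (L2.integrable_inner (𝕜 := ℝ) (hf.toLp f) (hg.toLp g)).congr ?_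
  filter_upwards [hf.coeFn_toLp, hg.coeFn_toLp] with x h1 h2
  rw [h1, h2]

theorem integrable_mul {f g : α → ℝ} (hf : MemLp f 2 μ) (hg : MemLp g 2 μ) :
    Integrable (fun x => f x * g x) μ :=
  hf.integrable_mul hg

theorem norm_toLp_eq_sqrt {f : α → H} (hf : MemLp f 2 μ) :
    ‖hf.toLp f‖ = √(∫ x, ‖f x‖ ^ 2 ∂μ) := by
  have := integral_inner_eq_inner_toLp hf hf
  simp_rw [real_inner_self_eq_norm_sq] at this
  rw [this, Real.sqrt_sq (norm_nonneg _)]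

/-- The Cauchy-Schwarz inequality in `L²`. -/
theorem abs_integral_inner_le {f g : α → H} (hf : MemLp f 2 μ) (hg : MemLp g 2 μ) :
    |∫ x, inner ℝ (f x) (g x) ∂μ| ≤ √(∫ x, ‖f x‖ ^ 2 ∂μ) * √(∫ x, ‖g x‖ ^ 2 ∂μ) := by
  rw [integral_inner_eq_inner_toLp hf hg, ← norm_toLp_eq_sqrt hf, ← norm_toLp_eq_sqrt hg]
  exact abs_real_inner_le_norm _ _

theorem abs_integral_mul_le {f g : α → ℝ} (hf : MemLp f 2 μ) (hg : MemLp g 2 μ) :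
    |∫ x, f x * g x ∂μ| ≤ √(∫ x, f x ^ 2 ∂μ) * √(∫ x, g x ^ 2 ∂μ) := by
  have h := abs_integral_inner_le hf hg
  simpa [mul_comm] using h

theorem tendsto_integral_inner {v : α → H} (hv : MemLp v 2 μ) {F : ℕ → α → H} {G : α → H}
    (hF : ∀ n, MemLp (F n) 2 μ) (hG : MemLp G 2 μ)
    (h : Tendsto (fun n => eLpNorm (fun x => G x - F n x) 2 μ) atTop (𝓝 0)) :
    Tendsto (fun n => ∫ x, inner ℝ (v x) (F n x) ∂μ) atTop (𝓝 (∫ x, inner ℝ (v x) (G x) ∂μ)) := by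
  simp_rw [fun n => integral_inner_eq_inner_toLp hv (hF n), integral_inner_eq_inner_toLp hv hG]
  refine Tendsto.inner tendsto_const_nhds ?_
  rw [Lp.tendsto_Lp_iff_tendsto_eLpNorm'']
  refine h.congr fun n => ?_
  rw [← eLpNorm_neg]
  congr 1
  funext x
  simp

end LTwo

/-! ### Weak derivatives -/

section Sobolev

variable {d : ℕ} {U V : Set (E d)} {u : E d → ℝ} {φ : E d → ℝ} {G G' : E d → E d}

theorem inner_gradient (φ : E d → ℝ) (x w : E d) : inner ℝ (gradient φ x) w = fderiv ℝ φ x w := by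
  rw [gradient, InnerProductSpace.toDual_symm_apply]

namespace IsTest

theorem continuous (h : IsTest U φ) : Continuous φ := h.1.continuous

theorem mono (h : IsTest V φ) (hVU : V ⊆ U) : IsTest U φ := ⟨h.1, h.2.1, h.2.2.trans hVU⟩

theorem sub {ψ : E d → ℝ} (h : IsTest U φ) (h' : IsTest U ψ) : IsTest U fun x => φ x - ψ x :=
  ⟨h.1.sub h'.1, h.2.1.sub h'.2.1, (tsupport_sub φ ψ).trans (Set.union_subset h.2.2 h'.2.2)⟩

theorem eq_zero (h : IsTest U φ) {x : E d} (hx : x ∉ U) : φ x = 0 :=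
  image_eq_zero_of_notMem_tsupport fun h' => hx (h.2.2 h')

theorem fderiv_eq_zero (h : IsTest U φ) {x : E d} (hx : x ∉ U) : fderiv ℝ φ x = 0 := by
  by_contra hne
  exact hx (h.2.2 (tsupport_fderiv_subset ℝ (subset_tsupport _ hne)))

theorem gradient_eq_zero (h : IsTest U φ) {x : E d} (hx : x ∉ U) : gradient φ x = 0 := by
  rw [gradient, h.fderiv_eq_zero hx, map_zero]

theorem memLp (h : IsTest U φ) (μ : Measure (E d)) [IsFiniteMeasureOnCompacts μ] : MemLp φ 2 μ :=
  h.continuous.memLp_of_hasCompactSupport h.2.1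

theorem continuous_fderiv (h : IsTest U φ) : Continuous (fderiv ℝ φ) :=
  h.1.continuous_fderiv (by simp)

theorem continuous_gradient (h : IsTest U φ) : Continuous (gradient φ) :=
  (LinearIsometryEquiv.continuous _).comp h.continuous_fderiv

theorem memLp_gradient (h : IsTest U φ) (μ : Measure (E d)) [IsFiniteMeasureOnCompacts μ] :
    MemLp (gradient φ) 2 μ :=
  h.continuous_gradient.memLp_of_hasCompactSupport
    ((h.2.1.fderiv ℝ).comp_left (map_zero (InnerProductSpace.toDual ℝ (E d)).symm))

theorem memLp_fderiv (h : IsTest U φ) (w : E d) (μ : Measure (E d))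
    [IsFiniteMeasureOnCompacts μ] : MemLp (fun x => fderiv ℝ φ x w) 2 μ :=
  (h.continuous_fderiv.clm_apply continuous_const).memLp_of_hasCompactSupport
    ((h.2.1.fderiv ℝ).comp_left (g := fun L : E d →L[ℝ] ℝ => L w) rfl)

end IsTest

theorem setIntegral_eq_integral_of_eq_zero {g : E d → ℝ} (h : ∀ x, x ∉ U → g x = 0) :
    ∫ x in U, g x = ∫ x, g x :=
  setIntegral_eq_integral_of_forall_compl_eq_zero h

theorem IsWeakGrad.mono (h : IsWeakGrad U u G) (hVU : V ⊆ U) : IsWeakGrad V u G := by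
  intro φ hφ w
  have := h φ (hφ.mono hVU) w
  rw [setIntegral_eq_integral_of_eq_zero, setIntegral_eq_integral_of_eq_zero] at this ⊢
  · exact this
  all_goals intro x hx
  · simp [hφ.eq_zero hx]
  · simp [(hφ.mono hVU).eq_zero hx]
  · simp [hφ.fderiv_eq_zero hx]
  · simp [(hφ.mono hVU).fderiv_eq_zero hx]

theorem IsWeakGrad.sub {u' : E d → ℝ} (h : IsWeakGrad U u G) (h' : IsWeakGrad U u' G')
    (hu : MemLp u 2 (volume.restrict U)) (hu' : MemLp u' 2 (volume.restrict U))
    (hG : MemLp G 2 (volume.restrict U)) (hG' : MemLp G' 2 (volume.restrict U)) :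
    IsWeakGrad U (fun x => u x - u' x) fun x => G x - G' x := by
  intro φ hφ w
  have i1 := integrable_mul hu (hφ.memLp_fderiv w (volume.restrict U))
  have i2 := integrable_mul hu' (hφ.memLp_fderiv w (volume.restrict U))
  have i3 := integrable_mul (hG.inner_const (𝕜 := ℝ) w) (hφ.memLp (volume.restrict U))
  have i4 := integrable_mul (hG'.inner_const (𝕜 := ℝ) w) (hφ.memLp (volume.restrict U))
  simp_rw [inner_sub_left, sub_mul]
  rw [integral_sub i1 i2, integral_sub i3 i4, h φ hφ w, h' φ hφ w]
  ring

/-- Weak gradients are unique. -/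
theorem IsWeakGrad.ae_eq (hU : IsOpen U) (h : IsWeakGrad U u G) (h' : IsWeakGrad U u G')
    (hG : MemLp G 2 (volume.restrict U)) (hG' : MemLp G' 2 (volume.restrict U)) :
    G =ᵐ[volume.restrict U] G' := by
  have hloc : LocallyIntegrableOn (fun x => G x - G' x) U := by
    have := (hG.sub hG').locallyIntegrable one_le_two
    exact locallyIntegrableOn_of_locallyIntegrable_restrict this
  have key := hU.ae_eq_zero_of_integral_contDiff_smul_eq_zero (μ := volume) hloc ?_
  · rw [EventuallyEq, ae_restrict_iff' hU.measurableSet]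
    filter_upwards [key] with x hx hxU
    exact sub_eq_zero.1 (hx hxU)
  intro φ h1 h2 h3
  have hφ : IsTest U φ := ⟨h1, h2, h3⟩
  have hφL := hφ.memLp (volume.restrict U)
  have hint : IntegrableOn (fun x => φ x • (G x - G' x)) U :=
    memLp_one_iff_integrable.1 ((hG.sub hG').smul (r := 1) hφL)
  rw [← setIntegral_eq_integral_of_forall_compl_eq_zero (s := U)
    fun x hx => by rw [hφ.eq_zero hx, zero_smul]]
  refine ext_inner_right ℝ fun w => ?_
  rw [inner_zero_left, real_inner_comm, ← integral_inner hint]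
  have i3 := integrable_mul (hG.inner_const (𝕜 := ℝ) w) hφL
  have i4 := integrable_mul (hG'.inner_const (𝕜 := ℝ) w) hφL
  have e : ∀ x, inner ℝ w (φ x • (G x - G' x)) =
      inner ℝ (G x) w * φ x - inner ℝ (G' x) w * φ x := by
    intro x
    rw [inner_smul_right, inner_sub_right, real_inner_comm w, real_inner_comm w]
    ring
  simp_rw [e]
  rw [integral_sub i3 i4]
  have e1 := h φ hφ w
  have e2 := h' φ hφ w
  linarith

theorem weakGrad_ae_eq (hU : IsOpen U) (h : IsWeakGrad U u G)
    (hG : MemLp G 2 (volume.restrict U)) : weakGrad U u =ᵐ[volume.restrict U] G := by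
  have hex : ∃ G : E d → E d, MemLp G 2 (volume.restrict U) ∧ IsWeakGrad U u G := ⟨G, hG, h⟩
  rw [weakGrad, dif_pos hex]
  exact hex.choose_spec.2.ae_eq hU h hex.choose_spec.1 hG

/-- The classical gradient is a weak gradient. -/
theorem isWeakGrad_gradient (hu : ContDiff ℝ 1 u) : IsWeakGrad U u (gradient u) := by
  intro φ hφ w
  rw [setIntegral_eq_integral_of_eq_zero fun x hx => by simp [hφ.fderiv_eq_zero hx],
    setIntegral_eq_integral_of_eq_zero fun x hx => by simp [hφ.eq_zero hx]]
  simp_rw [inner_gradient]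
  have c1 : Continuous fun x => fderiv ℝ u x w :=
    (hu.continuous_fderiv one_ne_zero).clm_apply continuous_const
  have c2 : Continuous fun x => fderiv ℝ φ x w := hφ.continuous_fderiv.clm_apply continuous_const
  have s2 : HasCompactSupport fun x => fderiv ℝ φ x w :=
    (hφ.2.1.fderiv ℝ).comp_left (g := fun L : E d →L[ℝ] ℝ => L w) rfl
  exact integral_mul_fderiv_eq_neg_fderiv_mul_of_integrable
    ((c1.mul hφ.continuous).integrable_of_hasCompactSupport hφ.2.1.mul_left)
    ((hu.continuous.mul c2).integrable_of_hasCompactSupport s2.mul_left)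
    ((hu.continuous.mul hφ.continuous).integrable_of_hasCompactSupport hφ.2.1.mul_left)
    (fun x _ => hu.differentiable one_ne_zero x) fun x _ => hφ.1.differentiable (by simp) x

theorem memLp_of_continuous {F : Type*} [NormedAddCommGroup F] {g : E d → F} (hg : Continuous g)
    (hU : Bornology.IsBounded U) : MemLp g 2 (volume.restrict U) := by
  obtain ⟨r, hr⟩ := hU.subset_closedBall 0
  have hc : IsCompact (Metric.closedBall (0 : E d) r) := isCompact_closedBall _ _
  obtain ⟨C, hC⟩ := hc.exists_bound_of_continuousOn hg.continuousOn
  have : MemLp g 2 (volume.restrict (Metric.closedBall (0 : E d) r)) := by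
    have : IsFiniteMeasure (volume.restrict (Metric.closedBall (0 : E d) r)) :=
      ⟨by simpa using hc.measure_lt_top⟩
    exact MemLp.of_bound hg.aestronglyMeasurable C
      ((ae_restrict_iff' hc.measurableSet).2 (Eventually.of_forall hC))
  exact this.mono_measure (Measure.restrict_mono hr le_rfl)

theorem continuous_gradient (hu : ContDiff ℝ 1 u) : Continuous (gradient u) :=
  (LinearIsometryEquiv.continuous _).comp (hu.continuous_fderiv one_ne_zero)

/-- `u` is the limit in `H¹(U)` of test functions, and `G` is its weak gradient. -/
structure IsH10 (U : Set (E d)) (u : E d → ℝ) (G : E d → E d) : Prop where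
  memLp : MemLp u 2 (volume.restrict U)
  memLp_grad : MemLp G 2 (volume.restrict U)
  exists_test : ∃ φ : ℕ → E d → ℝ, (∀ n, IsTest U (φ n)) ∧
    Tendsto (fun n => eLpNorm (fun x => u x - φ n x) 2 (volume.restrict U)) atTop (𝓝 0) ∧
    Tendsto (fun n => eLpNorm (fun x => G x - gradient (φ n) x) 2 (volume.restrict U))
      atTop (𝓝 0)

theorem memH10_iff : MemH10 U u ↔ ∃ G, IsH10 U u G :=
  ⟨fun ⟨h1, G, h2, h3⟩ => ⟨G, h1, h2, h3⟩, fun ⟨G, h1, h2, h3⟩ => ⟨h1, G, h2, h3⟩⟩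

namespace IsH10

theorem isWeakGrad (h : IsH10 U u G) : IsWeakGrad U u G := by
  obtain ⟨φ, h1, h2, h3⟩ := h.exists_test
  intro ψ hψ w
  have t1 := tendsto_integral_inner (hψ.memLp_fderiv w (volume.restrict U))
    (fun n => (h1 n).memLp (volume.restrict U)) h.memLp h2
  have hv : MemLp (fun x => ψ x • w) 2 (volume.restrict U) :=
    (hψ.continuous.smul continuous_const).memLp_of_hasCompactSupport hψ.2.1.smul_right
  have t2 := (tendsto_integral_inner hv (fun n => (h1 n).memLp_gradient (volume.restrict U))
    h.memLp_grad h3).neg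
  have e : ∀ n, ∫ x in U, inner ℝ (fderiv ℝ ψ x w) (φ n x) =
      -∫ x in U, inner ℝ (ψ x • w) (gradient (φ n) x) := by
    intro n
    have := isWeakGrad_gradient (U := U) ((h1 n).1.of_le (by simp)) ψ hψ w
    simpa [inner_smul_left, mul_comm, real_inner_comm] using this
  simp_rw [e] at t1
  have := tendsto_nhds_unique t1 t2
  simpa [inner_smul_left, mul_comm, real_inner_comm] using this

/-- Integration by parts against a field with a weak divergence. -/
theorem integral_inner_eq (h : IsH10 U u G) {v : E d → E d} {g : E d → ℝ}
    (hv : MemLp v 2 (volume.restrict U)) (hg : MemLp g 2 (volume.restrict U))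
    (hdiv : IsWeakDiv U v g) : ∫ x in U, inner ℝ (v x) (G x) = -∫ x in U, g x * u x := by
  obtain ⟨φ, h1, h2, h3⟩ := h.exists_test
  have t1 := tendsto_integral_inner hv (fun n => (h1 n).memLp_gradient (volume.restrict U))
    h.memLp_grad h3
  have t2 := (tendsto_integral_inner hg (fun n => (h1 n).memLp (volume.restrict U)) h.memLp h2).neg
  have e : ∀ n, ∫ x in U, inner ℝ (v x) (gradient (φ n) x) =
      -∫ x in U, inner ℝ (g x) (φ n x) := by
    intro n
    simpa [mul_comm] using hdiv (φ n) (h1 n)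
  simp_rw [e] at t1
  have := tendsto_nhds_unique t1 t2
  simpa [mul_comm] using this

theorem sub {u' : E d → ℝ} (h : IsH10 U u G) (h' : IsH10 U u' G') :
    IsH10 U (fun x => u x - u' x) fun x => G x - G' x := by
  obtain ⟨φ, h1, h2, h3⟩ := h.exists_test
  obtain ⟨ψ, k1, k2, k3⟩ := h'.exists_test
  have aux : ∀ {F : Type} [NormedAddCommGroup F] (a b : E d → F) (f g : ℕ → E d → F),
      (∀ n, AEStronglyMeasurable (fun x => a x - f n x) (volume.restrict U)) →
      (∀ n, AEStronglyMeasurable (fun x => b x - g n x) (volume.restrict U)) →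
      Tendsto (fun n => eLpNorm (fun x => a x - f n x) 2 (volume.restrict U)) atTop (𝓝 0) →
      Tendsto (fun n => eLpNorm (fun x => b x - g n x) 2 (volume.restrict U)) atTop (𝓝 0) →
      Tendsto (fun n => eLpNorm (fun x => a x - b x - (f n x - g n x)) 2 (volume.restrict U))
        atTop (𝓝 0) := by
    intro F _ a b f g m1 m2 ha hb
    have hs := ha.add hb
    rw [add_zero] at hs
    refine tendsto_of_tendsto_of_tendsto_of_le_of_le tendsto_const_nhds hs (fun _ => zero_le)
      fun n => ?_
    have : (fun x => a x - b x - (f n x - g n x)) =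
        (fun x => a x - f n x) - fun x => b x - g n x := by
      funext x; simp only [Pi.sub_apply]; abel
    change eLpNorm (fun x => a x - b x - (f n x - g n x)) 2 (volume.restrict U) ≤ _
    rw [this]
    exact eLpNorm_sub_le (m1 n) (m2 n) one_le_two
  refine ⟨h.memLp.sub h'.memLp, h.memLp_grad.sub h'.memLp_grad,
    fun n x => φ n x - ψ n x, fun n => (h1 n).sub (k1 n), ?_, ?_⟩
  · exact aux _ _ _ _ (fun n => (h.memLp.sub ((h1 n).memLp (volume.restrict U))).1)
      (fun n => (h'.memLp.sub ((k1 n).memLp (volume.restrict U))).1) h2 k2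
  · have hgr : ∀ n x, gradient (fun x => φ n x - ψ n x) x = gradient (φ n) x - gradient (ψ n) x := by
      intro n x
      have e1 := (h1 n).1.differentiable (by simp) x
      have e2 := (k1 n).1.differentiable (by simp) x
      rw [gradient, gradient, gradient, ← map_sub]
      congr 1
      exact fderiv_fun_sub e1 e2
    simp_rw [hgr]
    exact aux _ _ _ _ (fun n => (h.memLp_grad.sub ((h1 n).memLp_gradient (volume.restrict U))).1)
      (fun n => (h'.memLp_grad.sub ((k1 n).memLp_gradient (volume.restrict U))).1) h3 k3

theorem congr {u' : E d → ℝ} (h : IsH10 U u G) (hu : u =ᵐ[volume.restrict U] u')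
    (hG : G =ᵐ[volume.restrict U] G') : IsH10 U u' G' := by
  obtain ⟨φ, h1, h2, h3⟩ := h.exists_test
  refine ⟨h.memLp.ae_eq hu, h.memLp_grad.ae_eq hG, φ, h1, h2.congr fun n => ?_,
    h3.congr fun n => ?_⟩
  · refine eLpNorm_congr_ae ?_
    filter_upwards [hu] with x hx
    rw [hx]
  · refine eLpNorm_congr_ae ?_
    filter_upwards [hG] with x hx
    rw [hx]

end IsH10

/-- On an open set where a field with a weak divergence is smooth, the divergence is the classical
one. -/
theorem IsWeakDiv.ae_eq_divergence {v v' : E d → E d} {g : E d → ℝ} (hdiv : IsWeakDiv U v' g)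
    (hg : MemLp g 2 (volume.restrict U)) (hV : IsOpen V) (hVU : V ⊆ U) (hv : ContDiff ℝ 1 v)
    (hvv : ∀ x ∈ V, v' x = v x) : g =ᵐ[volume.restrict V] divergence v := by
  have hc : Continuous (divergence v) := by
    unfold divergence
    exact continuous_finsetSum _ fun i _ =>
      ((contDiff_component hv i).continuous_fderiv one_ne_zero).clm_apply continuous_const
  have hgV : MemLp g 2 (volume.restrict V) := hg.mono_measure (Measure.restrict_mono hVU le_rfl)
  have hloc : LocallyIntegrableOn (fun x => g x - divergence v x) V :=
    (locallyIntegrableOn_of_locallyIntegrable_restrict (hgV.locallyIntegrable one_le_two)).sub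
      (hc.locallyIntegrable.locallyIntegrableOn V)
  have key := hV.ae_eq_zero_of_integral_contDiff_smul_eq_zero (μ := volume) hloc ?_
  · rw [EventuallyEq, ae_restrict_iff' hV.measurableSet]
    filter_upwards [key] with x hx hxV
    exact sub_eq_zero.1 (hx hxV)
  intro φ h1 h2 h3
  have hφ : IsTest V φ := ⟨h1, h2, h3⟩
  have hφL := hφ.memLp (volume.restrict V)
  have e1 := hdiv φ (hφ.mono hVU)
  rw [setIntegral_eq_integral_of_eq_zero fun x hx => by
      rw [(hφ.mono hVU).gradient_eq_zero hx, inner_zero_right],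
    setIntegral_eq_integral_of_eq_zero fun x hx => by rw [(hφ.mono hVU).eq_zero hx, mul_zero],
    ← setIntegral_eq_integral_of_eq_zero (U := V) fun x hx => by
      rw [hφ.gradient_eq_zero hx, inner_zero_right],
    ← setIntegral_eq_integral_of_eq_zero (U := V) fun x hx => by rw [hφ.eq_zero hx, mul_zero],
    setIntegral_congr_fun hV.measurableSet fun x hx => by
      show inner ℝ (v' x) (gradient φ x) = inner ℝ (v x) (gradient φ x)
      rw [hvv x hx]] at e1
  have e2 : ∫ x in V, inner ℝ (v x) (gradient φ x) = -∫ x in V, divergence v x * φ x := by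
    have hφg : ∀ i : Fin d, Continuous fun x => fderiv ℝ φ x (EuclideanSpace.single i 1) := fun i =>
      hφ.continuous_fderiv.clm_apply continuous_const
    have hs : ∀ i : Fin d, HasCompactSupport fun x => fderiv ℝ φ x (EuclideanSpace.single i 1) :=
      fun i => (hφ.2.1.fderiv ℝ).comp_left
        (g := fun L : E d →L[ℝ] ℝ => L (EuclideanSpace.single i 1)) rfl
    have hgi : ∀ (x : E d) (i : Fin d), gradient φ x i = fderiv ℝ φ x (EuclideanSpace.single i 1) := by
      intro x i
      rw [← inner_gradient, EuclideanSpace.inner_single_right]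
      simp
    have hci : ∀ i : Fin d, Continuous fun x => v x i := fun i =>
      (contDiff_component hv i).continuous
    have hcd : ∀ i : Fin d, Continuous fun x =>
        fderiv ℝ (fun y => v y i) x (EuclideanSpace.single i 1) := fun i =>
      ((contDiff_component hv i).continuous_fderiv one_ne_zero).clm_apply continuous_const
    simp_rw [PiLp.inner_apply, divergence, Finset.sum_mul, hgi]
    rw [integral_finsetSum, integral_finsetSum, ← Finset.sum_neg_distrib]
    · refine Finset.sum_congr rfl fun i _ => ?_
      have := isWeakGrad_gradient (U := V) (contDiff_component hv i) φ hφ (EuclideanSpace.single i 1)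
      simp_rw [inner_gradient] at this
      simpa [mul_comm] using this
    · intro i _
      exact (((hcd i).mul hφ.continuous).integrable_of_hasCompactSupport (μ := volume)
        hφ.2.1.mul_left).integrableOn
    · intro i _
      have := (((hci i).mul (hφg i)).integrable_of_hasCompactSupport (μ := volume)
        (hs i).mul_left).integrableOn (s := V)
      exact this.congr (ae_of_all _ fun x => by simp [mul_comm])
  rw [← setIntegral_eq_integral_of_forall_compl_eq_zero (s := V)
    fun x hx => by rw [hφ.eq_zero hx, zero_smul]]
  have i1 := integrable_mul hgV hφL
  have i2 : IntegrableOn (fun x => divergence v x * φ x) V :=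
    ((hc.mul hφ.continuous).integrable_of_hasCompactSupport (μ := volume) hφ.2.1.mul_left).integrableOn
  have e3 : ∀ x, φ x • (g x - divergence v x) = g x * φ x - divergence v x * φ x := by
    intro x; rw [smul_eq_mul]; ring
  simp_rw [e3]
  rw [integral_sub i1 i2, sub_eq_zero]
  linarith

end Sobolev

/-! ### Lipschitz functions that vanish outside a bounded open set -/

/-- A function whose local Lipschitz constants are bounded by `L` is `L`-Lipschitz. -/
theorem abs_sub_le_of_eventually {H : Type*} [NormedAddCommGroup H] [NormedSpace ℝ H] {S : H → ℝ}
    {L : ℝ} (h : ∀ x, ∀ᶠ y in 𝓝 x, |S y - S x| ≤ L * ‖y - x‖) (x y : H) :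
    |S y - S x| ≤ L * ‖y - x‖ := by
  have hcont : Continuous S := by
    rw [continuous_iff_continuousAt]
    intro x
    have h0 : Tendsto (fun y => L * ‖y - x‖) (𝓝 x) (𝓝 0) := by
      have : Continuous fun y => L * ‖y - x‖ := by fun_prop
      simpa using this.tendsto x
    rw [ContinuousAt, tendsto_iff_norm_sub_tendsto_zero]
    exact squeeze_zero' (Eventually.of_forall fun y => norm_nonneg _) (h x) h0
  have key : ∀ x y, S y - S x ≤ L * ‖y - x‖ := by
    intro x y
    set c : ℝ → H := fun s => x + s • (y - x) with hc
    have hcc : Continuous c := by fun_prop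
    refine le_of_forall_pos_le_add fun ε hε => ?_
    have := image_le_of_liminf_slope_right_lt_deriv_boundary (f := fun s => S (c s) - S x)
      (f' := fun _ => L * ‖y - x‖) (a := 0) (b := 1)
      ((hcont.comp hcc).sub continuous_const).continuousOn ?_
      (B := fun s => (L * ‖y - x‖ + ε) * s) (B' := fun _ => L * ‖y - x‖ + ε)
      (by simp [hc]) (fun s => by simpa using (hasDerivAt_id s).const_mul (L * ‖y - x‖ + ε))
      (fun s _ _ => by linarith) (x := 1) (by simp)
    · simpa [hc] using this
    · intro s _ r hr
      refine Eventually.frequently ?_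
      have h1 : ∀ᶠ z in 𝓝[>] s, |S (c z) - S (c s)| ≤ L * ‖c z - c s‖ :=
        ((hcc.tendsto s).mono_left nhdsWithin_le_nhds).eventually (h (c s))
      filter_upwards [h1, self_mem_nhdsWithin] with z hz hzs
      have hzs : s < z := hzs
      have h2 : c z - c s = (z - s) • (y - x) := by simp only [hc]; module
      rw [h2, norm_smul, Real.norm_of_nonneg (sub_nonneg.2 hzs.le)] at hz
      refine lt_of_le_of_lt ?_ hr
      rw [slope_def_field, div_le_iff₀ (sub_pos.2 hzs)]
      have := (le_abs_self _).trans hz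
      linarith
  rw [abs_le]
  have h1 := key x y
  have h2 := key y x
  rw [norm_sub_rev] at h2
  constructor <;> linarith

section

variable {d : ℕ} {U : Set (E d)}

/-- Dominated convergence in `L²` of a finite measure. -/
theorem tendsto_eLpNorm_of_bounded {F : Type*} [NormedAddCommGroup F] {μ : Measure (E d)}
    [IsFiniteMeasure μ] {f : ℕ → E d → F} {g : E d → F} {C : ℝ} (hf : ∀ n x, ‖f n x‖ ≤ C)
    (hg : ∀ x, ‖g x‖ ≤ C) (hfm : ∀ n, AEStronglyMeasurable (f n) μ)
    (hgm : AEStronglyMeasurable g μ) (h : ∀ᵐ x ∂μ, Tendsto (fun n => f n x) atTop (𝓝 (g x))) :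
    Tendsto (fun n => eLpNorm (fun x => g x - f n x) 2 μ) atTop (𝓝 0) := by
  have h2 : Tendsto (fun n => ∫⁻ x, ‖g x - f n x‖ₑ ^ (2 : ℝ) ∂μ) atTop (𝓝 (∫⁻ _, 0 ∂μ)) := by
    refine tendsto_lintegral_of_dominated_convergence' (fun _ => ENNReal.ofReal (C + C) ^ (2 : ℝ))
      (fun n => (hgm.sub (hfm n)).enorm.pow_const _) (fun n => ae_of_all _ fun x => ?_) ?_ ?_
    · refine ENNReal.rpow_le_rpow ?_ (by norm_num)
      rw [← ofReal_norm]
      exact ENNReal.ofReal_le_ofReal ((norm_sub_le _ _).trans (add_le_add (hg x) (hf n x)))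
    · rw [lintegral_const]
      exact ENNReal.mul_ne_top (ENNReal.rpow_ne_top_of_nonneg (by norm_num) ENNReal.ofReal_ne_top)
        (measure_ne_top _ _)
    · filter_upwards [h] with x hx
      have : Tendsto (fun n => ‖g x - f n x‖ₑ) atTop (𝓝 0) := by
        have := ((tendsto_const_nhds (x := g x)).sub hx).enorm
        simpa using this
      have h3 := (ENNReal.continuous_rpow_const (y := (2 : ℝ))).tendsto 0 |>.comp this
      simpa [Function.comp_def] using h3
  rw [lintegral_zero] at h2
  have h4 := (ENNReal.continuous_rpow_const (y := (1 / 2 : ℝ))).tendsto 0 |>.comp h2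
  simp only [one_div, ENNReal.zero_rpow_of_pos (show (0 : ℝ) < 2⁻¹ by norm_num)] at h4
  refine h4.congr fun n => ?_
  rw [eLpNorm_eq_lintegral_rpow_enorm_toReal (by norm_num) (by norm_num)]
  simp

theorem norm_gradient_le {h : E d → ℝ} {L : NNReal} (hL : LipschitzWith L h) (x : E d) :
    ‖gradient h x‖ ≤ L := by
  rw [gradient, LinearIsometryEquiv.norm_map]
  exact norm_fderiv_le_of_lipschitz ℝ hL

theorem measurable_gradient (h : E d → ℝ) : Measurable (gradient h) :=
  (LinearIsometryEquiv.continuous _).measurable.comp (measurable_fderiv ℝ h)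

open scoped Convolution

theorem norm_convolution_le {F : Type*} [NormedAddCommGroup F] [NormedSpace ℝ F]
    (b : ContDiffBump (0 : E d)) {g : E d → F} {C : ℝ} (hg : ∀ x, ‖g x‖ ≤ C) (x : E d) :
    ‖(b.normed volume ⋆[ContinuousLinearMap.lsmul ℝ ℝ, volume] g) x‖ ≤ C := by
  have h1 : Integrable (fun t => b.normed volume t * C) :=
    (b.integrable_normed (μ := volume)).mul_const C
  have h2 : ∫ t, b.normed volume t * C = C := by
    rw [integral_mul_const, b.integral_normed, one_mul]
  rw [convolution_def]
  refine (norm_integral_le_of_norm_le h1 (ae_of_all _ fun t => ?_)).trans h2.le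
  rw [ContinuousLinearMap.lsmul_apply, norm_smul, Real.norm_of_nonneg (b.nonneg_normed t)]
  exact mul_le_mul_of_nonneg_left (hg _) (b.nonneg_normed t)

/-- The derivative of a mollified Lipschitz function is the mollified derivative. -/
theorem fderiv_convolution_of_lipschitz (b : ContDiffBump (0 : E d)) {h : E d → ℝ} {L : NNReal}
    (hL : LipschitzWith L h) (x : E d) :
    fderiv ℝ (b.normed volume ⋆[ContinuousLinearMap.lsmul ℝ ℝ, volume] h) x =
      (b.normed volume ⋆[ContinuousLinearMap.lsmul ℝ ℝ, volume] fderiv ℝ h) x := by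
  have hbc : Continuous (b.normed volume) := b.continuous_normed
  have hbs : HasCompactSupport (b.normed volume) := b.hasCompactSupport_normed
  have hF : ∀ x, Continuous fun t => b.normed volume t • h (x - t) := fun x =>
    hbc.smul (hL.continuous.comp (by fun_prop))
  have key := hasFDerivAt_integral_of_dominated_loc_of_lip (𝕜 := ℝ) (μ := volume) (x₀ := x)
    (F := fun x t => b.normed volume t • h (x - t))
    (F' := fun t => b.normed volume t • fderiv ℝ h (x - t))
    (bound := fun t => b.normed volume t * L) (s := Set.univ) univ_mem
    (Eventually.of_forall fun x => (hF x).aestronglyMeasurable)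
    ((hF x).integrable_of_hasCompactSupport hbs.smul_right) ?_ ?_
    ((b.integrable_normed (μ := volume)).mul_const _) ?_
  · exact key.2.fderiv
  · have : Measurable fun t => fderiv ℝ h (x - t) :=
      (measurable_fderiv ℝ h).comp (by fun_prop)
    exact (hbc.measurable.smul this).aestronglyMeasurable
  · refine ae_of_all _ fun t => LipschitzOnWith.of_dist_le_mul fun y _ z _ => ?_
    rw [Real.coe_nnabs, abs_of_nonneg (mul_nonneg (b.nonneg_normed t) L.coe_nonneg), dist_eq_norm,
      ← smul_sub, norm_smul, Real.norm_of_nonneg (b.nonneg_normed t), mul_assoc]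
    refine mul_le_mul_of_nonneg_left ?_ (b.nonneg_normed t)
    have := hL.dist_le_mul (y - t) (z - t)
    rwa [dist_sub_right, dist_eq_norm (h _)] at this
  · have hq : Measure.QuasiMeasurePreserving (fun t : E d => x - t) volume volume :=
      (Measure.measurePreserving_sub_left volume x).quasiMeasurePreserving
    filter_upwards [hq.ae hL.ae_differentiableAt] with t ht
    have h1 : HasFDerivAt (fun y => h (y - t)) (fderiv ℝ h (x - t)) x := by
      have := ht.hasFDerivAt
      exact (hasFDerivAt_comp_sub t).2 this
    exact h1.const_smul (b.normed volume t)

/-- A Lipschitz function is approximated in `H¹` by its mollifications. -/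
theorem exists_test_of_lipschitz (hU : IsOpen U) (hb : Bornology.IsBounded U) {h : E d → ℝ}
    {L : NNReal} (hL : LipschitzWith L h) {K : Set (E d)} (hK : IsCompact K) (hKU : K ⊆ U)
    (hhK : ∀ x, x ∉ K → h x = 0) {δ : ENNReal} (hδ : 0 < δ) :
    ∃ φ, IsTest U φ ∧ eLpNorm (fun x => h x - φ x) 2 (volume.restrict U) < δ ∧
      eLpNorm (fun x => gradient h x - gradient φ x) 2 (volume.restrict U) < δ := by
  have : IsFiniteMeasure (volume.restrict U) := ⟨by simpa using hb.measure_lt_top⟩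
  obtain ⟨r, hr, hrU⟩ := hK.exists_cthickening_subset_open hU hKU
  let b : ℕ → ContDiffBump (0 : E d) := fun n =>
    ⟨1 / (n + 1) / 2, 1 / (n + 1), by positivity, half_lt_self (by positivity)⟩
  let φ : ℕ → E d → ℝ := fun n =>
    (b n).normed volume ⋆[ContinuousLinearMap.lsmul ℝ ℝ, volume] h
  have hrout : Tendsto (fun n => (b n).rOut) atTop (𝓝 0) := tendsto_one_div_add_atTop_nhds_zero_nat
  have hratio : ∀ᶠ n in atTop, (b n).rOut ≤ 2 * (b n).rIn :=
    Eventually.of_forall fun n => le_of_eq (by simp only [b]; ring)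
  have hhc : HasCompactSupport h := HasCompactSupport.intro hK hhK
  obtain ⟨C, hC⟩ := hhc.exists_bound_of_continuous hL.continuous
  have hC0 : 0 ≤ C := (norm_nonneg _).trans (hC 0)
  have hsm : ∀ n, ContDiff ℝ ∞ (φ n) := fun n =>
    (b n).hasCompactSupport_normed.contDiff_convolution_left _ (b n).contDiff_normed
      hL.continuous.locallyIntegrable
  have hsupp : ∀ᶠ n in atTop, IsTest U (φ n) := by
    filter_upwards [(tendsto_order.1 hrout).2 r hr] with n hn
    have hsub : tsupport (φ n) ⊆ Metric.cthickening r K := by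
      refine closure_minimal ?_ Metric.isClosed_cthickening
      refine (support_convolution_subset _).trans ?_
      rintro x ⟨y, hy, z, hz, rfl⟩
      have hzK : z ∈ K := by
        by_contra hz'
        exact hz (hhK z hz')
      rw [(b n).support_normed_eq, mem_ball_zero_iff] at hy
      refine Metric.mem_cthickening_of_dist_le _ z r K hzK ?_
      simp only [dist_eq_norm, add_sub_cancel_right]
      exact (hy.trans hn).le
    refine ⟨hsm n, ?_, hsub.trans hrU⟩
    exact (hK.cthickening (r := r)).of_isClosed_subset (isClosed_tsupport _) hsub
  have t1 : Tendsto (fun n => eLpNorm (fun x => h x - φ n x) 2 (volume.restrict U)) atTop (𝓝 0) :=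
    tendsto_eLpNorm_of_bounded (fun n x => norm_convolution_le (b n) hC x) hC
      (fun n => (hsm n).continuous.aestronglyMeasurable) hL.continuous.aestronglyMeasurable
      (ae_of_all _ fun x => ContDiffBump.convolution_tendsto_right_of_continuous hrout
        hL.continuous x)
  have hfd : ∀ x, ‖fderiv ℝ h x‖ ≤ L := fun x => norm_fderiv_le_of_lipschitz ℝ hL
  have hfi : LocallyIntegrable (fderiv ℝ h) (volume : Measure (E d)) := by
    have hc : LocallyIntegrable (fun _ : E d => (L : ℝ)) volume := locallyIntegrable_const _
    exact hc.mono (measurable_fderiv ℝ h).aestronglyMeasurable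
      (ae_of_all _ fun x => (hfd x).trans (le_abs_self _))
  have t2 : Tendsto (fun n => eLpNorm (fun x => gradient h x - gradient (φ n) x) 2
      (volume.restrict U)) atTop (𝓝 0) := by
    refine tendsto_eLpNorm_of_bounded (C := L) (fun n x => ?_) (norm_gradient_le hL)
      (fun n => (measurable_gradient _).aestronglyMeasurable)
      (measurable_gradient _).aestronglyMeasurable (ae_restrict_of_ae ?_)
    · rw [gradient, LinearIsometryEquiv.norm_map, fderiv_convolution_of_lipschitz (b n) hL]
      exact norm_convolution_le (b n) hfd x
    · filter_upwards [ContDiffBump.ae_convolution_tendsto_right_of_locallyIntegrable hrout hratio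
        hfi] with x hx
      simp only [gradient, φ, fun n => fderiv_convolution_of_lipschitz (b n) hL x]
      exact ((LinearIsometryEquiv.continuous _).tendsto _).comp hx
  obtain ⟨n, ⟨h1, h2⟩, h3⟩ := ((hsupp.and ((tendsto_order.1 t1).2 δ hδ)).and
    ((tendsto_order.1 t2).2 δ hδ)).exists
  exact ⟨φ n, h1, h2, h3⟩

/-- The derivative of a function vanishes almost everywhere on its zero set. -/
theorem ae_fderiv_eq_zero (hd : 0 < d) {S : E d → ℝ} (hS : Measurable S)
    (hdiff : ∀ᵐ x, DifferentiableAt ℝ S x) : ∀ᵐ x, S x = 0 → fderiv ℝ S x = 0 := by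
  -- On its zero set, `S • w` is approximated by the zero map with the constant `0`, so that its
  -- derivative is zero at almost all points of this set. The factor `w ≠ 0` makes `S` a map from
  -- `E d` to itself.
  set w : E d := EuclideanSpace.single ⟨0, hd⟩ 1 with hw
  have hw1 : ‖w‖ = 1 := by simp [hw]
  set Z : Set (E d) := {x | S x = 0} ∩ {x | DifferentiableAt ℝ S x} with hZ
  have hZm : MeasurableSet Z :=
    (hS (measurableSet_singleton 0)).inter (measurableSet_of_differentiableAt ℝ S)
  have happ : ApproximatesLinearOn (fun x => S x • w) (0 : E d →L[ℝ] E d) Z 0 := by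
    intro x hx y hy
    have hx' : S x = 0 := hx.1
    have hy' : S y = 0 := hy.1
    simp [hx', hy']
  have key := happ.norm_fderiv_sub_le volume hZm (fun x => (fderiv ℝ S x).smulRight w)
    fun x hx => (DifferentiableAt.hasFDerivAt hx.2).hasFDerivWithinAt.smul_const w
  rw [ae_restrict_iff' hZm] at key
  filter_upwards [key, hdiff] with x h1 h2 h3
  have h4 := h1 ⟨h3, h2⟩
  rw [sub_zero, nonpos_iff_eq_zero, nnnorm_eq_zero] at h4
  ext v
  have h5 := congrArg (fun A : E d →L[ℝ] E d => A v) h4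
  simp only [ContinuousLinearMap.smulRight_apply, zero_apply, smul_eq_zero] at h5
  rcases h5 with h5 | h5
  · simpa using h5
  · rw [h5] at hw1; simp at hw1

/-- Soft thresholding: `s` is moved towards `0` by `ε`, and becomes `0` if `|s| ≤ ε`. -/
def soft (ε s : ℝ) : ℝ := max (s - ε) 0 + min (s + ε) 0

theorem abs_soft_sub_le {ε : ℝ} (hε : 0 < ε) (s r : ℝ) : |soft ε s - soft ε r| ≤ |s - r| := by
  unfold soft
  rcases max_cases (s - ε) 0 with ⟨h1, _⟩ | ⟨h1, _⟩ <;>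
  rcases max_cases (r - ε) 0 with ⟨h2, _⟩ | ⟨h2, _⟩ <;>
  rcases min_cases (s + ε) 0 with ⟨h3, _⟩ | ⟨h3, _⟩ <;>
  rcases min_cases (r + ε) 0 with ⟨h4, _⟩ | ⟨h4, _⟩ <;>
  rw [h1, h2, h3, h4] <;>
  rcases abs_cases (s - r) with ⟨h5, _⟩ | ⟨h5, _⟩ <;>
  rw [h5, abs_le] <;> constructor <;> linarith

theorem soft_of_abs_le {ε s : ℝ} (h : |s| ≤ ε) : soft ε s = 0 := by
  rw [abs_le] at h
  rw [soft, max_eq_right (by linarith), min_eq_right (by linarith), add_zero]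

theorem soft_of_le {ε s : ℝ} (hε : 0 < ε) (h : ε ≤ s) : soft ε s = s - ε := by
  rw [soft, max_eq_left (by linarith), min_eq_right (by linarith), add_zero]

theorem soft_of_le_neg {ε s : ℝ} (hε : 0 < ε) (h : s ≤ -ε) : soft ε s = s + ε := by
  rw [soft, max_eq_right (by linarith), min_eq_left (by linarith), zero_add]

/-- If `S x ≠ 0`, soft thresholding below `|S x|` changes `S` near `x` only by a constant. -/
theorem gradient_soft_of_lt {S : E d → ℝ} (hS : Continuous S) {ε : ℝ} (hε : 0 < ε) {x : E d}
    (h : ε < |S x|) : gradient (fun y => soft ε (S y)) x = gradient S x := by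
  rw [gradient, gradient]
  congr 1
  rcases lt_abs.1 h with h | h
  · have : (fun y => soft ε (S y)) =ᶠ[𝓝 x] fun y => S y - ε := by
      filter_upwards [hS.continuousAt.eventually (lt_mem_nhds h)] with y hy
      exact soft_of_le hε hy.le
    rw [this.fderiv_eq, fderiv_sub_const]
  · have : (fun y => soft ε (S y)) =ᶠ[𝓝 x] fun y => S y + ε := by
      filter_upwards [hS.continuousAt.eventually (gt_mem_nhds (show S x < -ε by linarith))] with y hy
      exact soft_of_le_neg hε hy.le
    rw [this.fderiv_eq, fderiv_add_const]

theorem gradient_soft_of_eq_zero {S : E d → ℝ} (hS : Continuous S) {ε : ℝ} (hε : 0 < ε) {x : E d}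
    (h : S x = 0) : gradient (fun y => soft ε (S y)) x = 0 := by
  have hlt : |S x| < ε := by rw [h, abs_zero]; exact hε
  have : (fun y => soft ε (S y)) =ᶠ[𝓝 x] fun _ => 0 := by
    filter_upwards [hS.abs.continuousAt.eventually (gt_mem_nhds hlt)] with y hy
    exact soft_of_abs_le hy.le
  rw [gradient, this.fderiv_eq, fderiv_fun_const, Pi.zero_apply, map_zero]

/-- A Lipschitz function `S` that vanishes outside a bounded open set belongs to `H¹₀`. Soft
thresholding gives it a compact support, and the gradients converge almost everywhere, as `∇S = 0`
almost everywhere on the zero set. -/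
theorem isH10_of_lipschitz (hd : 0 < d) (hU : IsOpen U) (hb : Bornology.IsBounded U) {S : E d → ℝ}
    {L : NNReal} (hL : LipschitzWith L S) (hS : ∀ x, x ∉ U → S x = 0) :
    IsH10 U S (gradient S) := by
  have : IsFiniteMeasure (volume.restrict U) := ⟨by simpa using hb.measure_lt_top⟩
  set ε : ℕ → ℝ := fun n => 1 / (n + 1) with hε
  have hε0 : ∀ n, 0 < ε n := fun n => by positivity
  have hεt : Tendsto ε atTop (𝓝 0) := tendsto_one_div_add_atTop_nhds_zero_nat
  have hlip : ∀ n, LipschitzWith L fun x => soft (ε n) (S x) := fun n =>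
    LipschitzWith.of_dist_le_mul fun x y =>
      (abs_soft_sub_le (hε0 n) (S x) (S y)).trans (hL.dist_le_mul x y)
  have hK : ∀ n, IsCompact {x | ε n ≤ |S x|} ∧ {x | ε n ≤ |S x|} ⊆ U := by
    intro n
    have hsub : {x | ε n ≤ |S x|} ⊆ U := fun x hx => by
      by_contra hxU
      have hx : ε n ≤ |S x| := hx
      rw [hS x hxU, abs_zero] at hx
      exact absurd (hε0 n) (not_lt.2 hx)
    exact ⟨Metric.isCompact_of_isClosed_isBounded
      (isClosed_le continuous_const hL.continuous.abs) (hb.subset hsub), hsub⟩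
  choose φ hφ1 hφ2 hφ3 using fun n => exists_test_of_lipschitz hU hb (hlip n) (hK n).1 (hK n).2
    (fun x hx => soft_of_abs_le (not_le.1 hx).le)
    (δ := ENNReal.ofReal (ε n)) (ENNReal.ofReal_pos.2 (hε0 n))
  have hS2 : MemLp S 2 (volume.restrict U) := memLp_of_continuous hL.continuous hb
  have hG2 : MemLp (gradient S) 2 (volume.restrict U) :=
    MemLp.of_bound (measurable_gradient S).aestronglyMeasurable L
      (ae_of_all _ (norm_gradient_le hL))
  have hεE : Tendsto (fun n => ENNReal.ofReal (ε n)) atTop (𝓝 0) := by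
    simpa using ENNReal.tendsto_ofReal hεt
  -- the triangle inequality for `S`, its thresholded version and the test function
  have hcomb : ∀ {F : Type} [NormedAddCommGroup F] (a : E d → F) (b c : ℕ → E d → F),
      (∀ n, AEStronglyMeasurable (fun x => a x - b n x) (volume.restrict U)) →
      (∀ n, AEStronglyMeasurable (fun x => b n x - c n x) (volume.restrict U)) →
      Tendsto (fun n => eLpNorm (fun x => a x - b n x) 2 (volume.restrict U)) atTop (𝓝 0) →
      (∀ n, eLpNorm (fun x => b n x - c n x) 2 (volume.restrict U) < ENNReal.ofReal (ε n)) →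
      Tendsto (fun n => eLpNorm (fun x => a x - c n x) 2 (volume.restrict U)) atTop (𝓝 0) := by
    intro F _ a b c m1 m2 h1 h2
    have hs := h1.add hεE
    rw [add_zero] at hs
    refine tendsto_of_tendsto_of_tendsto_of_le_of_le tendsto_const_nhds hs (fun _ => zero_le)
      fun n => ?_
    have : (fun x => a x - c n x) = (fun x => a x - b n x) + fun x => b n x - c n x := by
      funext x; simp
    change eLpNorm (fun x => a x - c n x) 2 (volume.restrict U) ≤ _
    rw [this]
    exact (eLpNorm_add_le (m1 n) (m2 n) one_le_two).trans (add_le_add le_rfl (h2 n).le)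
  obtain ⟨C, hC⟩ : ∃ C, ∀ x, |S x| ≤ C := by
    obtain ⟨C, hC⟩ := (HasCompactSupport.intro hb.isCompact_closure
      fun x hx => hS x fun h => hx (subset_closure h)).exists_bound_of_continuous hL.continuous
    exact ⟨C, hC⟩
  refine ⟨hS2, hG2, φ, hφ1, ?_, ?_⟩
  · refine hcomb S (fun n x => soft (ε n) (S x)) φ
      (fun n => (hL.continuous.sub (hlip n).continuous).aestronglyMeasurable)
      (fun n => ((hlip n).continuous.sub (hφ1 n).continuous).aestronglyMeasurable) ?_ hφ2
    refine tendsto_eLpNorm_of_bounded (C := C) (fun n x => ?_) hC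
      (fun n => (hlip n).continuous.aestronglyMeasurable) hL.continuous.aestronglyMeasurable
      (ae_of_all _ fun x => ?_)
    · have h0 : soft (ε n) 0 = 0 := soft_of_abs_le (by rw [abs_zero]; exact (hε0 n).le)
      have := abs_soft_sub_le (hε0 n) (S x) 0
      rw [h0, sub_zero, sub_zero] at this
      exact this.trans (hC x)
    · have : Tendsto (fun n => max (S x - ε n) 0 + min (S x + ε n) 0) atTop
          (𝓝 (max (S x - 0) 0 + min (S x + 0) 0)) :=
        ((tendsto_const_nhds.sub hεt).max tendsto_const_nhds).add
          ((tendsto_const_nhds.add hεt).min tendsto_const_nhds)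
      simpa [soft, max_add_min] using this
  · refine hcomb (gradient S) (fun n => gradient fun x => soft (ε n) (S x))
      (fun n => gradient (φ n))
      (fun n => ((measurable_gradient _).sub (measurable_gradient _)).aestronglyMeasurable)
      (fun n => ((measurable_gradient _).sub (measurable_gradient _)).aestronglyMeasurable) ?_ hφ3
    refine tendsto_eLpNorm_of_bounded (C := L) (fun n x => norm_gradient_le (hlip n) x)
      (norm_gradient_le hL) (fun n => (measurable_gradient _).aestronglyMeasurable)
      (measurable_gradient _).aestronglyMeasurable (ae_restrict_of_ae ?_)
    filter_upwards [ae_fderiv_eq_zero hd hL.continuous.measurable hL.ae_differentiableAt] with x hx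
    by_cases h0 : S x = 0
    · have : gradient S x = 0 := by rw [gradient, hx h0, map_zero]
      rw [this]
      simp_rw [gradient_soft_of_eq_zero hL.continuous (hε0 _) h0]
      exact tendsto_const_nhds
    · refine tendsto_const_nhds.congr' ?_
      filter_upwards [(tendsto_order.1 hεt).2 _ (abs_pos.2 h0)] with n hn
      exact (gradient_soft_of_lt hL.continuous (hε0 n) hn).symm

end

/-! ### Smoothness of piecewise polynomials -/

theorem contDiff_polyFun {d : ℕ} (P : MvPolynomial (Fin d) ℝ) : ContDiff ℝ ∞ (polyFun d P) := by
  change ContDiff ℝ ∞ fun x : E d => MvPolynomial.eval (fun i => x i) P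
  induction P using MvPolynomial.induction_on with
  | C a => simpa using contDiff_const
  | add p q hp hq => simpa using hp.add hq
  | mul_X p i hp => simpa using hp.mul (by fun_prop)

theorem contDiff_of_mem_polySpace {d k : ℕ} {q : E d → ℝ} (hq : q ∈ polySpace d k) :
    ContDiff ℝ ∞ q := by
  obtain ⟨P, -, rfl⟩ := hq
  exact contDiff_polyFun P

theorem const_mem_polySpace (d k : ℕ) (c : ℝ) : (fun _ => c) ∈ polySpace d k := by
  refine ⟨MvPolynomial.C c, ?_, ?_⟩
  · rw [SetLike.mem_coe, MvPolynomial.mem_restrictTotalDegree, MvPolynomial.totalDegree_C]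
    exact Nat.zero_le _
  · funext x
    simp [polyFun]

theorem contDiff_of_mem_rtnSpace {d l : ℕ} {u : E d → E d} (hu : u ∈ rtnSpace d l) :
    ContDiff ℝ ∞ u := by
  obtain ⟨w, r, hr, hw, h⟩ := hu
  have h1 : u = fun x => w x + r x • x := funext h
  rw [h1]
  exact ((contDiff_euclidean.2 fun i => contDiff_of_mem_polySpace (hw i))).add
    ((contDiff_of_mem_polySpace hr).smul contDiff_id)

/-! ### The Oswald interpolant belongs to `H¹₀` -/

namespace NestedMesh

variable {d : ℕ} {ι J : Type*} (M : NestedMesh d ι J)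

theorem contDiff_lagrangeBasis (k : ℕ) (t : ι) (m : E d → ℕ) :
    ContDiff ℝ ∞ (lagrangeBasis M k t m) := by
  unfold lagrangeBasis
  refine contDiff_prod fun a _ => contDiff_prod fun j _ => ?_
  exact ((contDiff_const.mul (M.contDiff_bary t a)).sub contDiff_const).div_const _

variable {M}

theorem sum_div_eq_one [DecidableEq (E d)] {k : ℕ} (hk : 1 ≤ k) {t : ι} {m : E d → ℕ}
    (hm : m ∈ (M.vert t).piAntidiag k) : ∑ a ∈ M.vert t, (m a : ℝ) / k = 1 := by
  rw [Finset.mem_piAntidiag] at hm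
  rw [← Finset.sum_div, ← Nat.cast_sum, hm.1]
  exact div_self (by positivity)

theorem bary_lagrangeNode [DecidableEq (E d)] {k : ℕ} (hk : 1 ≤ k) {t : ι} {m : E d → ℕ}
    (hm : m ∈ (M.vert t).piAntidiag k) (a : E d) :
    M.bary t a (lagrangeNode M k t m) = (m a : ℝ) / k := by
  rw [lagrangeNode, M.bary_combination subset_rfl (fun a => (m a : ℝ) / k) (sum_div_eq_one hk hm)]
  split_ifs with h
  · rfl
  · have : m a = 0 := by
      by_contra hne
      exact h ((Finset.mem_piAntidiag.1 hm).2 a hne)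
    simp [this]

/-- A basis function vanishes where one of the coordinates of its node is positive and the
barycentric coordinate is zero. -/
theorem lagrangeBasis_eq_zero [DecidableEq (E d)] {k : ℕ} {t : ι} {m : E d → ℕ}
    (hm : m ∈ (M.vert t).piAntidiag k) {a x : E d} (ha : m a ≠ 0) (hx : M.bary t a x = 0) :
    lagrangeBasis M k t m x = 0 := by
  refine Finset.prod_eq_zero ((Finset.mem_piAntidiag.1 hm).2 a ha) ?_
  refine Finset.prod_eq_zero (Finset.mem_range.2 (Nat.pos_of_ne_zero ha)) ?_
  simp [hx]

theorem cell_subset_closure_domain (t : ι) : M.cell t ⊆ closure M.domain := by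
  rw [← M.closure_interior_cell t]
  exact closure_mono (M.interior_cell_subset_domain t)

variable [Fintype ι]

open scoped Classical in
/-- The mesh looks the same around all relative interior points of a subsimplex, so that a
subsimplex with a boundary point in its relative interior lies on the boundary of the domain. -/
theorem lagrangeNode_mem_frontier {k : ℕ} (hk : 1 ≤ k) {t : ι} {m : E d → ℕ}
    (hm : m ∈ (M.vert t).piAntidiag k) {x : E d} (hx : x ∈ M.cell t) (hxd : x ∉ M.domain)
    (hpos : ∀ a, m a ≠ 0 → 0 < M.bary t a x) : lagrangeNode M k t m ∈ frontier M.domain := by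
  have hbn := bary_lagrangeNode hk hm
  set ν := lagrangeNode M k t m with hν
  have hνt : ν ∈ M.cell t := M.mem_cell_iff.2 fun a => by rw [hbn]; positivity
  refine ⟨M.cell_subset_closure_domain t hνt, ?_⟩
  rw [M.isOpen_domain.interior_eq]
  intro hνd
  -- a point between `ν` and `x` that is near `ν`, hence inside the domain, and has the same
  -- positive barycentric coordinates as `x`
  obtain ⟨δ, ⟨hδd, hδ1⟩, hδ0⟩ : ∃ δ : ℝ, (ν + δ • (x - ν) ∈ M.domain ∧ δ < 1) ∧ 0 < δ := by
    have hc : Continuous fun δ : ℝ => ν + δ • (x - ν) := by fun_prop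
    have e1 : ∀ᶠ δ : ℝ in 𝓝[>] 0, ν + δ • (x - ν) ∈ M.domain :=
      ((hc.tendsto 0).mono_left nhdsWithin_le_nhds).eventually
        (M.isOpen_domain.mem_nhds (by simpa using hνd))
    have e2 : ∀ᶠ δ : ℝ in 𝓝[>] 0, δ < 1 := nhdsWithin_le_nhds (gt_mem_nhds one_pos)
    exact ((e1.and e2).and self_mem_nhdsWithin).exists
  set y := ν + δ • (x - ν) with hy
  have hyb : ∀ a, M.bary t a y = (1 - δ) * ((m a : ℝ) / k) + δ * M.bary t a x := by
    intro a
    rw [hy, M.bary_add, map_smul, M.baryLin_apply_sub, hbn, smul_eq_mul]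
    ring
  have hyt : y ∈ M.cell t := M.mem_cell_iff.2 fun a => by
    rw [hyb]
    have := M.mem_cell_iff.1 hx a
    have h1 : (0 : ℝ) ≤ 1 - δ := by linarith
    positivity
  have hy0 : ∀ a, M.bary t a y = 0 ↔ M.bary t a x = 0 := by
    intro a
    have h1 : (0 : ℝ) < 1 - δ := by linarith
    have h2 := M.mem_cell_iff.1 hx a
    rw [hyb]
    constructor
    · intro h
      have h3 : 0 ≤ (1 - δ) * ((m a : ℝ) / k) := by positivity
      have h4 : 0 ≤ δ * M.bary t a x := by positivity
      have h5 : δ * M.bary t a x = 0 := by linarith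
      exact (mul_eq_zero.1 h5).resolve_left hδ0.ne'
    · intro h
      have : m a = 0 := by
        by_contra hne
        exact (hpos a hne).ne' h
      rw [h, this]; simp
  -- the subsimplex that carries `x` belongs to every element that contains `y`
  have hyx : ∀ t', y ∈ M.cell t' → ∀ a, M.bary t' a x = M.bary t a x := by
    intro t' hyt' a
    have hsub : ∀ b ∈ M.vert t, b ∉ M.vert t ∩ M.vert t' → M.bary t b x = 0 := by
      intro b hb hb'
      rw [← hy0, M.bary_eq_bary hyt hyt']
      exact M.bary_of_notMem (fun h => hb' (Finset.mem_inter.2 ⟨hb, h⟩)) y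
    have e1 : ∑ b ∈ M.vert t ∩ M.vert t', M.bary t b x = 1 := by
      rw [← M.sum_bary t x]
      exact Finset.sum_subset Finset.inter_subset_left hsub
    have e2 : ∑ b ∈ M.vert t ∩ M.vert t', M.bary t b x • b = x := by
      conv_rhs => rw [← M.sum_bary_smul t x]
      exact Finset.sum_subset Finset.inter_subset_left fun b hb hb' => by
        simp [hsub b hb hb']
    have e3 := M.bary_combination (t := t') Finset.inter_subset_right (fun b => M.bary t b x) e1 a
    rw [e2] at e3
    rw [e3]
    split_ifs with h
    · rfl
    · by_cases ha : a ∈ M.vert t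
      · exact (hsub a ha h).symm
      · exact (M.bary_of_notMem ha x).symm
  -- small translations that move `y` inside the mesh move `x` inside the mesh
  have key : ∀ᶠ h : E d in 𝓝 0, x + h ∈ ⋃ t, M.cell t := by
    have c1 : Tendsto (fun h : E d => y + h) (𝓝 0) (𝓝 y) := by
      have : Continuous fun h : E d => y + h := by fun_prop
      simpa using this.tendsto 0
    have c2 : Tendsto (fun h : E d => x + h) (𝓝 0) (𝓝 x) := by
      have : Continuous fun h : E d => x + h := by fun_prop
      simpa using this.tendsto 0
    have e1 : ∀ᶠ h : E d in 𝓝 0, y + h ∈ ⋃ t, M.cell t :=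
      c1.eventually (mem_interior_iff_mem_nhds.1 hδd)
    have e2 : ∀ᶠ h : E d in 𝓝 0, ∀ t', y ∉ M.cell t' → y + h ∉ M.cell t' := by
      rw [eventually_all]
      intro t'
      by_cases h : y ∈ M.cell t'
      · exact Eventually.of_forall fun _ h' => absurd h h'
      · filter_upwards [c1.eventually ((M.isClosed_cell t').isOpen_compl.mem_nhds h)] with z hz _
        exact hz
    have e3 : ∀ᶠ h : E d in 𝓝 0, ∀ t', ∀ a ∈ M.vert t', 0 < M.bary t' a x →
        0 < M.bary t' a (x + h) := by
      rw [eventually_all]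
      intro t'
      rw [Finset.eventually_all]
      intro a _
      by_cases h : 0 < M.bary t' a x
      · filter_upwards [(((M.continuous_bary t' a).tendsto x).comp c2).eventually
          (lt_mem_nhds h)] with z hz _
        exact hz
      · exact Eventually.of_forall fun _ h' => absurd h' h
    filter_upwards [e1, e2, e3] with h h1 h2 h3
    obtain ⟨t', ht'⟩ := Set.mem_iUnion.1 h1
    have hyt' : y ∈ M.cell t' := by
      by_contra hcon
      exact h2 t' hcon ht'
    refine Set.mem_iUnion.2 ⟨t', M.mem_cell_iff.2 fun a => ?_⟩
    by_cases hpx : 0 < M.bary t' a x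
    · by_cases ha : a ∈ M.vert t'
      · exact (h3 t' a ha hpx).le
      · rw [M.bary_of_notMem ha]
    · have hx0 : M.bary t a x = 0 := by
        rw [hyx t' hyt'] at hpx
        exact le_antisymm (not_lt.1 hpx) (M.mem_cell_iff.1 hx a)
      have hy0' : M.bary t' a y = 0 := by
        rw [← M.bary_eq_bary hyt hyt', hy0, hx0]
      have h4 := M.mem_cell_iff.1 ht' a
      rw [M.bary_add, hy0', zero_add] at h4
      rw [M.bary_add, hyx t' hyt', hx0, zero_add]
      exact h4
  refine hxd (mem_interior_iff_mem_nhds.2 ?_)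
  have hc : Tendsto (fun z : E d => z - x) (𝓝 x) (𝓝 0) := by
    have : Continuous fun z : E d => z - x := by fun_prop
    simpa using this.tendsto x
  filter_upwards [hc.eventually key] with z hz
  simpa using hz

variable (M)

theorem contDiff_oswald (k : ℕ) (p : ι → E d → ℝ) (t : ι) : ContDiff ℝ ∞ (oswald M k p t) := by
  classical
  unfold oswald
  exact ContDiff.sum fun m _ => contDiff_const.mul (M.contDiff_lagrangeBasis k t m)

/-- On the boundary only nodes on the boundary contribute, and there the nodal values are zero. -/
theorem oswald_eq_zero {k : ℕ} (hk : 1 ≤ k) (p : ι → E d → ℝ) {t : ι} {x : E d}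
    (hx : x ∈ M.cell t) (hxd : x ∉ M.domain) : oswald M k p t x = 0 := by
  classical
  refine Finset.sum_eq_zero fun m hm => ?_
  by_cases h : ∃ a, m a ≠ 0 ∧ M.bary t a x = 0
  · obtain ⟨a, h1, h2⟩ := h
    rw [lagrangeBasis_eq_zero hm h1 h2, mul_zero]
  · push Not at h
    rw [oswaldValue, if_pos (lagrangeNode_mem_frontier hk hm hx hxd fun a ha =>
      lt_of_le_of_ne (M.mem_cell_iff.1 hx a) (Ne.symm (h a ha))), zero_mul]

open scoped Classical in
/-- On a common point of two simplices only the nodes of their common subsimplex contribute. -/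
theorem oswald_eq_sum_inter (k : ℕ) (p : ι → E d → ℝ) {t t' : ι} {x : E d}
    (hx : x ∈ M.cell t) (hx' : x ∈ M.cell t') :
    oswald M k p t x = ∑ m ∈ (M.vert t ∩ M.vert t').piAntidiag k,
      oswaldValue M p (∑ a ∈ M.vert t ∩ M.vert t', ((m a : ℝ) / k) • a) *
        ∏ a ∈ M.vert t ∩ M.vert t', ∏ j ∈ Finset.range (m a), (k * M.bary t a x - j) / (j + 1) := by
  have hsub : (M.vert t ∩ M.vert t').piAntidiag k ⊆ (M.vert t).piAntidiag k := by
    intro m hm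
    rw [Finset.mem_piAntidiag] at hm ⊢
    refine ⟨?_, fun a ha => (Finset.mem_inter.1 (hm.2 a ha)).1⟩
    rw [← hm.1]
    refine (Finset.sum_subset Finset.inter_subset_left fun a _ ha => ?_).symm
    by_contra hne
    exact ha (hm.2 a hne)
  unfold oswald
  rw [← Finset.sum_subset hsub]
  · refine Finset.sum_congr rfl fun m hm => ?_
    have h0 : ∀ a ∈ M.vert t, a ∉ M.vert t ∩ M.vert t' → m a = 0 := fun a _ ha => by
      by_contra hne
      exact ha ((Finset.mem_piAntidiag.1 hm).2 a hne)
    congr 1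
    · congr 1
      refine (Finset.sum_subset Finset.inter_subset_left fun a h1 h2 => ?_).symm
      simp [h0 a h1 h2]
    · refine (Finset.prod_subset Finset.inter_subset_left fun a h1 h2 => ?_).symm
      simp [h0 a h1 h2]
  · intro m hm hm'
    obtain ⟨a, ha, hat⟩ : ∃ a, m a ≠ 0 ∧ a ∉ M.vert t' := by
      by_contra hcon
      push Not at hcon
      refine hm' (Finset.mem_piAntidiag.2 ⟨?_, fun a ha => Finset.mem_inter.2
        ⟨(Finset.mem_piAntidiag.1 hm).2 a ha, hcon a ha⟩⟩)
      rw [← (Finset.mem_piAntidiag.1 hm).1]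
      refine Finset.sum_subset Finset.inter_subset_left fun a h1 h2 => ?_
      by_contra hne
      exact h2 (Finset.mem_inter.2 ⟨h1, hcon a hne⟩)
    rw [lagrangeBasis_eq_zero hm ha, mul_zero]
    rw [M.bary_eq_bary hx hx', M.bary_of_notMem hat]

/-- The Oswald interpolant is continuous across faces. -/
theorem oswald_eq_oswald (k : ℕ) (p : ι → E d → ℝ) {t t' : ι} {x : E d}
    (hx : x ∈ M.cell t) (hx' : x ∈ M.cell t') : oswald M k p t x = oswald M k p t' x := by
  classical
  rw [M.oswald_eq_sum_inter k p hx hx', M.oswald_eq_sum_inter k p hx' hx]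
  simp_rw [Finset.inter_comm (M.vert t'), M.bary_eq_bary hx hx']

open scoped Classical in
/-- The Oswald interpolant as a function on the whole space: zero outside of the mesh. -/
def oswaldExt (k : ℕ) (p : ι → E d → ℝ) (x : E d) : ℝ :=
  if h : ∃ t, x ∈ M.cell t then oswald M k p h.choose x else 0

theorem oswaldExt_of_mem (k : ℕ) (p : ι → E d → ℝ) {t : ι} {x : E d} (hx : x ∈ M.cell t) :
    M.oswaldExt k p x = oswald M k p t x := by
  have h : ∃ t, x ∈ M.cell t := ⟨t, hx⟩
  rw [oswaldExt, dif_pos h]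
  exact M.oswald_eq_oswald k p h.choose_spec hx

theorem oswaldExt_eq_zero {k : ℕ} (hk : 1 ≤ k) (p : ι → E d → ℝ) {x : E d} (hx : x ∉ M.domain) :
    M.oswaldExt k p x = 0 := by
  by_cases h : ∃ t, x ∈ M.cell t
  · obtain ⟨t, ht⟩ := h
    rw [M.oswaldExt_of_mem k p ht, M.oswald_eq_zero hk p ht hx]
  · rw [oswaldExt, dif_neg h]

/-- A point near `x` shares an element with `x`, or the extension vanishes at both points. -/
theorem exists_lipschitz_oswaldExt {k : ℕ} (hk : 1 ≤ k) (p : ι → E d → ℝ) :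
    ∃ L : NNReal, LipschitzWith L (M.oswaldExt k p) := by
  have hcell : ∀ t, ∃ C : ℝ, ∀ x ∈ M.cell t, ‖fderiv ℝ (oswald M k p t) x‖ ≤ C := fun t =>
    (M.isCompact_cell t).exists_bound_of_continuousOn
      ((M.contDiff_oswald k p t).continuous_fderiv (by simp)).continuousOn
  choose C hC using hcell
  set L : ℝ := ∑ t, |C t| with hL
  have hL0 : 0 ≤ L := Finset.sum_nonneg fun t _ => abs_nonneg _
  have hCL : ∀ t, C t ≤ L := fun t => (le_abs_self _).trans
    (Finset.single_le_sum (f := fun t => |C t|) (fun t _ => abs_nonneg _) (Finset.mem_univ t))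
  refine ⟨⟨L, hL0⟩, LipschitzWith.of_dist_le_mul fun x y => ?_⟩
  rw [dist_eq_norm, dist_eq_norm]
  refine abs_sub_le_of_eventually (fun x => ?_) y x
  have e1 : ∀ᶠ y in 𝓝 x, ∀ t, y ∈ M.cell t → x ∈ M.cell t := by
    rw [eventually_all]
    intro t
    by_cases h : x ∈ M.cell t
    · exact Eventually.of_forall fun _ _ => h
    · filter_upwards [(M.isClosed_cell t).isOpen_compl.mem_nhds h] with y hy hy'
      exact absurd hy' hy
  have e2 : ∀ᶠ y in 𝓝 x, x ∈ M.domain → y ∈ M.domain := by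
    by_cases h : x ∈ M.domain
    · filter_upwards [M.isOpen_domain.mem_nhds h] with y hy _ using hy
    · exact Eventually.of_forall fun _ h' => absurd h' h
  filter_upwards [e1, e2] with y h1 h2
  by_cases h : ∃ t, y ∈ M.cell t
  · obtain ⟨t, ht⟩ := h
    rw [M.oswaldExt_of_mem k p ht, M.oswaldExt_of_mem k p (h1 t ht)]
    exact (M.convex_cell t).norm_image_sub_le_of_norm_fderiv_le
      (fun z _ => (M.contDiff_oswald k p t).differentiable (by simp) z)
      (fun z hz => (hC t z hz).trans (hCL t)) (h1 t ht) ht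
  · have hy : y ∉ M.domain := fun hy => by
      obtain ⟨t, ht⟩ := Set.mem_iUnion.1 (interior_subset hy)
      exact h ⟨t, ht⟩
    rw [M.oswaldExt_eq_zero hk p hy, M.oswaldExt_eq_zero hk p fun hx => hy (h2 hx), sub_zero,
      abs_zero]
    exact mul_nonneg hL0 (norm_nonneg _)

/-- The Oswald interpolant belongs to `H¹₀`; its weak gradient is the piecewise gradient. -/
theorem isH10_oswald (hd : 0 < d) {k : ℕ} (hk : 1 ≤ k) (p : ι → E d → ℝ) :
    IsH10 M.domain (M.glue (oswald M k p)) (M.glue fun t => gradient (oswald M k p t)) := by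
  obtain ⟨L, hL⟩ := M.exists_lipschitz_oswaldExt hk p
  have h := isH10_of_lipschitz hd M.isOpen_domain M.isBounded_domain hL
    fun x hx => M.oswaldExt_eq_zero hk p hx
  refine h.congr ?_ ?_
  · refine M.ae_domain_of_forall_cell fun t => ?_
    filter_upwards [ae_restrict_mem isOpen_interior.measurableSet] with x hx
    rw [M.glue_of_mem _ hx, M.oswaldExt_of_mem k p (interior_subset hx)]
  · refine M.ae_domain_of_forall_cell fun t => ?_
    filter_upwards [ae_restrict_mem isOpen_interior.measurableSet] with x hx
    rw [M.glue_of_mem _ hx, gradient, gradient]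
    congr 1
    refine EventuallyEq.fderiv_eq ?_
    filter_upwards [isOpen_interior.mem_nhds hx] with y hy
    exact M.oswaldExt_of_mem k p (interior_subset hy)

end NestedMesh

/-! ### Positive definite matrices -/

section Matrices

open Matrix
open scoped MatrixOrder

variable {d : ℕ} {K : Matrix (Fin d) (Fin d) ℝ}

theorem inner_toEuclideanLin_comm (hK : K.IsHermitian) (x y : E d) :
    inner ℝ (toEuclideanLin K x) y = (inner ℝ x (toEuclideanLin K y) : ℝ) :=
  isSymmetric_toEuclideanLin_iff.2 hK x y

theorem inner_toEuclideanLin_nonneg (hK : K.PosSemidef) (x : E d) :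
    0 ≤ (inner ℝ (toEuclideanLin K x) x : ℝ) := by
  have := (isPositive_toEuclideanLin_iff.2 hK).2 x
  simpa using this

theorem toEuclideanLin_mul_apply (K L : Matrix (Fin d) (Fin d) ℝ) (x : E d) :
    toEuclideanLin (K * L) x = toEuclideanLin K (toEuclideanLin L x) := by
  simp [toLpLin_apply, mulVec_mulVec]

theorem sqrt_mul_sqrt (hK : K.PosDef) : CFC.sqrt K * CFC.sqrt K = K :=
  CFC.sqrt_mul_sqrt_self K (nonneg_iff_posSemidef.2 hK.posSemidef)

theorem isHermitian_sqrt (K : Matrix (Fin d) (Fin d) ℝ) : (CFC.sqrt K).IsHermitian :=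
  (nonneg_iff_posSemidef.1 (CFC.sqrt_nonneg K)).isHermitian

theorem isUnit_det_sqrt (hK : K.PosDef) : IsUnit (CFC.sqrt K).det := by
  have h := hK.isUnit
  rw [← sqrt_mul_sqrt hK, isUnit_iff_isUnit_det, det_mul] at h
  exact isUnit_of_mul_isUnit_left h

/-- The square root of a positive definite matrix moves from one factor of an inner product to the
other one. -/
theorem inner_sqrt_inv_sqrt (hK : K.PosDef) (x y : E d) :
    inner ℝ (toEuclideanLin (CFC.sqrt K)⁻¹ x) (toEuclideanLin (CFC.sqrt K) y) =
      (inner ℝ x y : ℝ) := by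
  rw [← inner_toEuclideanLin_comm (isHermitian_sqrt K), ← toEuclideanLin_mul_apply,
    mul_nonsing_inv _ (isUnit_det_sqrt hK)]
  simp

theorem norm_sqrt_sq (hK : K.PosDef) (x : E d) :
    ‖toEuclideanLin (CFC.sqrt K) x‖ ^ 2 = inner ℝ (toEuclideanLin K x) x := by
  rw [← real_inner_self_eq_norm_sq, ← inner_toEuclideanLin_comm (isHermitian_sqrt K),
    ← toEuclideanLin_mul_apply, sqrt_mul_sqrt hK]

theorem sqrt_smul (hK : K.PosDef) {c : ℝ} (hc : 0 < c) :
    CFC.sqrt (c • K) = √c • CFC.sqrt K := by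
  refine CFC.sqrt_unique ?_ ?_
  · rw [smul_mul_smul_comm, Real.mul_self_sqrt hc.le, sqrt_mul_sqrt hK]
  · exact nonneg_iff_posSemidef.2
      ((nonneg_iff_posSemidef.1 (CFC.sqrt_nonneg K)).smul (Real.sqrt_nonneg c))

theorem sqrt_smul_inv (hK : K.PosDef) {c : ℝ} (hc : 0 < c) :
    (CFC.sqrt (c • K))⁻¹ = (√c)⁻¹ • (CFC.sqrt K)⁻¹ := by
  rw [sqrt_smul hK hc]
  have h : √c ≠ 0 := (Real.sqrt_pos.2 hc).ne'
  have := inv_smul' (CFC.sqrt K) (Units.mk0 _ h) (isUnit_det_sqrt hK)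
  exact this

theorem spectrum_nonempty (hd : 0 < d) (hK : K.PosDef) : (spectrum ℝ K).Nonempty := by
  rw [hK.isHermitian.spectrum_real_eq_range_eigenvalues]
  exact ⟨_, ⟨0, hd⟩, rfl⟩

theorem sInf_spectrum_pos (hd : 0 < d) (hK : K.PosDef) : 0 < sInf (spectrum ℝ K) := by
  have hf : (spectrum ℝ K).Finite := by
    rw [hK.isHermitian.spectrum_real_eq_range_eigenvalues]
    exact Set.finite_range _
  have hm := (spectrum_nonempty hd hK).csInf_mem hf
  rw [hK.isHermitian.spectrum_real_eq_range_eigenvalues] at hm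
  obtain ⟨i, hi⟩ := hm
  rw [hK.isHermitian.spectrum_real_eq_range_eigenvalues, ← hi]
  exact hK.eigenvalues_pos i

/-- The Rayleigh quotient is bounded from below by the smallest eigenvalue. -/
theorem sInf_spectrum_mul_le (hK : K.PosDef) (x : E d) :
    sInf (spectrum ℝ K) * ‖x‖ ^ 2 ≤ inner ℝ (toEuclideanLin K x) x := by
  have hf : (spectrum ℝ K).Finite := by
    rw [hK.isHermitian.spectrum_real_eq_range_eigenvalues]
    exact Set.finite_range _
  have h1 : algebraMap ℝ (Matrix (Fin d) (Fin d) ℝ) (sInf (spectrum ℝ K)) ≤ K :=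
    (algebraMap_le_iff_le_spectrum (a := K) hK.isHermitian).2 fun r hr => csInf_le hf.bddBelow hr
  rw [Matrix.le_iff] at h1
  have h2 := inner_toEuclideanLin_nonneg h1 x
  rw [map_sub, LinearMap.sub_apply, inner_sub_left, sub_nonneg] at h2
  refine le_trans (le_of_eq ?_) h2
  rw [Algebra.algebraMap_eq_smul_one, map_smul, LinearMap.smul_apply, inner_smul_left]
  simp

theorem sInf_spectrum_smul (hd : 0 < d) (hK : K.PosDef) {c : ℝ} (hc : 0 ≤ c) :
    sInf (spectrum ℝ (c • K)) = c * sInf (spectrum ℝ K) := by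
  have : Nonempty (Fin d) := ⟨⟨0, hd⟩⟩
  rw [spectrum.smul_eq_smul c K (spectrum_nonempty hd hK), Real.sInf_smul_of_nonneg hc, smul_eq_mul]

end Matrices

/-! ### Bounds for the coefficients -/

namespace Coefficients

variable {d : ℕ} {ι J : Type*} {M : NestedMesh d ι J} {P : Type*} {N : ℕ}
  (A : Coefficients M P N)

@[fun_prop]
theorem measurable_lam (μ : P) (t : ι) : Measurable (A.lam μ t) := by
  unfold lam
  exact Finset.measurable_fun_sum _ fun ξ _ => (A.lamC_measurable ξ t).const_mul _

theorem exists_lam_le (μ : P) : ∃ C : ℝ, ∀ t, ∀ x ∈ M.cell t, A.lam μ t x ≤ C := by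
  obtain ⟨C, hC⟩ := A.lamC_bounded
  exact ⟨∑ ξ, A.θ ξ μ * C, fun t x hx => Finset.sum_le_sum fun ξ _ =>
    mul_le_mul_of_nonneg_left (hC ξ t x hx) (A.θ_pos ξ μ).le⟩

theorem exists_le_lam : ∃ c : ℝ, 0 < c ∧ ∀ μ t, ∀ x ∈ M.cell t, c ≤ A.lam μ t x := A.lam_lower

theorem lam_pos (μ : P) {t : ι} {x : E d} (hx : x ∈ M.cell t) : 0 < A.lam μ t x := by
  obtain ⟨c, hc, h⟩ := A.exists_le_lam
  exact hc.trans_le (h μ t x hx)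

theorem nonempty_fin (A : Coefficients M P N) (μ : P) (t : ι) : Nonempty (Fin N) := by
  obtain ⟨x, hx⟩ := M.interior_cell_nonempty t
  have h := A.lam_pos μ (interior_subset hx)
  by_contra hcon
  rw [not_nonempty_iff] at hcon
  simp [lam] at h

theorem alpha_pos (μ ν : P) (t : ι) : 0 < A.alpha μ ν := by
  have := A.nonempty_fin μ t
  obtain ⟨ξ, hξ⟩ := exists_eq_ciInf_of_finite (f := fun ξ => A.θ ξ μ / A.θ ξ ν)
  rw [alpha, ← hξ]
  exact div_pos (A.θ_pos ξ μ) (A.θ_pos ξ ν)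

theorem gamma_nonneg (μ ν : P) : 0 ≤ A.gamma μ ν :=
  Real.iSup_nonneg fun ξ => (div_pos (A.θ_pos ξ μ) (A.θ_pos ξ ν)).le

theorem alpha_mul_lam_le (μ ν : P) {t : ι} {x : E d} (hx : x ∈ M.cell t) :
    A.alpha μ ν * A.lam ν t x ≤ A.lam μ t x := by
  rw [lam, lam, Finset.mul_sum]
  refine Finset.sum_le_sum fun ξ _ => ?_
  rw [← mul_assoc]
  refine mul_le_mul_of_nonneg_right ?_ (A.lamC_nonneg ξ t x hx)
  rw [← le_div_iff₀ (A.θ_pos ξ ν)]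
  exact ciInf_le (Set.finite_range _).bddBelow ξ

theorem lam_le_gamma_mul (μ ν : P) {t : ι} {x : E d} (hx : x ∈ M.cell t) :
    A.lam μ t x ≤ A.gamma μ ν * A.lam ν t x := by
  rw [lam, lam, Finset.mul_sum]
  refine Finset.sum_le_sum fun ξ _ => ?_
  rw [← mul_assoc]
  refine mul_le_mul_of_nonneg_right ?_ (A.lamC_nonneg ξ t x hx)
  rw [← div_le_iff₀ (A.θ_pos ξ ν)]
  exact le_ciSup (f := fun ξ => A.θ ξ μ / A.θ ξ ν) (Set.finite_range _).bddAbove ξ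

/-- The essential infimum in `cElem` is a genuine one: it is bounded from below by means of a lower
bound `c` of `λ(μ)`, and it is an almost everywhere lower bound for the smallest eigenvalue. -/
theorem cElem_bounds (μ : P) (t : ι) (hd : 0 < d) {c : ℝ}
    (h : ∀ x ∈ M.cell t, c ≤ A.lam μ t x) :
    c * sInf (spectrum ℝ (A.κ t)) ≤ A.cElem μ t ∧
      ∀ᵐ x ∂volume.restrict (M.cell t), A.cElem μ t ≤ A.lam μ t x * sInf (spectrum ℝ (A.κ t)) := by
  have hm := sInf_spectrum_pos hd (A.κ_posDef t)
  obtain ⟨C, hC⟩ := A.exists_lam_le μ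
  set g : E d → ℝ := fun x => sInf (spectrum ℝ (A.lam μ t x • A.κ t)) with hg
  have hcell : ∀ᵐ x ∂volume.restrict (M.cell t), x ∈ M.cell t :=
    ae_restrict_mem (M.isClosed_cell t).measurableSet
  have hgx : ∀ᵐ x ∂volume.restrict (M.cell t), g x = A.lam μ t x * sInf (spectrum ℝ (A.κ t)) := by
    filter_upwards [hcell] with x hx
    exact sInf_spectrum_smul hd (A.κ_posDef t) (A.lam_pos μ hx).le
  have hlow : ∀ᵐ x ∂volume.restrict (M.cell t), c * sInf (spectrum ℝ (A.κ t)) ≤ g x := by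
    filter_upwards [hcell, hgx] with x hx hx'
    rw [hx']
    exact mul_le_mul_of_nonneg_right (h x hx) hm.le
  have hup : ∀ᵐ x ∂volume.restrict (M.cell t), g x ≤ C * sInf (spectrum ℝ (A.κ t)) := by
    filter_upwards [hcell, hgx] with x hx hx'
    rw [hx']
    exact mul_le_mul_of_nonneg_right (hC t x hx) hm.le
  have hne : (ae (volume.restrict (M.cell t))).NeBot := by
    rw [ae_neBot]
    intro h0
    rw [Measure.restrict_eq_zero] at h0
    exact (isOpen_interior.measure_pos volume (M.interior_cell_nonempty t)).ne'
      (measure_mono_null interior_subset h0)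
  have hb : IsBoundedUnder (· ≥ ·) (ae (volume.restrict (M.cell t))) g :=
    ⟨_, eventually_map.2 hlow⟩
  have hcb : IsCoboundedUnder (· ≥ ·) (ae (volume.restrict (M.cell t))) g :=
    IsBoundedUnder.isCoboundedUnder_ge ⟨_, eventually_map.2 hup⟩
  refine ⟨le_essInf_of_ae_le _ hlow hcb, ?_⟩
  filter_upwards [ae_essInf_le hb, hgx] with x h1 h2
  rw [← h2]
  exact h1

variable [Fintype ι]

/-- The infimum over all parameters is positive because `λ` is bounded from below uniformly in the
parameter; in particular it is a lower bound of a family that is bounded from below. -/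
theorem cCoarse_pos (μ : P) (hd : 0 < d) (T : J) : 0 < A.cCoarse T ∧
    ∀ t : M.Patch T, A.cCoarse T ≤ A.cElem μ t.1 := by
  obtain ⟨c, hc, h⟩ := A.exists_le_lam
  obtain ⟨t₀, ht₀⟩ := M.coarse_surjective T
  have : Nonempty (M.Patch T) := ⟨⟨t₀, ht₀⟩⟩
  have : Nonempty P := ⟨μ⟩
  have : Finite (M.Patch T) := Subtype.finite
  obtain ⟨t₁, ht₁⟩ := Finite.exists_min fun t : M.Patch T => sInf (spectrum ℝ (A.κ t.1))
  set m := sInf (spectrum ℝ (A.κ t₁.1)) with hm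
  have hm0 : 0 < m := sInf_spectrum_pos hd (A.κ_posDef _)
  have hlow : ∀ (t : M.Patch T) (ν : P), c * m ≤ A.cElem ν t.1 := fun t ν =>
    (mul_le_mul_of_nonneg_left (ht₁ t) hc.le).trans
      (A.cElem_bounds ν t.1 hd (h ν t.1)).1
  refine ⟨(mul_pos hc hm0).trans_le (le_ciInf fun t => le_ciInf fun ν => hlow t ν), fun t => ?_⟩
  refine (ciInf_le ⟨c * m, ?_⟩ t).trans (ciInf_le ⟨c * m, ?_⟩ μ)
  · rintro _ ⟨t, rfl⟩
    exact le_ciInf fun ν => hlow t ν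
  · rintro _ ⟨ν, rfl⟩
    exact hlow t ν

theorem coeff_of_mem (μ : P) {t : ι} {x : E d} (hx : x ∈ interior (M.cell t)) :
    A.coeff μ x = A.lam μ t x • A.κ t := M.glue_of_mem _ hx

theorem toEuclideanLin_coeff (μ : P) {t : ι} {x : E d} (hx : x ∈ interior (M.cell t)) (w : E d) :
    Matrix.toEuclideanLin (A.coeff μ x) w = A.lam μ t x • Matrix.toEuclideanLin (A.κ t) w := by
  rw [A.coeff_of_mem μ hx, map_smul, LinearMap.smul_apply]

theorem coeff_posDef (μ : P) {t : ι} {x : E d} (hx : x ∈ interior (M.cell t)) :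
    (A.coeff μ x).PosDef := by
  rw [A.coeff_of_mem μ hx]
  exact (A.κ_posDef t).smul (A.lam_pos μ (interior_subset hx))

end Coefficients

/-- On each element, a bounded multiple of a linear map acts on `L²`. -/
theorem NestedMesh.memLp_piecewise {d : ℕ} {ι J : Type*} [Fintype ι] (M : NestedMesh d ι J)
    {c : ι → E d → ℝ} (hc : ∀ t, Measurable (c t)) {C : ℝ}
    (hC : ∀ t, ∀ x ∈ M.cell t, |c t x| ≤ C) (L : ι → E d →ₗ[ℝ] E d) {W Z : E d → E d}
    (hW : MemLp W 2 (volume.restrict M.domain))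
    (hZ : ∀ t, ∀ x ∈ interior (M.cell t), Z x = c t x • L t (W x)) :
    MemLp Z 2 (volume.restrict M.domain) := by
  have h1 : MemLp (fun x => ∑ t, (interior (M.cell t)).indicator (c t) x • L t (W x)) 2
      (volume.restrict M.domain) := by
    refine memLp_finsetSum _ fun t _ => ?_
    set L' : E d →L[ℝ] E d := LinearMap.toContinuousLinearMap (L t) with hL'
    have hLW : MemLp (fun x => L' (W x)) 2 (volume.restrict M.domain) := L'.comp_memLp' hW
    refine MemLp.of_le_mul (c := C) hLW ?_ (ae_of_all _ fun x => ?_)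
    · exact ((hc t).indicator isOpen_interior.measurableSet).aestronglyMeasurable.smul hLW.1
    · rw [norm_smul]
      refine mul_le_mul_of_nonneg_right ?_ (norm_nonneg _)
      by_cases hx : x ∈ interior (M.cell t)
      · rw [Set.indicator_of_mem hx]
        exact hC t x (interior_subset hx)
      · rw [Set.indicator_of_notMem hx, norm_zero]
        obtain ⟨y, hy⟩ := M.interior_cell_nonempty t
        exact (abs_nonneg _).trans (hC t y (interior_subset hy))
  refine h1.ae_eq (M.ae_domain_of_forall_cell fun t => ?_)
  filter_upwards [ae_restrict_mem isOpen_interior.measurableSet] with x hx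
  rw [hZ t x hx, Finset.sum_eq_single t, Set.indicator_of_mem hx]
  · intro t' _ htt
    rw [Set.indicator_of_notMem fun h => htt (M.eq_of_mem_interior_cell h (interior_subset hx)),
      zero_smul]
  · simp

/-! ### Broken gradients -/

namespace NestedMesh

variable {d : ℕ} {ι J : Type*} (M : NestedMesh d ι J)

theorem memLp_glue [Fintype ι] {F : Type*} [NormedAddCommGroup F] {q : ι → E d → F}
    (hq : ∀ t, Continuous (q t)) : MemLp (M.glue q) 2 (volume.restrict M.domain) := by
  have : M.glue q = fun x => ∑ t, (interior (M.cell t)).indicator (q t) x := rfl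
  rw [this]
  exact memLp_finsetSum _ fun t _ =>
    (memLp_of_continuous (hq t) M.isBounded_domain).indicator isOpen_interior.measurableSet

/-- `q` is weakly differentiable on each element, and `G` is its broken gradient. -/
structure HasBrokenGrad (q : E d → ℝ) (G : E d → E d) : Prop where
  memLp : MemLp q 2 (volume.restrict M.domain)
  memLp_grad : MemLp G 2 (volume.restrict M.domain)
  isWeakGrad : ∀ t, IsWeakGrad (interior (M.cell t)) q G

variable {M}

namespace HasBrokenGrad

variable {q q' : E d → ℝ} {G G' : E d → E d}

theorem brokenGrad_ae_eq [Fintype ι] (h : M.HasBrokenGrad q G) :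
    M.brokenGrad q =ᵐ[volume.restrict M.domain] G := by
  refine M.ae_domain_of_forall_cell fun t => ?_
  have h1 := weakGrad_ae_eq isOpen_interior (h.isWeakGrad t) (h.memLp_grad.mono_measure
    (Measure.restrict_mono (M.interior_cell_subset_domain t) le_rfl))
  filter_upwards [h1, ae_restrict_mem isOpen_interior.measurableSet] with x hx hxt
  rw [brokenGrad, M.glue_of_mem _ hxt, hx]

theorem sub (h : M.HasBrokenGrad q G) (h' : M.HasBrokenGrad q' G') :
    M.HasBrokenGrad (fun x => q x - q' x) fun x => G x - G' x := by
  refine ⟨h.memLp.sub h'.memLp, h.memLp_grad.sub h'.memLp_grad, fun t => ?_⟩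
  have hm := Measure.restrict_mono (μ := volume) (M.interior_cell_subset_domain t) le_rfl
  exact (h.isWeakGrad t).sub (h'.isWeakGrad t) (h.memLp.mono_measure hm)
    (h'.memLp.mono_measure hm) (h.memLp_grad.mono_measure hm) (h'.memLp_grad.mono_measure hm)

end HasBrokenGrad

theorem hasBrokenGrad_of_isH10 {u : E d → ℝ} {G : E d → E d} (h : IsH10 M.domain u G) :
    M.HasBrokenGrad u G :=
  ⟨h.memLp, h.memLp_grad, fun t => h.isWeakGrad.mono (M.interior_cell_subset_domain t)⟩

theorem hasBrokenGrad_glue [Fintype ι] {q : ι → E d → ℝ} (hq : ∀ t, ContDiff ℝ 1 (q t)) :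
    M.HasBrokenGrad (M.glue q) (M.glue fun t => gradient (q t)) := by
  refine ⟨M.memLp_glue fun t => (hq t).continuous,
    M.memLp_glue fun t => continuous_gradient (hq t), fun t φ hφ w => ?_⟩
  have h := isWeakGrad_gradient (U := interior (M.cell t)) (hq t) φ hφ w
  have h1 : ∫ x in interior (M.cell t), M.glue q x * fderiv ℝ φ x w =
      ∫ x in interior (M.cell t), q t x * fderiv ℝ φ x w :=
    setIntegral_congr_fun isOpen_interior.measurableSet fun x hx => by
      simp only [M.glue_of_mem _ hx]
  have h2 : ∫ x in interior (M.cell t), inner ℝ (M.glue (fun t => gradient (q t)) x) w * φ x =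
      ∫ x in interior (M.cell t), inner ℝ (gradient (q t) x) w * φ x :=
    setIntegral_congr_fun isOpen_interior.measurableSet fun x hx => by
      simp only [M.glue_of_mem _ hx]
  rw [h1, h2]
  exact h

end NestedMesh

/-! ### Local conservation -/

section Conservation

variable {d : ℕ} {ι J : Type*} {M : NestedMesh d ι J} {P : Type*} {N : ℕ}
  {A : Coefficients M P N} {D : Discretization J}

open scoped Classical in
/-- The characteristic function of a coarse element as a broken function. -/
def coarseIndicator (M : NestedMesh d ι J) (T : J) (t : ι) (_ : E d) : ℝ :=
  if M.coarse t = T then 1 else 0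

theorem coarseIndicator_congr (T : J) {t t' : ι} (h : M.coarse t = M.coarse t') (x : E d) :
    coarseIndicator M T t x = coarseIndicator M T t' x := by
  by_cases ht : M.coarse t = T
  · simp only [coarseIndicator, if_pos ht, if_pos (h.symm.trans ht)]
  · simp only [coarseIndicator, if_neg ht, if_neg fun h' => ht (h.trans h')]

theorem jump_coarseIndicator (T : J) (e : Finset (E d)) (x : E d) :
    jump M e (coarseIndicator M T) x = jump M e (coarseIndicator M T) 0 := by
  simp only [jump, coarseIndicator]

theorem jump_coarseIndicator_of_isInside (T : J) {e : Finset (E d)} (he : M.IsInside e) (x : E d) :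
    jump M e (coarseIndicator M T) x = 0 := by
  rw [jump, if_pos he.1, sub_eq_zero]
  exact coarseIndicator_congr T he.2 x

theorem bc_coarseIndicator_left (μ : P) (T : J) (e : Finset (E d)) (p : ι → E d → ℝ) :
    bc A D μ e (coarseIndicator M T) p = 0 := by
  have h : ∀ t, gradient (coarseIndicator M T t) = 0 := by
    intro t
    funext x
    have : coarseIndicator M T t = fun _ => coarseIndicator M T t 0 := rfl
    rw [this, gradient, fderiv_fun_const, Pi.zero_apply, map_zero, Pi.zero_apply]
  simp [bc, avgFlux, avg, h, faceIntegral]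

/-- The numerical flux through the face `e` in direction of its normal, as in the face conditions on a
flux reconstruction with `r = 1`. -/
def numFlux (A : Coefficients M P N) (D : Discretization J) (μ : P) (p : ι → E d → ℝ)
    (e : Finset (E d)) : ℝ :=
  faceIntegral e (fun x => -avgFlux A D μ e p x) +
    faceIntegral e fun x => penalty A D μ e x * jump M e p x

theorem bc_add_bp_coarseIndicator (μ : P) (T : J) (e : Finset (E d)) (p : ι → E d → ℝ) :
    bc A D μ e p (coarseIndicator M T) + bp A D μ e (coarseIndicator M T) p =
      jump M e (coarseIndicator M T) 0 * numFlux A D μ p e := by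
  rw [numFlux, mul_add, bc, bp, faceIntegral, faceIntegral, faceIntegral, faceIntegral,
    ← integral_const_mul, ← integral_const_mul]
  simp_rw [jump_coarseIndicator T e]
  congr 1
  · exact integral_congr_ae (ae_of_all _ fun x => mul_comm _ _)
  · exact integral_congr_ae (ae_of_all _ fun x => by ring)

theorem contDiff_of_mem_dgSpace {k : ℕ} {q : ι → E d → ℝ} (hq : q ∈ dgSpace M D k) (t : ι) :
    ContDiff ℝ ∞ (q t) := by
  have h := hq (M.coarse t)
  have h1 : M.restr (M.coarse t) q ∈ dgLocal M k (M.coarse t) := by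
    rw [localSpace] at h
    split at h
    · exact h.1
    · exact h
  exact contDiff_of_mem_polySpace (h1 ⟨t, rfl⟩ trivial)

theorem coarseIndicator_mem_dgSpace (D : Discretization J) (k : ℕ) (T : J) :
    coarseIndicator M T ∈ dgSpace M D k := by
  intro T'
  have h : M.restr T' (coarseIndicator M T) ∈ cgLocal M k T' := by
    exact ⟨fun t _ => const_mem_polySpace d k _,
      fun t t' x _ => coarseIndicator_congr T (t.2.trans t'.2.symm) x⟩
  rw [localSpace]
  split
  · exact h
  · exact h.1

theorem coarseIndicator_mem_reducedSpace (D : Discretization J) (k : ℕ)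
    {Qred : ∀ T : J, Submodule ℝ (M.Patch T → E d → ℝ)} (hone : ∀ T, 1 ∈ Qred T) (T : J) :
    coarseIndicator M T ∈ reducedSpace M D k Qred := by
  refine ⟨coarseIndicator_mem_dgSpace D k T, fun T' => ?_⟩
  by_cases h : T' = T
  · have : M.restr T' (coarseIndicator M T) = 1 := by
      funext t x
      simp [NestedMesh.restr, coarseIndicator, t.2, h]
    rw [this]
    exact hone T'
  · have : M.restr T' (coarseIndicator M T) = 0 := by
      funext t x
      simp [NestedMesh.restr, coarseIndicator, t.2, h]
    rw [this]
    exact zero_mem _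

variable [Fintype ι]

theorem glue_coarseIndicator_of_mem (T : J) {t : ι} {x : E d} (hx : x ∈ interior (M.cell t)) :
    M.glue (coarseIndicator M T) x = coarseIndicator M T t 0 := M.glue_of_mem _ hx

theorem brokenGrad_coarseIndicator (T : J) :
    M.brokenGrad (M.glue (coarseIndicator M T)) =ᵐ[volume.restrict M.domain] 0 := by
  have h := (NestedMesh.hasBrokenGrad_glue (M := M) (q := coarseIndicator M T)
    fun t => contDiff_const).brokenGrad_ae_eq
  refine h.trans (M.ae_domain_of_forall_cell fun t => ?_)
  filter_upwards [ae_restrict_mem isOpen_interior.measurableSet] with x hx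
  have : coarseIndicator M T t = fun _ => coarseIndicator M T t 0 := rfl
  rw [M.glue_of_mem _ hx, this, gradient, fderiv_fun_const, Pi.zero_apply, map_zero, Pi.zero_apply]

theorem weakDiv_spec {U : Set (E d)} {v : E d → E d} (hv : MemHdiv U v) :
    MemLp (weakDiv U v) 2 (volume.restrict U) ∧ IsWeakDiv U v (weakDiv U v) := by
  rw [weakDiv, dif_pos hv.2]
  exact hv.2.choose_spec

/-- The flux through the boundary of a coarse element is the integral of the divergence of the
reconstruction. -/
theorem integral_weakDiv_coarseSet (hd : 0 < d) {l : ℕ} {μ : P} {p : ι → E d → ℝ}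
    {u : ι → E d → E d} (hu : IsFluxReconstruction A D l μ p u) (T : J) :
    ∫ x in M.coarseSet T, weakDiv M.domain (M.glue u) x =
      ∑ e ∈ M.faces, jump M e (coarseIndicator M T) 0 * numFlux A D μ p e := by
  classical
  obtain ⟨⟨hrtn, hdiv⟩, hface, -⟩ := hu
  obtain ⟨hw1, hw2⟩ := weakDiv_spec hdiv
  have hsm : ∀ t, ContDiff ℝ 1 (u t) := fun t =>
    (contDiff_of_mem_rtnSpace (hrtn t)).of_le (by simp)
  have hsum : ∑ e ∈ M.faces, jump M e (coarseIndicator M T) 0 * numFlux A D μ p e = _ :=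
    (M.sum_faceSign_eq_sum_jump hd (fun t => coarseIndicator M T t 0) (numFlux A D μ p) 0).symm
  rw [M.setIntegral_coarseSet T (hw1.integrable one_le_two), hsum]
  refine Finset.sum_congr rfl fun t _ => ?_
  refine congrArg₂ _ (by simp [coarseIndicator]) ?_
  have hae := hw2.ae_eq_divergence hw1 isOpen_interior (M.interior_cell_subset_domain t) (hsm t)
    fun x hx => M.glue_of_mem u hx
  rw [integral_congr_ae hae, setIntegral_congr_set (M.ae_eq_interior_cell t),
    (M.isOutwardNormal t).integral_divergence (hsm t), ← M.sum_erase_eq_sum_powersetCard]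
  refine Finset.sum_congr rfl fun a ha => ?_
  set e := (M.vert t).erase a with he
  have hmem : e ∈ (M.vert t).powersetCard d := by
    rw [Finset.mem_powersetCard, he, Finset.card_erase_of_mem ha, M.card_vert]
    exact ⟨Finset.erase_subset _ _, rfl⟩
  have h1 := hface t e hmem (fun _ => 1) (const_mem_polySpace d l 1)
  simp only [mul_one] at h1
  rw [numFlux, ← h1, faceIntegral, faceIntegral, ← integral_const_mul]
  simp_rw [inner_smul_right]

variable [Fintype J]

/-- The characteristic function of a coarse element has no gradient and no jumps inside of coarse
elements, so that only numerical fluxes through coupling faces remain. -/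
theorem bh_coarseIndicator (μ : P) (T : J) (p : ι → E d → ℝ) :
    bh A D μ p (coarseIndicator M T) =
      ∑ e ∈ M.faces, jump M e (coarseIndicator M T) 0 * numFlux A D μ p e := by
  classical
  have hb : ∀ T', A.bForm μ (M.coarseSet T') (M.glue p) (M.glue (coarseIndicator M T)) = 0 := by
    intro T'
    rw [Coefficients.bForm]
    refine integral_eq_zero_of_ae ?_
    have := ae_restrict_of_ae_restrict_of_subset (M.coarseSet_subset_domain T')
      (brokenGrad_coarseIndicator (M := M) T)
    filter_upwards [this] with x hx
    rw [hx, Pi.zero_apply, inner_zero_right, Pi.zero_apply]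
  have hl : ∀ T', bhLocal A D μ T' p (coarseIndicator M T) = 0 := by
    intro T'
    rw [bhLocal, hb, zero_add]
    refine Finset.sum_eq_zero fun e he => ?_
    have hin : M.IsInside e := (Finset.mem_filter.1 he).2.1
    rw [bc_coarseIndicator_left, mul_zero, zero_add, bc_add_bp_coarseIndicator,
      jump_coarseIndicator_of_isInside T hin, zero_mul]
  rw [bh, Finset.sum_eq_zero fun T' _ => hl T', zero_add, NestedMesh.couplingFaces,
    Finset.sum_filter]
  refine Finset.sum_congr rfl fun e _ => ?_
  by_cases hin : M.IsInside e
  · rw [if_neg (not_not.2 hin), jump_coarseIndicator_of_isInside T hin, zero_mul]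
  · rw [if_pos hin, bc_coarseIndicator_left, zero_add, bc_add_bp_coarseIndicator]

theorem load_coarseIndicator {f : E d → ℝ} (hf : MemLp f 2 (volume.restrict M.domain)) (T : J) :
    load M f (M.glue (coarseIndicator M T)) = ∫ x in M.coarseSet T, f x := by
  classical
  have hg : MemLp (M.glue (coarseIndicator M T)) 2 (volume.restrict M.domain) :=
    M.memLp_glue fun t => continuous_const
  rw [load, M.sum_setIntegral_coarseSet (integrable_mul hf hg),
    M.setIntegral_domain (integrable_mul hf hg),
    M.setIntegral_coarseSet T (hf.integrable one_le_two)]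
  refine Finset.sum_congr rfl fun t _ => ?_
  rw [← integral_const_mul]
  refine setIntegral_congr_fun isOpen_interior.measurableSet fun x hx => ?_
  simp only [glue_coarseIndicator_of_mem T hx, coarseIndicator]
  rw [mul_comm]

/-- Testing with the characteristic function of a coarse element shows that the reconstructed flux
is conservative on this element. -/
theorem integral_residual_eq_zero (hd : 0 < d) {f : E d → ℝ}
    (hf : MemLp f 2 (volume.restrict M.domain)) {l : ℕ} {μ : P} {p : ι → E d → ℝ}
    {u : ι → E d → E d} {Q : Set (ι → E d → ℝ)} (hp : IsGalerkinSolution A D f μ Q p)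
    (hu : IsFluxReconstruction A D l μ p u) {T : J} (hT : coarseIndicator M T ∈ Q) :
    ∫ x in M.coarseSet T, (f x - weakDiv M.domain (M.glue u) x) = 0 := by
  have hsub := Measure.restrict_mono (μ := volume) (M.coarseSet_subset_domain T) le_rfl
  have hw := (weakDiv_spec hu.1.2).1
  rw [integral_sub ((hf.integrable one_le_two).mono_measure hsub)
    ((hw.integrable one_le_two).mono_measure hsub), integral_weakDiv_coarseSet hd hu T,
    ← load_coarseIndicator hf T, ← hp.2 _ hT, bh_coarseIndicator, sub_self]

end Conservation

/-! ### The energy product of vector fields -/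

namespace Coefficients

open Matrix
open scoped MatrixOrder

variable {d : ℕ} {ι J : Type*} {M : NestedMesh d ι J} {P : Type*} {N : ℕ} [Fintype ι]
  (A : Coefficients M P N)

/-- `∫_S (λ(μ) κ V) · W` for vector fields `V` and `W`. -/
def fieldForm (μ : P) (S : Set (E d)) (V W : E d → E d) : ℝ :=
  ∫ x in S, inner ℝ (toEuclideanLin (A.coeff μ x) (V x)) (W x)

variable {A} {V W : E d → E d} {S : Set (E d)}

theorem ae_posDef (μ : P) (hS : S ⊆ M.domain) :
    ∀ᵐ x ∂volume.restrict S, (A.coeff μ x).PosDef := by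
  refine ae_restrict_of_ae_restrict_of_subset hS (M.ae_domain_of_forall_cell fun t => ?_)
  filter_upwards [ae_restrict_mem isOpen_interior.measurableSet] with x hx
  exact A.coeff_posDef μ hx

theorem memLp_coeff (μ : P) (hW : MemLp W 2 (volume.restrict M.domain)) :
    MemLp (fun x => toEuclideanLin (A.coeff μ x) (W x)) 2 (volume.restrict M.domain) := by
  obtain ⟨C, hC⟩ := A.exists_lam_le μ
  refine M.memLp_piecewise (A.measurable_lam μ) (C := C)
    (fun t x hx => ?_) (fun t => toEuclideanLin (A.κ t)) hW
    fun t x hx => A.toEuclideanLin_coeff μ hx (W x)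
  rw [abs_of_pos (A.lam_pos μ hx)]
  exact hC t x hx

theorem memLp_sqrt_coeff (μ : P) (hW : MemLp W 2 (volume.restrict M.domain)) :
    MemLp (fun x => toEuclideanLin (CFC.sqrt (A.coeff μ x)) (W x)) 2
      (volume.restrict M.domain) := by
  obtain ⟨C, hC⟩ := A.exists_lam_le μ
  refine M.memLp_piecewise (c := fun t x => √(A.lam μ t x))
    (fun t => (A.measurable_lam μ t).sqrt) (C := √C)
    (fun t x hx => ?_) (fun t => toEuclideanLin (CFC.sqrt (A.κ t))) hW fun t x hx => ?_
  · rw [abs_of_nonneg (Real.sqrt_nonneg _)]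
    exact Real.sqrt_le_sqrt (hC t x hx)
  · rw [A.coeff_of_mem μ hx, sqrt_smul (A.κ_posDef t) (A.lam_pos μ (interior_subset hx)),
      map_smul, LinearMap.smul_apply]

theorem memLp_sqrt_inv_coeff (μ : P) (hW : MemLp W 2 (volume.restrict M.domain)) :
    MemLp (fun x => toEuclideanLin (CFC.sqrt (A.coeff μ x))⁻¹ (W x)) 2
      (volume.restrict M.domain) := by
  obtain ⟨c, hc, h⟩ := A.exists_le_lam
  refine M.memLp_piecewise (c := fun t x => (√(A.lam μ t x))⁻¹)
    (fun t => (A.measurable_lam μ t).sqrt.inv) (C := (√c)⁻¹)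
    (fun t x hx => ?_) (fun t => toEuclideanLin (CFC.sqrt (A.κ t))⁻¹) hW fun t x hx => ?_
  · rw [abs_of_nonneg (inv_nonneg.2 (Real.sqrt_nonneg _))]
    exact inv_anti₀ (Real.sqrt_pos.2 hc) (Real.sqrt_le_sqrt (h μ t x hx))
  · rw [A.coeff_of_mem μ hx, sqrt_smul_inv (A.κ_posDef t) (A.lam_pos μ (interior_subset hx)),
      map_smul, LinearMap.smul_apply]

theorem integral_norm_sqrt_coeff_sq (μ : P) (hS : S ⊆ M.domain) (W : E d → E d) :
    ∫ x in S, ‖toEuclideanLin (CFC.sqrt (A.coeff μ x)) (W x)‖ ^ 2 = A.fieldForm μ S W W := by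
  refine integral_congr_ae ?_
  filter_upwards [ae_posDef μ hS] with x hx
  exact norm_sqrt_sq hx (W x)

theorem fieldForm_self_nonneg (μ : P) (hS : S ⊆ M.domain) (W : E d → E d) :
    0 ≤ A.fieldForm μ S W W := by
  rw [← integral_norm_sqrt_coeff_sq μ hS]
  exact integral_nonneg fun x => sq_nonneg _

theorem integrable_fieldForm (μ : P) (hS : S ⊆ M.domain)
    (hV : MemLp V 2 (volume.restrict M.domain)) (hW : MemLp W 2 (volume.restrict M.domain)) :
    IntegrableOn (fun x => inner ℝ (toEuclideanLin (A.coeff μ x) (V x)) (W x)) S :=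
  (integrable_inner (memLp_coeff μ hV) hW).mono_measure (Measure.restrict_mono hS le_rfl)

/-- The square root of the coefficient turns a pairing of vector fields into dual weighted
norms. -/
theorem abs_integral_inner_le_fieldForm (μ : P) (hS : S ⊆ M.domain)
    (hV : MemLp V 2 (volume.restrict M.domain)) (hW : MemLp W 2 (volume.restrict M.domain)) :
    |∫ x in S, inner ℝ (V x) (W x)| ≤
      √(∫ x in S, ‖toEuclideanLin (CFC.sqrt (A.coeff μ x))⁻¹ (V x)‖ ^ 2) *
        √(A.fieldForm μ S W W) := by
  have hm := Measure.restrict_mono (μ := volume) hS le_rfl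
  have h := abs_integral_inner_le ((memLp_sqrt_inv_coeff (A := A) μ hV).mono_measure hm)
    ((memLp_sqrt_coeff (A := A) μ hW).mono_measure hm)
  rw [integral_norm_sqrt_coeff_sq μ hS] at h
  refine le_trans (le_of_eq ?_) h
  congr 1
  refine integral_congr_ae ?_
  filter_upwards [ae_posDef (A := A) μ hS] with x hx
  exact (inner_sqrt_inv_sqrt hx (V x) (W x)).symm

theorem abs_fieldForm_le (μ : P) (hS : S ⊆ M.domain)
    (hV : MemLp V 2 (volume.restrict M.domain)) (hW : MemLp W 2 (volume.restrict M.domain)) :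
    |A.fieldForm μ S V W| ≤ √(A.fieldForm μ S V V) * √(A.fieldForm μ S W W) := by
  have hm := Measure.restrict_mono (μ := volume) hS le_rfl
  have h := abs_integral_inner_le ((memLp_sqrt_coeff (A := A) μ hV).mono_measure hm)
    ((memLp_sqrt_coeff (A := A) μ hW).mono_measure hm)
  rw [integral_norm_sqrt_coeff_sq μ hS, integral_norm_sqrt_coeff_sq μ hS] at h
  refine le_trans (le_of_eq ?_) h
  congr 1
  refine integral_congr_ae ?_
  filter_upwards [ae_posDef (A := A) μ hS] with x hx
  rw [inner_toEuclideanLin_comm (isHermitian_sqrt _), ← toEuclideanLin_mul_apply,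
    sqrt_mul_sqrt hx, inner_toEuclideanLin_comm hx.isHermitian]

theorem fieldForm_comm (μ : P) (hS : S ⊆ M.domain) (V W : E d → E d) :
    A.fieldForm μ S V W = A.fieldForm μ S W V := by
  refine integral_congr_ae ?_
  filter_upwards [ae_posDef (A := A) μ hS] with x hx
  rw [inner_toEuclideanLin_comm hx.isHermitian, real_inner_comm]

theorem fieldForm_sub_left (μ : P) (hS : S ⊆ M.domain) {U : E d → E d}
    (hU : MemLp U 2 (volume.restrict M.domain)) (hV : MemLp V 2 (volume.restrict M.domain))
    (hW : MemLp W 2 (volume.restrict M.domain)) :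
    A.fieldForm μ S (fun x => U x - V x) W = A.fieldForm μ S U W - A.fieldForm μ S V W := by
  simp_rw [fieldForm, map_sub, inner_sub_left]
  exact integral_sub (integrable_fieldForm μ hS hU hW) (integrable_fieldForm μ hS hV hW)

theorem fieldForm_sub_self (μ : P) (hS : S ⊆ M.domain)
    (hV : MemLp V 2 (volume.restrict M.domain)) (hW : MemLp W 2 (volume.restrict M.domain)) :
    A.fieldForm μ S (fun x => V x - W x) (fun x => V x - W x) =
      A.fieldForm μ S V V - 2 * A.fieldForm μ S W V + A.fieldForm μ S W W := by
  have hVW : MemLp (fun x => V x - W x) 2 (volume.restrict M.domain) := hV.sub hW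
  rw [fieldForm_sub_left μ hS hV hW hVW, fieldForm_comm μ hS V, fieldForm_comm μ hS W,
    fieldForm_sub_left μ hS hV hW hV, fieldForm_sub_left μ hS hV hW hW, fieldForm_comm μ hS V W]
  ring

theorem alpha_mul_fieldForm_le (μ ν : P) (hS : S ⊆ M.domain)
    (hW : MemLp W 2 (volume.restrict M.domain)) :
    A.alpha μ ν * A.fieldForm ν S W W ≤ A.fieldForm μ S W W := by
  rw [fieldForm, fieldForm, ← integral_const_mul]
  refine integral_mono_ae ((integrable_fieldForm ν hS hW hW).const_mul _)
    (integrable_fieldForm μ hS hW hW) ?_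
  refine ae_restrict_of_ae_restrict_of_subset hS (M.ae_domain_of_forall_cell fun t => ?_)
  filter_upwards [ae_restrict_mem isOpen_interior.measurableSet] with x hx
  simp only [A.toEuclideanLin_coeff _ hx, real_inner_smul_left]
  rw [← mul_assoc]
  exact mul_le_mul_of_nonneg_right (A.alpha_mul_lam_le μ ν (interior_subset hx))
    (inner_toEuclideanLin_nonneg (A.κ_posDef t).posSemidef _)

theorem fieldForm_le_gamma_mul (μ ν : P) (hS : S ⊆ M.domain)
    (hW : MemLp W 2 (volume.restrict M.domain)) :
    A.fieldForm μ S W W ≤ A.gamma μ ν * A.fieldForm ν S W W := by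
  rw [fieldForm, fieldForm, ← integral_const_mul]
  refine integral_mono_ae (integrable_fieldForm μ hS hW hW)
    ((integrable_fieldForm ν hS hW hW).const_mul _) ?_
  refine ae_restrict_of_ae_restrict_of_subset hS (M.ae_domain_of_forall_cell fun t => ?_)
  filter_upwards [ae_restrict_mem isOpen_interior.measurableSet] with x hx
  simp only [A.toEuclideanLin_coeff _ hx, real_inner_smul_left]
  rw [← mul_assoc]
  exact mul_le_mul_of_nonneg_right (A.lam_le_gamma_mul μ ν (interior_subset hx))
    (inner_toEuclideanLin_nonneg (A.κ_posDef t).posSemidef _)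

theorem sqrt_fieldForm_le_of_alpha (μ ν : P) (t : ι) (hS : S ⊆ M.domain)
    (hW : MemLp W 2 (volume.restrict M.domain)) :
    √(A.fieldForm ν S W W) ≤ 1 / √(A.alpha μ ν) * √(A.fieldForm μ S W W) := by
  have hα := A.alpha_pos μ ν t
  rw [one_div, ← div_eq_inv_mul, le_div_iff₀ (Real.sqrt_pos.2 hα), mul_comm,
    ← Real.sqrt_mul hα.le]
  exact Real.sqrt_le_sqrt (alpha_mul_fieldForm_le μ ν hS hW)

theorem sqrt_fieldForm_le_of_gamma (μ ν : P) (hS : S ⊆ M.domain)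
    (hW : MemLp W 2 (volume.restrict M.domain)) :
    √(A.fieldForm μ S W W) ≤ √(A.gamma μ ν) * √(A.fieldForm ν S W W) := by
  rw [← Real.sqrt_mul (A.gamma_nonneg μ ν)]
  exact Real.sqrt_le_sqrt (fieldForm_le_gamma_mul μ ν hS hW)

/-- The energy product controls the `L²` norm with the smallest eigenvalue on the coarse element. -/
theorem cCoarse_mul_integral_le (μ : P) (hd : 0 < d) (T : J)
    (hW : MemLp W 2 (volume.restrict M.domain)) :
    A.cCoarse T * ∫ x in M.coarseSet T, ‖W x‖ ^ 2 ≤ A.fieldForm μ (M.coarseSet T) W W := by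
  have hS := M.coarseSet_subset_domain T
  have hint : IntegrableOn (fun x => ‖W x‖ ^ 2) (M.coarseSet T) :=
    (hW.mono_measure (Measure.restrict_mono hS le_rfl)).integrable_norm_pow two_ne_zero
  rw [fieldForm, ← integral_const_mul]
  refine integral_mono_ae (hint.const_mul _) (integrable_fieldForm μ hS hW hW) ?_
  refine M.ae_coarseSet_of_forall_cell fun t ht => ?_
  obtain ⟨c, hc, h⟩ := A.exists_le_lam
  have h1 := ae_restrict_of_ae_restrict_of_subset (interior_subset (s := M.cell t))
    (A.cElem_bounds μ t hd (h μ t)).2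
  filter_upwards [ae_restrict_mem isOpen_interior.measurableSet, h1] with x hx h2
  simp only [A.toEuclideanLin_coeff _ hx, real_inner_smul_left]
  calc A.cCoarse T * ‖W x‖ ^ 2
      ≤ A.lam μ t x * sInf (spectrum ℝ (A.κ t)) * ‖W x‖ ^ 2 :=
        mul_le_mul_of_nonneg_right (((A.cCoarse_pos μ hd T).2 ⟨t, ht⟩).trans h2) (sq_nonneg _)
    _ ≤ _ := by
        rw [mul_assoc]
        exact mul_le_mul_of_nonneg_left (sInf_spectrum_mul_le (A.κ_posDef t) (W x))
          (A.lam_pos μ (interior_subset hx)).le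

theorem bForm_eq_fieldForm (μ : P) (hS : S ⊆ M.domain) {q q' : E d → ℝ} {G G' : E d → E d}
    (hq : M.HasBrokenGrad q G) (hq' : M.HasBrokenGrad q' G') :
    A.bForm μ S q q' = A.fieldForm μ S G G' := by
  refine integral_congr_ae ?_
  filter_upwards [ae_restrict_of_ae_restrict_of_subset hS hq.brokenGrad_ae_eq,
    ae_restrict_of_ae_restrict_of_subset hS hq'.brokenGrad_ae_eq] with x h1 h2
  rw [h1, h2]

theorem energyLocal_sq (μ : P) (T : J) {q : E d → ℝ} {G : E d → E d}
    (hq : M.HasBrokenGrad q G) :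
    A.energyLocal μ T q ^ 2 = A.fieldForm μ (M.coarseSet T) G G := by
  have hS := M.coarseSet_subset_domain T
  rw [energyLocal, bForm_eq_fieldForm μ hS hq hq, Real.sq_sqrt (fieldForm_self_nonneg μ hS G)]

variable [Fintype J]

theorem sum_fieldForm (μ : P) (hV : MemLp V 2 (volume.restrict M.domain))
    (hW : MemLp W 2 (volume.restrict M.domain)) :
    ∑ T, A.fieldForm μ (M.coarseSet T) V W = A.fieldForm μ M.domain V W :=
  M.sum_setIntegral_coarseSet (integrable_fieldForm μ subset_rfl hV hW)

theorem sqrt_sum_energyLocal_sq (μ : P) {q : E d → ℝ} {G : E d → E d}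
    (hq : M.HasBrokenGrad q G) :
    √(∑ T, A.energyLocal μ T q ^ 2) = √(A.fieldForm μ M.domain G G) := by
  rw [Finset.sum_congr rfl fun T _ => energyLocal_sq μ T hq, sum_fieldForm μ hq.memLp_grad hq.memLp_grad]

end Coefficients

/-! ### The energy norm estimate -/

section Estimate

variable {d : ℕ} {ι J : Type*} {M : NestedMesh d ι J} {P : Type*} {N : ℕ} [Fintype ι]
  {A : Coefficients M P N}

/-- If `a = ‖α‖`, `b = ‖β‖` and `c = ⟨α, β⟩`, then `⟨β - α, β⟩ ≤ R ‖β‖` implies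
`‖β - α‖ ≤ ‖α‖ + R`. -/
theorem sq_sub_le_of_le {a b c R : ℝ} (ha : 0 ≤ a) (hb : 0 ≤ b) (hR : 0 ≤ R) (hc : |c| ≤ a * b)
    (h : b ^ 2 - c ≤ R * b) : b ^ 2 - 2 * c + a ^ 2 ≤ (a + R) ^ 2 := by
  rcases hb.eq_or_lt with rfl | hb
  · have : c = 0 := abs_eq_zero.1 (le_antisymm (by simpa using hc) (abs_nonneg _))
    subst this
    nlinarith
  · obtain ⟨m, rfl⟩ : ∃ m, c = m * b := ⟨c / b, by field_simp⟩
    rw [abs_mul, abs_of_pos hb] at hc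
    have hm : |m| ≤ a := le_of_mul_le_mul_right hc hb
    have h1 : b - m ≤ R := le_of_mul_le_mul_right (by nlinarith) hb
    obtain ⟨h2, h3⟩ := abs_le.1 hm
    have hma : m ^ 2 ≤ a ^ 2 := sq_le_sq' h2 h3
    rcases le_total 0 (b - m) with h0 | h0
    · nlinarith [mul_nonneg ha hR]
    · nlinarith [mul_nonneg ha hR]

/-- The residual has mean value zero on the coarse element, so that the Poincaré inequality
applies. -/
theorem abs_integral_mul_le_of_poincare (hd : 0 < d) (μ : P) (T : J) {C : ℝ} (hC : 0 < C)
    (hP : PoincareOn (M.coarseSet T) C) {φ r : E d → ℝ} {G : E d → E d}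
    (hφ : MemLp φ 2 (volume.restrict M.domain)) (hG : MemLp G 2 (volume.restrict M.domain))
    (hw : IsWeakGrad M.domain φ G) (hr : MemLp r 2 (volume.restrict M.domain))
    (h0 : ∫ x in M.coarseSet T, r x = 0) :
    |∫ x in M.coarseSet T, r x * φ x| ≤
      √(C / A.cCoarse T) * Metric.diam (M.coarseSet T) * √(∫ x in M.coarseSet T, r x ^ 2) *
        √(A.fieldForm μ (M.coarseSet T) G G) := by
  have hS := M.coarseSet_subset_domain T
  have hm := Measure.restrict_mono (μ := volume) hS le_rfl
  have : IsFiniteMeasure (volume.restrict (M.coarseSet T)) := isFiniteMeasure_of_le _ hm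
  have hφT := hφ.mono_measure hm
  have hGT := hG.mono_measure hm
  have hrT := hr.mono_measure hm
  have hwT := hw.mono hS
  set m := ⨍ y in M.coarseSet T, φ y with hmean
  have hφm : MemLp (fun x => φ x - m) 2 (volume.restrict (M.coarseSet T)) :=
    hφT.sub (memLp_const m)
  have h1 : ∫ x in M.coarseSet T, r x * φ x = ∫ x in M.coarseSet T, r x * (φ x - m) := by
    simp_rw [mul_sub]
    rw [integral_sub (integrable_mul hrT hφT) ((hrT.integrable one_le_two).mul_const m),
      integral_mul_const, h0, zero_mul, sub_zero]
  have h2 : ∫ x in M.coarseSet T, ‖weakGrad (M.coarseSet T) φ x‖ ^ 2 =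
      ∫ x in M.coarseSet T, ‖G x‖ ^ 2 := by
    refine integral_congr_ae ?_
    filter_upwards [weakGrad_ae_eq (M.isOpen_coarseSet T) hwT hGT] with x hx
    rw [hx]
  have h3 := hP φ ⟨hφT, G, hGT, hwT⟩
  rw [h2] at h3
  obtain ⟨hc, -⟩ := A.cCoarse_pos μ hd T
  have h4 : ∫ x in M.coarseSet T, ‖G x‖ ^ 2 ≤
      A.fieldForm μ (M.coarseSet T) G G / A.cCoarse T := by
    rw [le_div_iff₀ hc, mul_comm]
    exact Coefficients.cCoarse_mul_integral_le μ hd T hG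
  set D := Metric.diam (M.coarseSet T) with hD
  have hD0 : 0 ≤ D := Metric.diam_nonneg
  have h5 : √(∫ x in M.coarseSet T, (φ x - m) ^ 2) ≤
      √(C / A.cCoarse T) * D * √(A.fieldForm μ (M.coarseSet T) G G) := by
    rw [← Real.sqrt_sq hD0, ← Real.sqrt_mul (by positivity), ← Real.sqrt_mul (by positivity)]
    refine Real.sqrt_le_sqrt (h3.trans ?_)
    calc C * D ^ 2 * ∫ x in M.coarseSet T, ‖G x‖ ^ 2
        ≤ C * D ^ 2 * (A.fieldForm μ (M.coarseSet T) G G / A.cCoarse T) := by gcongr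
      _ = _ := by ring
  rw [h1]
  refine (abs_integral_mul_le hrT hφm).trans ?_
  calc √(∫ x in M.coarseSet T, r x ^ 2) * √(∫ x in M.coarseSet T, (φ x - m) ^ 2)
      ≤ √(∫ x in M.coarseSet T, r x ^ 2) *
        (√(C / A.cCoarse T) * D * √(A.fieldForm μ (M.coarseSet T) G G)) := by gcongr
    _ = _ := by ring

variable [Fintype J]

theorem sum_mul_sqrt_le (a b : J → ℝ) (hb : ∀ T, 0 ≤ b T) :
    ∑ T, a T * √(b T) ≤ √(∑ T, a T ^ 2) * √(∑ T, b T) := by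
  have h := Real.sum_mul_le_sqrt_mul_sqrt Finset.univ a fun T => √(b T)
  simpa only [Real.sq_sqrt (hb _)] using h

/-- The estimate for any conforming `s` and any `H_div`-conforming `v` that is conservative on the
coarse elements. The element `t` only shows that the mesh is nonempty, which makes `α` a minimum
over a nonempty set. -/
theorem energyNorm_le_etaAbstract (hd : 0 < d) (t : ι) {f : E d → ℝ}
    (hf : MemLp f 2 (volume.restrict M.domain)) {CP : J → ℝ} (hCP_pos : ∀ T, 0 < CP T)
    (hCP : ∀ T, PoincareOn (M.coarseSet T) (CP T)) (μ μbar μhat : P) {p q s : E d → ℝ}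
    {Gq Gs v : E d → E d} (hp : IsWeakSolution M A f μ p) (hq : M.HasBrokenGrad q Gq)
    (hs : IsH10 M.domain s Gs) (hv : MemHdiv M.domain v)
    (hcons : ∀ T, ∫ x in M.coarseSet T, (f x - weakDiv M.domain v x) = 0) :
    A.energyNorm μbar (fun x => p x - q x) ≤ etaAbstract A f CP μ μbar μhat q s v := by
  obtain ⟨Gp, hpG⟩ := memH10_iff.1 hp.1
  have hφ := hpG.sub hs
  have hpB := NestedMesh.hasBrokenGrad_of_isH10 (M := M) hpG
  have hsB := NestedMesh.hasBrokenGrad_of_isH10 (M := M) hs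
  have hφB := NestedMesh.hasBrokenGrad_of_isH10 (M := M) hφ
  have hX := hpB.sub hq
  have ha := hq.sub hsB
  obtain ⟨hw1, hw2⟩ := weakDiv_spec hv
  set w := weakDiv M.domain v with hw
  set φ : E d → ℝ := fun x => p x - s x with hφdef
  set Gφ : E d → E d := fun x => Gp x - Gs x with hGφ
  set Ga : E d → E d := fun x => Gq x - Gs x with hGa
  set B := A.fieldForm μ M.domain with hB
  set Z : E d → E d := fun x => Matrix.toEuclideanLin (A.coeff μ x) (Gq x) + v x with hZ
  have hZL : MemLp Z 2 (volume.restrict M.domain) :=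
    (Coefficients.memLp_coeff μ hq.memLp_grad).add hv.1
  have hr : MemLp (fun x => f x - w x) 2 (volume.restrict M.domain) := hf.sub hw1
  have hnn : ∀ (ν : P) T, 0 ≤ A.fieldForm ν (M.coarseSet T) Gφ Gφ := fun ν T =>
    Coefficients.fieldForm_self_nonneg ν (M.coarseSet_subset_domain T) _
  have hαhat := A.alpha_pos μ μhat t
  set R := √(∑ T, etaR A f CP T v ^ 2) +
    1 / √(A.alpha μ μhat) * √(∑ T, etaDF A μ μhat T q v ^ 2) with hR
  have hR0 : 0 ≤ R := by positivity
  -- The error equation, with `v` inserted by means of Green's formula.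
  have herr : B (fun x => Gp x - Gq x) Gφ =
      ∑ T, (∫ x in M.coarseSet T, (f x - w x) * φ x) -
        ∑ T, ∫ x in M.coarseSet T, inner ℝ (Z x) (Gφ x) := by
    have hsol := hp.2 φ (memH10_iff.2 ⟨Gφ, hφ⟩)
    simp_rw [fun T => Coefficients.bForm_eq_fieldForm (A := A) μ (M.coarseSet_subset_domain T)
      hpB hφB] at hsol
    rw [Coefficients.sum_fieldForm μ hpG.memLp_grad hφ.memLp_grad, load,
      M.sum_setIntegral_coarseSet (integrable_mul hf hφ.memLp)] at hsol
    have hgreen := hφ.integral_inner_eq hv.1 hw1 hw2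
    rw [hB, Coefficients.fieldForm_sub_left μ subset_rfl hpG.memLp_grad hq.memLp_grad
      hφ.memLp_grad, hsol, M.sum_setIntegral_coarseSet (integrable_mul hr hφ.memLp),
      M.sum_setIntegral_coarseSet (integrable_inner hZL hφ.memLp_grad)]
    simp_rw [hZ, inner_add_left, sub_mul]
    rw [integral_add (Coefficients.integrable_fieldForm μ subset_rfl hq.memLp_grad hφ.memLp_grad)
      (integrable_inner hv.1 hφ.memLp_grad),
      integral_sub (integrable_mul hf hφ.memLp) (integrable_mul hw1 hφ.memLp), hgreen]
    simp only [Coefficients.fieldForm]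
    ring
  have hres : ∑ T, (∫ x in M.coarseSet T, (f x - w x) * φ x) ≤
      √(∑ T, etaR A f CP T v ^ 2) * √(B Gφ Gφ) := by
    rw [hB, ← Coefficients.sum_fieldForm μ hφ.memLp_grad hφ.memLp_grad]
    refine le_trans (Finset.sum_le_sum fun T _ => ?_) (sum_mul_sqrt_le _ _ (hnn μ))
    exact (le_abs_self _).trans (abs_integral_mul_le_of_poincare hd μ T (hCP_pos T) (hCP T)
      hφ.memLp hφ.memLp_grad hφ.isWeakGrad hr (hcons T))
  have hdf : -∑ T, (∫ x in M.coarseSet T, inner ℝ (Z x) (Gφ x)) ≤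
      1 / √(A.alpha μ μhat) * √(∑ T, etaDF A μ μhat T q v ^ 2) * √(B Gφ Gφ) := by
    have h1 : -∑ T, (∫ x in M.coarseSet T, inner ℝ (Z x) (Gφ x)) ≤
        √(∑ T, etaDF A μ μhat T q v ^ 2) * √(A.fieldForm μhat M.domain Gφ Gφ) := by
      rw [← Coefficients.sum_fieldForm μhat hφ.memLp_grad hφ.memLp_grad, ← Finset.sum_neg_distrib]
      refine le_trans (Finset.sum_le_sum fun T _ => ?_) (sum_mul_sqrt_le _ _ (hnn μhat))
      have hS := M.coarseSet_subset_domain T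
      refine (neg_le_abs _).trans ((Coefficients.abs_integral_inner_le_fieldForm (A := A) μhat hS
        hZL hφ.memLp_grad).trans (le_of_eq ?_))
      rw [etaDF]
      congr 2
      refine integral_congr_ae ?_
      filter_upwards [ae_restrict_of_ae_restrict_of_subset hS hq.brokenGrad_ae_eq] with x hx
      rw [hx]
    have h2 := Coefficients.sqrt_fieldForm_le_of_alpha (A := A) μ μhat t subset_rfl hφ.memLp_grad
    calc _ ≤ _ := h1
      _ ≤ √(∑ T, etaDF A μ μhat T q v ^ 2) * (1 / √(A.alpha μ μhat) * √(B Gφ Gφ)) := by gcongr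
      _ = _ := by ring
  have hmain : B (fun x => Gp x - Gq x) Gφ ≤ R * √(B Gφ Gφ) := by
    rw [herr, hR, add_mul]
    linarith
  -- The error is `φ - a` with `φ = p - s` and `a = q - s`.
  have hXe : (fun x => Gp x - Gq x) = fun x => Gφ x - Ga x := by
    funext x
    simp only [hGφ, hGa]
    abel
  have hB0 : ∀ W, 0 ≤ B W W := Coefficients.fieldForm_self_nonneg μ subset_rfl
  have hCS := Coefficients.abs_fieldForm_le (A := A) μ subset_rfl ha.memLp_grad hφ.memLp_grad
  have hkey : √(B (fun x => Gp x - Gq x) fun x => Gp x - Gq x) ≤ √(B Ga Ga) + R := by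
    rw [hXe, hB, Coefficients.fieldForm_sub_left μ subset_rfl hφ.memLp_grad ha.memLp_grad
      hφ.memLp_grad] at hmain
    rw [hXe, hB, Coefficients.fieldForm_sub_self μ subset_rfl hφ.memLp_grad ha.memLp_grad]
    refine Real.sqrt_le_iff.2 ⟨by positivity, ?_⟩
    have := sq_sub_le_of_le (Real.sqrt_nonneg (B Ga Ga)) (Real.sqrt_nonneg (B Gφ Gφ)) hR0 hCS
      (by rw [Real.sq_sqrt (hB0 _)]; exact hmain)
    rwa [Real.sq_sqrt (hB0 _), Real.sq_sqrt (hB0 _)] at this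
  have hγ := Coefficients.sqrt_fieldForm_le_of_gamma (A := A) μ μbar subset_rfl ha.memLp_grad
  rw [Coefficients.energyNorm, Coefficients.sqrt_sum_energyLocal_sq μbar hX, etaAbstract]
  simp only [etaNC]
  rw [Coefficients.sqrt_sum_energyLocal_sq μbar ha, add_assoc]
  refine (Coefficients.sqrt_fieldForm_le_of_alpha μ μbar t subset_rfl hX.memLp_grad).trans ?_
  refine mul_le_mul_of_nonneg_left (hkey.trans ?_) (by positivity)
  exact add_le_add_left hγ R

theorem energyNorm_le_eta (hd : 0 < d) (t : ι) {f : E d → ℝ}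
    (hf : MemLp f 2 (volume.restrict M.domain)) {D : Discretization J} {k l : ℕ} (hk : 1 ≤ k)
    {CP : J → ℝ} (hCP_pos : ∀ T, 0 < CP T)
    (hCP : ∀ T, PoincareOn (M.coarseSet T) (CP T)) (μ μbar μhat : P) {p : E d → ℝ}
    (hp : IsWeakSolution M A f μ p) {Q : Set (ι → E d → ℝ)} (hQ : Q ⊆ dgSpace M D k)
    (hone : ∀ T, coarseIndicator M T ∈ Q) {q : ι → E d → ℝ} {u : ι → E d → E d}
    (hq : IsGalerkinSolution A D f μ Q q) (hu : IsFluxReconstruction A D l μ q u) :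
    A.energyNorm μbar (fun x => p x - M.glue q x) ≤ eta A f CP k μ μbar μhat q u :=
  energyNorm_le_etaAbstract hd t hf hCP_pos hCP μ μbar μhat hp
    (NestedMesh.hasBrokenGrad_glue fun t =>
      (contDiff_of_mem_dgSpace (hQ hq.1) t).of_le (by simp))
    (M.isH10_oswald hd hk q) hu.1.2 fun T => integral_residual_eq_zero hd hf hq hu (hone T)

end Estimate

end LRBMS

end

theorem mainTheorem3 {d : ℕ} (hd : d = 2 ∨ d = 3) {ι J : Type*} [Fintype ι] [Fintype J]
    (M : LRBMS.NestedMesh d ι J) (hΩ : IsConnected M.domain)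
    {P : Type*} {N : ℕ} (A : LRBMS.Coefficients M P N)
    (f : LRBMS.E d → ℝ) (hf : MemLp f 2 (volume.restrict M.domain))
    (D : LRBMS.Discretization J) (k l : ℕ) (hk : 1 ≤ k) (hkl : k ≤ l + 1) (hlk : l ≤ k)
    (Qred : ∀ T : J, Submodule ℝ (M.Patch T → LRBMS.E d → ℝ))
    (hQred : ∀ T, Qred T ≤ LRBMS.localSpace M D k T) (hone : ∀ T, 1 ∈ Qred T)
    (CP : J → ℝ) (hCP_pos : ∀ T, 0 < CP T) (hCP : ∀ T, LRBMS.PoincareOn (M.coarseSet T) (CP T))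
    (μ μbar μhat : P) (p : LRBMS.E d → ℝ) (hp : LRBMS.IsWeakSolution M A f μ p) :
    (∀ (ph : ι → LRBMS.E d → ℝ) (uh : ι → LRBMS.E d → LRBMS.E d),
      LRBMS.IsGalerkinSolution A D f μ (LRBMS.dgSpace M D k) ph →
      LRBMS.IsFluxReconstruction A D l μ ph uh →
        A.energyNorm μbar (fun x => p x - M.glue ph x)
          ≤ LRBMS.eta A f CP k μ μbar μhat ph uh) ∧
    (∀ (pred : ι → LRBMS.E d → ℝ) (ured : ι → LRBMS.E d → LRBMS.E d),
      LRBMS.IsGalerkinSolution A D f μ (LRBMS.reducedSpace M D k Qred) pred →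
      LRBMS.IsFluxReconstruction A D l μ pred ured →
        A.energyNorm μbar (fun x => p x - M.glue pred x)
          ≤ LRBMS.eta A f CP k μ μbar μhat pred ured) := by
  have hd0 : 0 < d := by omega
  obtain ⟨x, hx⟩ := hΩ.nonempty
  obtain ⟨t, -⟩ := Set.mem_iUnion.1 (interior_subset hx)
  exact ⟨fun ph uh hph huh => LRBMS.energyNorm_le_eta hd0 t hf hk hCP_pos hCP μ μbar μhat hp
      subset_rfl (LRBMS.coarseIndicator_mem_dgSpace D k) hph huh,
    fun pred ured hpred hured => LRBMS.energyNorm_le_eta hd0 t hf hk hCP_pos hCP μ μbar μhat hp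
      (fun q hq => hq.1) (LRBMS.coarseIndicator_mem_reducedSpace D k hone) hpred hured⟩
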